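/- **Setting.** Let $\mathbf{k}=(k_1,\dots,k_r)$ be a non-empty sequence of positive integers. $\mathrm{Path}(\mathbf{k})$ (respectively, for $r$ even, $\mathrm{Cycle}(\mathbf{k})$) is the directed acyclic multigraph $G$ with one source $s$, one sink $t$ and inner vertices $1,2,\dots,n$, where $n=k_1+\dots+k_r+1$ (respectively $n=k_1+\dots+k_r$), built as follows. Inner edges join consecutive vertices $i,i+1$ (in the cycle case also $n$ and $1$) and are cut, in this order, into $r$ legs of lengths $k_1,\dots,k_r$; the edges of the odd-numbered legs are directed forward ($i\to i+1$) and labelled $2$, those of the even-numbered legs are directed backward and labelled $1$. Edges $s\to i$ and $i\to t$ labelled $1$ or $2$ are added so that every inner vertex has exactly one incoming and exactly one outgoing edge of each label. Up to the choice of numbering and labels, these are the locally anti-blocking framed DAGs with connected inner graph having at least one edge. A *route* is a directed path from $s$ to $t$. Two routes $R,S$ are *in conflict* if they have a common subroute (possibly a single inner vertex) such that one of the two routes enters it by an edge of label $1$ and leaves it by an edge of label $2$, while the other enters it by an edge of label $2$ and leaves it by an edge of label $1$. Otherwise they are *coherent*. A route is *exceptional* if it is coherent with every route; an exceptional route is *short*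 if it has exactly two edges and *long* otherwise. The $\mathbf{g}$-vector $\mathbf{g}(R)\in\mathbb{R}^n$ has $v$-th coordinate $-1$ if $R$ enters $v$ with label $1$ and leaves it with label $2$, $+1$ if it enters with label $2$ and leaves with label $1$, and $0$ otherwise. $P$ is the convex hull of the $\mathbf{g}$-vectors of all routes. Faces of $P$ (including $P$), facets and edges are those of the polytope; "the minimal face containing $R$ and $S$" is the smallest face containing $\mathbf{g}(R)$ and $\mathbf{g}(S)$, and "the segment from $R$ to $S$" is the one from $\mathbf{g}(R)$ to $\mathbf{g}(S)$. In $\mathrm{Cycle}(k_1,k_2)$, the eight routes whose edges lie in the union of the two long exceptional routes are called *anomalous*; in all other cases no route is anomalous. **Coherence diagram.** A source or sink edge at the inner vertex $i$ is named $i$ if it lies on a short exceptional route; otherwise a source edge is named $i^-$ if its label is $2$ and $i^+$ if its label is $1$, and a sink edge is named $i^+$ if its label is $2$ and $i^-$ if its label is $1$. Names are ordered $1^-<1<1^+<2^-<2<2^+<\cdots$. Rows of the diagram are indexed, top to bottom, by the source edges and columns, left to right, by the sink edges; each route has a box in the row of its source edge and the column of its sink edge. In the cycle case the two source edges at vertex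 $1$ index two additional rows at the bottom as well, which hold the routes with such a source edge that run along the last leg (labelled $1$), and the right ends of the two bottom rows are glued to the left ends of the two top rows. $\mathrm{North}(R),\mathrm{South}(R)$ are the sets of boxes above and below $R$ in its column, $\mathrm{West}(R),\mathrm{East}(R)$ the sets of boxes to the left and to the right of $R$ in its row, continued across the gluing. A route $R'$ lies in $\mathrm{NW}(R)$ if there are $T_1\in \mathrm{West}(R)\cap \mathrm{South}(R')$ and $T_2\in \mathrm{North}(R)\cap \mathrm{East}(R')$; in $\mathrm{NE}(R)$ if there are $T_1\in \mathrm{East}(R)\cap \mathrm{South}(R')$ and $T_2\in \mathrm{North}(R)\cap \mathrm{West}(R')$; in $\mathrm{SW}(R)$ if there are $T_1\in \mathrm{West}(R)\cap \mathrm{North}(R')$ and $T_2\in \mathrm{South}(R)\cap \mathrm{East}(R')$; and in $\mathrm{SE}(R)$ if there are $T_1\in \mathrm{East}(R)\cap \mathrm{North}(R')$ and $T_2\in \mathrm{South}(R)\cap \mathrm{West}(R')$. If one of $R,S$ is northwest of the other, with corners $T_1,T_2$ as above, the *2-by-2 array* subtended by $R$ and $S$ is $\{R,S,T_1,T_2\}$.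 **Lemma (The Coherence Lemma).** Let $R$ and $S$ be routes of $G$. (i) Suppose that both $R$ and $S$ are anomalous. (a) $S\in \mathrm{NW}(R)\cup \mathrm{SE}(R)$ if and only if $R$ and $S$ are in conflict, and in this case $P$ is the minimal face containing $R$ and $S$. (b) Suppose that $R$ and $S$ are coherent. If one of them is exceptional, then the minimal face containing them is $P$. Otherwise, the minimal face containing them is the segment from $R$ to $S$, which is an edge of $P$ if $R\ne S$. (ii) Suppose that $R$ and $S$ are not both anomalous. Then each of the intersections of $\mathrm{West}(R)$ or $\mathrm{East}(R)$ with $\mathrm{North}(S)$ or $\mathrm{South}(S)$, and of $\mathrm{North}(R)$ or $\mathrm{South}(R)$ with $\mathrm{West}(S)$ or $\mathrm{East}(S)$, has at most one element, so that the corners $T_1,T_2$ above are unique. Moreover: (a) $S\in \mathrm{NW}(R)\cup \mathrm{SE}(R)$ if and only if $S$ is in conflict with $R$. In this case, let $\{R,S,T_1,T_2\}$ be the 2-by-2 array subtended by $R$ and $S$. If $T_1$ or $T_2$ is exceptional, then $R$ and $S$ lie on different facets of $P$ (each lies on a facet, no facet contains both, and the minimal face containing them is $P$). Otherwise, the convex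 hull of the $\mathbf{g}$-vectors of $R,S,T_1,T_2$ is the minimal face of $P$ containing $R$ and $S$. (b) If $S\in \mathrm{NE}(R)\cup \mathrm{SW}(R)$, then $S$ is coherent with $R$ and the segment from $R$ to $S$ is not an edge of $P$. The converse holds if $R\neq S$ and neither $R$ nor $S$ is exceptional. (c) If $S$ is coherent with $R$ and the segment from $R$ to $S$ is an edge of $P$, then $S$ lies outside $\mathrm{NW}(R)\cup \mathrm{NE}(R)\cup \mathrm{SE}(R)\cup \mathrm{SW}(R)$. The converse holds if $R\neq S$ and neither $R$ nor $S$ is exceptional. -/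

import Mathlib

/-! ### Framed DAGs, routes, coherence and `g`-polytopes

All DAGs here have one source, one sink, and a set of inner vertices. An ample framing is given by
a labelling of the edges by `1` and `2`; the framing order at an inner vertex compares the labels.
-/

/-- The vertices of a DAG with one source, one sink and inner vertices `V`. -/
inductive DagVertex (V : Type) : Type
  | source : DagVertex V
  | inner (v : V) : DagVertex V
  | sink : DagVertex V

/-- A directed multigraph on `DagVertex V` whose edges carry framing labels in `{1, 2}`:
the label of `e` is `2` if `isTwo e = true` and `1` if `isTwo e = false`
(so that `false < true` is `1 < 2`). -/
structure FramedDag (V : Type) where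
  Edge : Type
  tail : Edge → DagVertex V
  head : Edge → DagVertex V
  isTwo : Edge → Bool

namespace FramedDag

variable {V : Type} {G : FramedDag V}

/-- A route: a directed path from the source to the sink, as its list of edges. -/
@[ext]
structure Route (G : FramedDag V) where
  edges : List G.Edge
  ne_nil : edges ≠ []
  chain : edges.IsChain (fun e f => G.head e = G.tail f)
  start : G.tail (edges.head ne_nil) = DagVertex.source
  finish : G.head (edges.getLast ne_nil) = DagVertex.sink

/-- The source-adjacent edge of a route. -/
def Route.first (R : Route G) : G.Edge := R.edges.head R.ne_nil

/-- The sink-adjacent edge of a route. -/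
def Route.last (R : Route G) : G.Edge := R.edges.getLast R.ne_nil

/-- `R` and `S` are in conflict: they share a subroute with edge list `c` (possibly just a vertex),
which `R` enters by `e` and leaves by `f`, and which `S` enters by `e'` and leaves by `f'`, such
that the framing orders `e, e'` and `f, f'` strictly and in opposite ways. -/
def Conflict (R S : Route G) : Prop :=
  ∃ (e e' f f' : G.Edge) (c : List G.Edge),
    (e :: c ++ [f]) <:+: R.edges ∧ (e' :: c ++ [f']) <:+: S.edges ∧ G.head e = G.head e' ∧
      ((G.isTwo e < G.isTwo e' ∧ G.isTwo f' < G.isTwo f) ∨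
        (G.isTwo e' < G.isTwo e ∧ G.isTwo f < G.isTwo f'))

/-- `R` and `S` are coherent: they are in conflict at no common subroute. -/
def Coherent (R S : Route G) : Prop := ¬ Conflict R S

/-- A route is exceptional if it is coherent with every route. -/
def IsExceptional (R : Route G) : Prop := ∀ S : Route G, Coherent R S

/-- An exceptional route is short if it has exactly two edges, and long otherwise. -/
def IsLongExceptional (R : Route G) : Prop := IsExceptional R ∧ R.edges.length ≠ 2

open Classical in
/-- The `g`-vector of a route: at the inner vertex `v` it is `-1` if the route enters `v` by an
edge labelled `1` and leaves by an edge labelled `2`, it is `1` if the route enters `v` by an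
edge labelled `2` and leaves by an edge labelled `1`, and it is `0` otherwise. -/
noncomputable def gVec (R : Route G) : V → ℝ := fun v =>
  if ∃ e f, [e, f] <:+: R.edges ∧ G.head e = DagVertex.inner v ∧
      G.isTwo e = false ∧ G.isTwo f = true then -1
  else if ∃ e f, [e, f] <:+: R.edges ∧ G.head e = DagVertex.inner v ∧
      G.isTwo e = true ∧ G.isTwo f = false then 1
  else 0

/-- The `g`-polytope: the convex hull of the `g`-vectors of all routes. -/
noncomputable def gPolytope (G : FramedDag V) : Set (V → ℝ) :=
  convexHull ℝ (Set.range (gVec (G := G)))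

end FramedDag

/-! ### Faces of polytopes -/

/-- `F` is the minimal face of the polytope `P` that contains `X`. The faces of a polytope are
its exposed subsets (`P` itself included). -/
def IsMinimalFace {V : Type} (P X F : Set (V → ℝ)) : Prop :=
  IsLeast {F' : Set (V → ℝ) | IsExposed ℝ P F' ∧ X ⊆ F'} F

/-- The facets of a polytope: its maximal proper faces. -/
def IsFacet {V : Type} (P F : Set (V → ℝ)) : Prop :=
  Maximal (fun F' : Set (V → ℝ) => IsExposed ℝ P F' ∧ F' ≠ P) F

/-- The line segment from `x` to `y` is an edge (a one-dimensional face) of the polytope `P`. -/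
def IsEdge {V : Type} (P : Set (V → ℝ)) (x y : V → ℝ) : Prop :=
  x ≠ y ∧ IsExposed ℝ P (segment ℝ x y)

/-! ### Path and cycle DAGs with the lab framing -/

/-- The index (from `0`) of the block that contains `j` when `0, 1, 2, …` is cut into consecutive
blocks of the lengths in the list. -/
def blockIndex : List ℕ → ℕ → ℕ
  | [], _ => 0
  | a :: k, j => if j < a then 0 else blockIndex k (j - a) + 1

/-- The data of `Path(k)` (`cyclic = false`) or `Cycle(k)` (`cyclic = true`): a non-empty sequence
of positive leg lengths, of even length in the cyclic case. -/
structure LabShape where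
  cyclic : Bool
  k : List ℕ
  k_ne_nil : k ≠ []
  k_pos : ∀ a ∈ k, 0 < a
  even_of_cyclic : cyclic = true → Even k.length

namespace LabShape

variable (D : LabShape)

/-- The number of edges of the inner graph. -/
def numSteps : ℕ := D.k.sum

/-- The number of inner vertices. The vertex that is called `i + 1` on paper is `i : Fin numInner`.
-/
def numInner : ℕ := if D.cyclic then D.k.sum else D.k.sum + 1

theorem numSteps_pos : 0 < D.numSteps := by
  obtain ⟨a, ha⟩ := List.exists_mem_of_ne_nil _ D.k_ne_nil
  exact lt_of_lt_of_le (D.k_pos a ha) (List.le_sum_of_mem ha)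

theorem numSteps_le_numInner : D.numSteps ≤ D.numInner := by
  unfold numSteps numInner
  split <;> omega

theorem numInner_pos : 0 < D.numInner :=
  lt_of_lt_of_le D.numSteps_pos D.numSteps_le_numInner

/-- The `j`-th edge of the inner graph joins the `j`-th inner vertex to the next one (cyclically in
the cyclic case); `left j` is the former of the two. -/
def left (j : Fin D.numSteps) : Fin D.numInner := ⟨j, j.2.trans_le D.numSteps_le_numInner⟩

/-- The other end of the `j`-th edge of the inner graph, the vertex after `left j`. -/
def right (j : Fin D.numSteps) : Fin D.numInner :=
  ⟨(j + 1) % D.numInner, Nat.mod_lt _ D.numInner_pos⟩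

/-- The edges of the first, third, fifth, … leg are directed from `left` to `right`, those of the
other legs from `right` to `left`. -/
def isForward (j : Fin D.numSteps) : Bool := decide (Even (blockIndex D.k j))

/-- The initial vertex of an inner edge. -/
def stepTail (j : Fin D.numSteps) : Fin D.numInner :=
  if D.isForward j then D.left j else D.right j

/-- The final vertex of an inner edge. -/
def stepHead (j : Fin D.numSteps) : Fin D.numInner :=
  if D.isForward j then D.right j else D.left j

/-- No inner edge with the label `c` (`true` for `2`) ends at `v`. -/
def NeedsSource (v : Fin D.numInner) (c : Bool) : Prop :=
  ∀ j, D.stepHead j = v → D.isForward j ≠ c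

/-- No inner edge with the label `c` (`true` for `2`) starts at `v`. -/
def NeedsSink (v : Fin D.numInner) (c : Bool) : Prop :=
  ∀ j, D.stepTail j = v → D.isForward j ≠ c

/-- The edges of `Path(k)` or `Cycle(k)`. Source and sink edges are added so that every inner
vertex has exactly one incoming and exactly one outgoing edge of each label. -/
inductive LabEdge : Type
  | step (j : Fin D.numSteps) : LabEdge
  | fromSource (v : Fin D.numInner) (c : Bool) (h : D.NeedsSource v c) : LabEdge
  | toSink (v : Fin D.numInner) (c : Bool) (h : D.NeedsSink v c) : LabEdge

/-- `Path(k)` or `Cycle(k)` with the lab framing: the inner edges of the first, third, … leg are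
labelled `2`, those of the other legs are labelled `1`. -/
def dag : FramedDag (Fin D.numInner) where
  Edge := D.LabEdge
  tail
    | .step j => .inner (D.stepTail j)
    | .fromSource _ _ _ => .source
    | .toSink v _ _ => .inner v
  head
    | .step j => .inner (D.stepHead j)
    | .fromSource v _ _ => .inner v
    | .toSink _ _ _ => .sink
  isTwo
    | .step j => D.isForward j
    | .fromSource _ c _ => c
    | .toSink _ c _ => c

/-- The routes of `Path(k)` or `Cycle(k)`. -/
abbrev LabRoute : Type := FramedDag.Route D.dag

/-- The anomalous routes: in `Cycle(k₁, k₂)`, the routes contained in the edge union of the long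
exceptional routes. -/
def IsAnomalous (R : D.LabRoute) : Prop :=
  D.cyclic = true ∧ D.k.length = 2 ∧
    ∀ e ∈ R.edges, ∃ L : D.LabRoute, FramedDag.IsLongExceptional L ∧ e ∈ L.edges

/-! ### The coherence diagram -/

open Classical in
/-- The position of a source edge at vertex `i` in the order
`1⁻ < 1 < 1⁺ < 2⁻ < 2 < 2⁺ < ⋯` of edge names, with `i⁻, i, i⁺` at `3 i - 1, 3 i, 3 i + 1`.
The edge is named `i` if it lies on a short exceptional route, that is, if there is a sink edge with
the same label at the same vertex; otherwise it is named `i⁻` if its label is `2` and `i⁺` if its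
label is `1`. -/
noncomputable def sourceRank : D.LabEdge → ℤ
  | .fromSource v c _ =>
      3 * ((v : ℤ) + 1) + (if D.NeedsSink v c then 0 else if c then -1 else 1)
  | _ => 0

open Classical in
/-- The position of a sink edge at vertex `i` in the same order. The edge is named `i` if it lies on
a short exceptional route, that is, if there is a source edge with the same label at the same vertex;
otherwise it is named `i⁺` if its label is `2` and `i⁻` if its label is `1`. -/
noncomputable def sinkRank : D.LabEdge → ℤ
  | .toSink v c _ =>
      3 * ((v : ℤ) + 1) + (if D.NeedsSource v c then 0 else if c then 1 else -1)
  | _ => 0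

/-- In a cycle, the routes on a leg labelled `1` whose source edge is at the first vertex are placed
in the two additional rows at the bottom of the diagram. -/
def InBottomRows (R : D.LabRoute) : Prop :=
  D.cyclic = true ∧
    (D.dag.head R.first = DagVertex.inner ⟨0, D.numInner_pos⟩) ∧
    ∃ j, D.isForward j = false ∧ LabEdge.step j ∈ R.edges

open Classical in
/-- The row of the box of a route, numbered from top to bottom. The two additional rows of a cycle
have the numbers that a first vertex repeated after the last vertex would give them. -/
noncomputable def rowIndex (R : D.LabRoute) : ℤ :=
  D.sourceRank R.first + (if D.InBottomRows R then 3 * (D.numInner : ℤ) else 0)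

/-- The column of the box of a route, numbered from left to right. -/
noncomputable def colIndex (R : D.LabRoute) : ℤ := D.sinkRank R.last

/-- For routes with the same source edge: the box of `T` is to the right of the box of `R`. The right
ends of the two bottom rows of a cycle are glued to the left ends of the two top rows. -/
def IsRightOf (T R : D.LabRoute) : Prop :=
  (D.InBottomRows R ∧ ¬ D.InBottomRows T) ∨
    ((D.InBottomRows R ↔ D.InBottomRows T) ∧ D.colIndex R < D.colIndex T)

/-- The boxes above `R` in its column. -/
def north (R : D.LabRoute) : Set D.LabRoute :=
  {T | T.last = R.last ∧ D.rowIndex T < D.rowIndex R}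

/-- The boxes below `R` in its column. -/
def south (R : D.LabRoute) : Set D.LabRoute :=
  {T | T.last = R.last ∧ D.rowIndex R < D.rowIndex T}

/-- The boxes to the right of `R` in its row, continued across the line of identification. -/
def east (R : D.LabRoute) : Set D.LabRoute :=
  {T | T.first = R.first ∧ D.IsRightOf T R}

/-- The boxes to the left of `R` in its row, continued across the line of identification. -/
def west (R : D.LabRoute) : Set D.LabRoute :=
  {T | T.first = R.first ∧ D.IsRightOf R T}

/-- The routes northwest of `R`. -/
def NW (R : D.LabRoute) : Set D.LabRoute :=
  {R' | ∃ T₁ T₂, T₁ ∈ D.west R ∩ D.south R' ∧ T₂ ∈ D.north R ∩ D.east R'}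

/-- The routes northeast of `R`. -/
def NE (R : D.LabRoute) : Set D.LabRoute :=
  {R' | ∃ T₁ T₂, T₁ ∈ D.east R ∩ D.south R' ∧ T₂ ∈ D.north R ∩ D.west R'}

/-- The routes southwest of `R`. -/
def SW (R : D.LabRoute) : Set D.LabRoute :=
  {R' | ∃ T₁ T₂, T₁ ∈ D.west R ∩ D.north R' ∧ T₂ ∈ D.south R ∩ D.east R'}

/-- The routes southeast of `R`. -/
def SE (R : D.LabRoute) : Set D.LabRoute :=
  {R' | ∃ T₁ T₂, T₁ ∈ D.east R ∩ D.north R' ∧ T₂ ∈ D.south R ∩ D.west R'}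

/-- `R` is northwest of `S`, and `T₁`, `T₂` are the two other corners of the rectangle: the
2-by-2 array subtended by `R` and `S` is `{R, S, T₁, T₂}`. -/
def IsArray (R S T₁ T₂ : D.LabRoute) : Prop :=
  T₁ ∈ D.west S ∩ D.south R ∧ T₂ ∈ D.north S ∩ D.east R

end LabShape

/-! ### Blocks of a sequence of leg lengths -/

/-! Where two legs meet, both inner edges point in or both point out, so a route never leaves the
leg on which it starts: it is an interval in a leg. Extend the leg with vertices `s, …, e` by a
point at each end, number the points `s, …, e + 2` so that vertex `x` is the point `x + 1`, and
describe the route by two points `u ≤ w`. An endpoint strictly between `s` and `e + 2` is a vertex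
where the label changes; `s` and `e + 2` record that the end edge has the label of the leg. Then the
`g`-vector is the basis vector at `w` minus the one at `u`, where the two added points count as zero
(`gVec_route`). Points and whole legs have `g`-vector `0`; they are the exceptional routes.

Two routes are in conflict if and only if their intervals cross on one leg, or, on consecutive legs,
one ends and the other begins with a label change at the common vertex (`conflict_iff`). A row or a
column of the diagram fixes one end edge, so moving along it moves one endpoint, or passes to a
neighbouring leg through a shared end edge. Hence, apart from pairs of anomalous routes, northwest
and southeast mean crossing, northeast and southwest mean nesting, and the corners `T₁`, `T₂` arise
by exchanging endpoints (`corner_of_isArray`, `nestCorner_of_NE`). This gives `g(R) + g(S) = g(T₁) +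
g(T₂)`, so every face with `R` and `S` contains the corners (`mem_face`). As `P` contains the unit
vectors and their negatives, a face with the origin is `P`; this settles the case of an exceptional
corner. For a nested pair the identity shows that the segment is not an edge.

It remains to find small faces. An integer function on the vertices, its height, has on a route the
value height at `w` minus height at `u`. Explicit heights attain their maximum `6` exactly on a
coherent, non-nested pair of non-exceptional routes (`supported_pair`), or exactly on the four
routes of an array without exceptional corner (`supported_corner`). On different legs two such
heights interact only at junctions of the legs, and coherence and non-nesting say that they do not
disagree in sign there.

In a cycle with two legs each leg follows the other, and routes on different legs can share both end
edges. This affects only routes both of whose endpoints are at the ends of the leg. They are the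
anomalous ones and are treated directly. -/

theorem blockIndex_zero {k : List ℕ} (hk : ∀ a ∈ k, 0 < a) : blockIndex k 0 = 0 := by
  cases k with
  | nil => rfl
  | cons a k => simp [blockIndex, hk a (by simp)]

/-- No index is skipped, because every block has positive length. -/
theorem blockIndex_succ_le {k : List ℕ} (hk : ∀ a ∈ k, 0 < a) (j : ℕ) :
    blockIndex k (j + 1) ≤ blockIndex k j + 1 := by
  induction k generalizing j with
  | nil => simp [blockIndex]
  | cons a k ih =>
    have hk' : ∀ b ∈ k, 0 < b := fun b hb => hk b (by simp [hb])
    simp only [blockIndex]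
    split_ifs with h1 h2 h2
    · omega
    · omega
    · have : j + 1 - a = 0 := by omega
      rw [this, blockIndex_zero hk']
    · have : j + 1 - a = (j - a) + 1 := by omega
      have := ih hk' (j - a)
      simp_all

theorem blockIndex_le_succ (k : List ℕ) (j : ℕ) : blockIndex k j ≤ blockIndex k (j + 1) := by
  induction k generalizing j with
  | nil => simp [blockIndex]
  | cons a k ih =>
    simp only [blockIndex]
    split_ifs with h1 h2 h2
    · omega
    · omega
    · omega
    · have : j + 1 - a = (j - a) + 1 := by omega
      have := ih (j - a)
      simp_all

theorem blockIndex_mono (k : List ℕ) : Monotone (blockIndex k) :=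
  monotone_nat_of_le_succ (blockIndex_le_succ k)

theorem blockIndex_last {k : List ℕ} (hk : ∀ a ∈ k, 0 < a) (hne : k ≠ []) :
    blockIndex k (k.sum - 1) + 1 = k.length := by
  induction k with
  | nil => exact absurd rfl hne
  | cons a k ih =>
    have ha : 0 < a := hk a (by simp)
    have hk' : ∀ b ∈ k, 0 < b := fun b hb => hk b (by simp [hb])
    rcases eq_or_ne k [] with rfl | hne'
    · simp [blockIndex, ha]
    · have hpos : 0 < k.sum := by
        obtain ⟨b, hb⟩ := List.exists_mem_of_ne_nil _ hne'
        exact lt_of_lt_of_le (hk' b hb) (List.le_sum_of_mem hb)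
      have h1 : ¬ (a + k.sum - 1 < a) := by omega
      have h2 : a + k.sum - 1 - a = k.sum - 1 := by omega
      simp only [blockIndex, List.sum_cons, List.length_cons, if_neg h1, h2, ih hk' hne']

namespace LabShape

variable (D : LabShape)

/-! ### Vertices and directions of steps, numbered by natural numbers -/

/-- The direction of the `j`-th inner edge. -/
def dir (j : ℕ) : Bool := decide (Even (blockIndex D.k j))

theorem isForward_eq (j : Fin D.numSteps) : D.isForward j = D.dir j := rfl

/-- The `x`-th inner vertex, read cyclically in the cyclic case. -/
def vtx (x : ℕ) : Fin D.numInner := ⟨x % D.numInner, Nat.mod_lt _ D.numInner_pos⟩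

theorem numInner_of_cyclic (h : D.cyclic = true) : D.numInner = D.numSteps := by
  simp [numInner, numSteps, h]

theorem numInner_of_not_cyclic (h : D.cyclic = false) : D.numInner = D.numSteps + 1 := by
  simp [numInner, numSteps, h]

theorem vtx_val_of_lt {x : ℕ} (hx : x < D.numInner) : (D.vtx x : ℕ) = x := Nat.mod_eq_of_lt hx

theorem vtx_numSteps (h : D.cyclic = true) : (D.vtx D.numSteps : ℕ) = 0 := by
  simp [vtx, D.numInner_of_cyclic h]

theorem vtx_coe (v : Fin D.numInner) : D.vtx v = v := Fin.ext (D.vtx_val_of_lt v.2)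

/-- Positions run up to `numSteps`, so that the last leg of a cycle ends at a larger position than
it starts; the price is one vertex with two positions. -/
theorem vtx_eq_iff {x y : ℕ} (hx : x ≤ D.numSteps) (hy : y ≤ D.numSteps) :
    D.vtx x = D.vtx y ↔ x = y ∨
      (D.cyclic = true ∧ ((x = 0 ∧ y = D.numSteps) ∨ (x = D.numSteps ∧ y = 0))) := by
  have hpos := D.numSteps_pos
  rw [Fin.ext_iff]
  cases hc : D.cyclic with
  | false =>
    have hn := D.numInner_of_not_cyclic hc
    rw [D.vtx_val_of_lt (by omega), D.vtx_val_of_lt (by omega)]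
    simp
  | true =>
    have hn := D.numInner_of_cyclic hc
    have h0 := D.vtx_numSteps hc
    rcases hx.eq_or_lt with rfl | hx' <;> rcases hy.eq_or_lt with rfl | hy'
    · simp
    · rw [h0, D.vtx_val_of_lt (by omega)]; simp; omega
    · rw [h0, D.vtx_val_of_lt (by omega)]; simp; omega
    · rw [D.vtx_val_of_lt (by omega), D.vtx_val_of_lt (by omega)]; simp; omega

theorem left_eq (j : Fin D.numSteps) : D.left j = D.vtx j :=
  Fin.ext (D.vtx_val_of_lt (j.2.trans_le D.numSteps_le_numInner)).symm

theorem right_eq (j : Fin D.numSteps) : D.right j = D.vtx (j + 1) := rfl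

theorem stepTail_eq (j : Fin D.numSteps) :
    D.stepTail j = if D.dir j then D.vtx j else D.vtx (j + 1) := by
  simp [stepTail, isForward_eq, left_eq, right_eq]

theorem stepHead_eq (j : Fin D.numSteps) :
    D.stepHead j = if D.dir j then D.vtx (j + 1) else D.vtx j := by
  simp [stepHead, isForward_eq, left_eq, right_eq]

theorem dir_zero : D.dir 0 = true := by simp [dir, blockIndex_zero D.k_pos]

theorem blockIndex_last' : blockIndex D.k (D.numSteps - 1) + 1 = D.k.length :=
  blockIndex_last D.k_pos D.k_ne_nil

/-- A cycle has an even number of legs, so the last leg has odd index and runs backward. -/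
theorem dir_last (h : D.cyclic = true) : D.dir (D.numSteps - 1) = false := by
  have h1 := D.even_of_cyclic h
  rw [← D.blockIndex_last', Nat.even_add_one] at h1
  simp [dir, h1]

theorem needsSource_true_iff (x : ℕ) :
    D.NeedsSource (D.vtx x) true ↔
      ∀ j, j < D.numSteps → D.dir j = true → D.vtx (j + 1) ≠ D.vtx x := by
  constructor
  · intro h j hj hd he
    exact h ⟨j, hj⟩ (by simp [stepHead_eq, hd, he]) (by simpa [isForward_eq] using hd)
  · intro h j hj hf
    rw [isForward_eq] at hf
    exact h j j.2 hf (by simpa [stepHead_eq, hf] using hj)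

theorem needsSource_false_iff (x : ℕ) :
    D.NeedsSource (D.vtx x) false ↔
      ∀ j, j < D.numSteps → D.dir j = false → D.vtx j ≠ D.vtx x := by
  constructor
  · intro h j hj hd he
    exact h ⟨j, hj⟩ (by simp [stepHead_eq, hd, he]) (by simpa [isForward_eq] using hd)
  · intro h j hj hf
    rw [isForward_eq] at hf
    exact h j j.2 hf (by simpa [stepHead_eq, hf] using hj)

theorem needsSink_true_iff (x : ℕ) :
    D.NeedsSink (D.vtx x) true ↔
      ∀ j, j < D.numSteps → D.dir j = true → D.vtx j ≠ D.vtx x := by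
  constructor
  · intro h j hj hd he
    exact h ⟨j, hj⟩ (by simp [stepTail_eq, hd, he]) (by simpa [isForward_eq] using hd)
  · intro h j hj hf
    rw [isForward_eq] at hf
    exact h j j.2 hf (by simpa [stepTail_eq, hf] using hj)

theorem needsSink_false_iff (x : ℕ) :
    D.NeedsSink (D.vtx x) false ↔
      ∀ j, j < D.numSteps → D.dir j = false → D.vtx (j + 1) ≠ D.vtx x := by
  constructor
  · intro h j hj hd he
    exact h ⟨j, hj⟩ (by simp [stepTail_eq, hd, he]) (by simpa [isForward_eq] using hd)
  · intro h j hj hf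
    rw [isForward_eq] at hf
    exact h j j.2 hf (by simpa [stepTail_eq, hf] using hj)

/-! ### Legs -/

/-- The inner edges from the `s`-th to the `(e - 1)`-th form a leg. -/
structure IsLeg (s e : ℕ) : Prop where
  lt : s < e
  le : e ≤ D.numSteps
  dir_eq : ∀ j, s ≤ j → j < e → D.dir j = D.dir s
  left_end : s = 0 ∨ D.dir (s - 1) ≠ D.dir s
  right_end : e = D.numSteps ∨ D.dir e ≠ D.dir s

/-- A leg that starts at the vertex `s'` follows a leg that ends at the vertex `e`. -/
def Next (e s' : ℕ) : Prop := e = s' ∨ (D.cyclic = true ∧ e = D.numSteps ∧ s' = 0)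

variable {D}

theorem exists_isLeg {j : ℕ} (hj : j < D.numSteps) : ∃ s e, D.IsLeg s e ∧ s ≤ j ∧ j < e := by
  classical
  -- The leg is the maximal run of equal directions around `j`: `s` is the earliest start of such a
  -- run, `e` the first later position where the direction changes or the inner edges end.
  have hl : ∃ t, t ≤ j ∧ ∀ i, t ≤ i → i ≤ j → D.dir i = D.dir j :=
    ⟨j, le_rfl, fun i h1 h2 => by rw [le_antisymm h2 h1]⟩
  have hr : ∃ t, j < t ∧ (t = D.numSteps ∨ D.dir t ≠ D.dir j) := ⟨D.numSteps, hj, Or.inl rfl⟩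
  obtain ⟨hs1, hs2⟩ := Nat.find_spec hl
  obtain ⟨he1, he2⟩ := Nat.find_spec hr
  set s := Nat.find hl
  set e := Nat.find hr
  have hse : D.dir s = D.dir j := hs2 s le_rfl hs1
  have hmid : ∀ i, j ≤ i → i < e → D.dir i = D.dir j := by
    intro i h1 h2
    rcases h1.eq_or_lt with rfl | h1
    · rfl
    · have := Nat.find_min hr h2
      by_contra h
      exact this ⟨h1, Or.inr h⟩
  refine ⟨s, e, ⟨by omega, ?_, ?_, ?_, ?_⟩, hs1, he1⟩
  · by_contra h
    exact Nat.find_min hr (not_le.1 h) ⟨hj, Or.inl rfl⟩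
  · intro i h1 h2
    rw [hse]
    rcases le_total i j with h | h
    · exact hs2 i h1 h
    · exact hmid i h h2
  · by_contra! h
    have hlt : s - 1 < s := by omega
    refine Nat.find_min hl hlt ⟨by omega, fun i h1 h2 => ?_⟩
    rcases h1.eq_or_lt with rfl | h1
    · rw [h.2, hse]
    · exact hs2 i (by omega) h2
  · rcases he2 with h | h
    · exact Or.inl h
    · exact Or.inr (by rwa [hse])

/-- Legs with a common inner edge have the same direction, and then the maximality of each run makes
their ends agree. -/
theorem IsLeg.trichotomy {s e s' e' : ℕ} (h : D.IsLeg s e) (h' : D.IsLeg s' e') :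
    (s = s' ∧ e = e') ∨ e ≤ s' ∨ e' ≤ s := by
  by_contra! hc
  obtain ⟨h1, h2, h3⟩ := hc
  have hd : D.dir s = D.dir s' := by
    rw [← h.dir_eq (max s s') (by omega) (by have := h.lt; have := h'.lt; omega),
      ← h'.dir_eq (max s s') (by omega) (by have := h.lt; have := h'.lt; omega)]
  have hss : s = s' := by
    rcases lt_trichotomy s s' with hlt | rfl | hlt
    · rcases h'.left_end with h0 | h0
      · omega
      · exact absurd ((h.dir_eq _ (by omega) (by omega)).trans hd) h0
    · rfl
    · rcases h.left_end with h0 | h0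
      · omega
      · exact absurd ((h'.dir_eq _ (by omega) (by omega)).trans hd.symm) h0
  have hee : e = e' := by
    rcases lt_trichotomy e e' with hlt | rfl | hlt
    · rcases h.right_end with h0 | h0
      · have := h'.le; omega
      · exact absurd ((h'.dir_eq _ (by omega) (by omega)).trans hd.symm) h0
    · rfl
    · rcases h'.right_end with h0 | h0
      · have := h.le; omega
      · exact absurd ((h.dir_eq _ (by omega) (by omega)).trans hd) h0
  exact h1 hss hee

/-- The wrap-around of a cycle reverses the direction as well: the last leg is backward and the
first is forward. -/
theorem IsLeg.dir_ne_of_next {s e s' e' : ℕ} (h : D.IsLeg s e) (h' : D.IsLeg s' e')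
    (hn : D.Next e s') : D.dir s' = !D.dir s := by
  rcases hn with rfl | ⟨hc, rfl, rfl⟩
  · rcases h.right_end with h0 | h0
    · have := h'.lt; have := h'.le; omega
    · revert h0; cases D.dir s <;> cases D.dir e <;> simp
  · rw [D.dir_zero]
    have := h.dir_eq (D.numSteps - 1) (by have := h.lt; omega) (by have := h.lt; omega)
    rw [← this, D.dir_last hc]; rfl

/-- A leg of a cycle is not the whole cycle. -/
theorem IsLeg.not_whole {s e : ℕ} (h : D.IsLeg s e) (hc : D.cyclic = true) :
    ¬ (s = 0 ∧ e = D.numSteps) := by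
  rintro ⟨rfl, rfl⟩
  have := h.dir_ne_of_next h (Or.inr ⟨hc, rfl, rfl⟩)
  revert this; cases D.dir 0 <;> simp

/-- Two legs meet only at the last vertex of one and the first vertex of the other. -/
theorem IsLeg.vtx_eq {s e s' e' x x' : ℕ} (h : D.IsLeg s e) (h' : D.IsLeg s' e')
    (h1 : s ≤ x) (h2 : x ≤ e) (h3 : s' ≤ x') (h4 : x' ≤ e') (hv : D.vtx x = D.vtx x') :
    (s = s' ∧ e = e' ∧ x = x') ∨ (D.Next e s' ∧ x = e ∧ x' = s') ∨
      (D.Next e' s ∧ x' = e' ∧ x = s) := by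
  have a1 := h.lt; have a2 := h.le; have a3 := h'.lt; have a4 := h'.le
  rw [D.vtx_eq_iff (h2.trans h.le) (h4.trans h'.le)] at hv
  have t := h.trichotomy h'
  rcases hv with rfl | ⟨hc, hv⟩
  · rcases t with t | t | t
    · exact Or.inl ⟨t.1, t.2, rfl⟩
    · exact Or.inr (Or.inl ⟨Or.inl (by omega), by omega, by omega⟩)
    · exact Or.inr (Or.inr ⟨Or.inl (by omega), by omega, by omega⟩)
  · have w := h.not_whole hc
    rcases hv with hv | hv
    · refine Or.inr (Or.inr ⟨Or.inr ⟨hc, by omega, by omega⟩, by omega, by omega⟩)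
    · refine Or.inr (Or.inl ⟨Or.inr ⟨hc, by omega, by omega⟩, by omega, by omega⟩)

theorem IsLeg.dir_eq' {s e j : ℕ} (h : D.IsLeg s e) (h1 : s ≤ j) (h2 : j < e) :
    D.dir j = D.dir s := h.dir_eq j h1 h2

/-- At a vertex of a leg, the inner edge before it has the direction of the leg, unless the vertex is
the first one of the leg. -/
theorem IsLeg.dir_before {s e x j : ℕ} (h : D.IsLeg s e) (h1 : s ≤ x) (h2 : x ≤ e)
    (hj : j < D.numSteps) (hv : D.vtx (j + 1) = D.vtx x) :
    (s < x ∧ x = j + 1 ∧ D.dir j = D.dir s) ∨ (x = s ∧ D.dir j = !D.dir s) := by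
  obtain ⟨s', e', h', h3, h4⟩ := exists_isLeg hj
  have hd := h'.dir_eq' h3 h4
  rcases h'.vtx_eq h (by omega) (by omega) h1 h2 hv with ⟨rfl, rfl, rfl⟩ | ⟨hn, h5, h6⟩ | ⟨-, h5, h6⟩
  · exact Or.inl ⟨by omega, rfl, hd⟩
  · refine Or.inr ⟨h6, ?_⟩
    rw [hd, h'.dir_ne_of_next h hn]; simp
  · omega

theorem IsLeg.dir_after {s e x j : ℕ} (h : D.IsLeg s e) (h1 : s ≤ x) (h2 : x ≤ e)
    (hj : j < D.numSteps) (hv : D.vtx j = D.vtx x) :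
    (x < e ∧ x = j ∧ D.dir j = D.dir s) ∨ (x = e ∧ D.dir j = !D.dir s) := by
  obtain ⟨s', e', h', h3, h4⟩ := exists_isLeg hj
  have hd := h'.dir_eq' h3 h4
  rcases h'.vtx_eq h (by omega) (by omega) h1 h2 hv with ⟨rfl, rfl, rfl⟩ | ⟨-, h5, h6⟩ | ⟨hn, h5, h6⟩
  · exact Or.inl ⟨by omega, rfl, hd⟩
  · omega
  · refine Or.inr ⟨h5, ?_⟩
    rw [hd, h.dir_ne_of_next h' hn]

/-- The first vertex of a leg has an inner edge before it, unless it is the end of a path. -/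
theorem IsLeg.exists_before {s e : ℕ} (h : D.IsLeg s e) (hs : ¬ (D.cyclic = false ∧ s = 0)) :
    ∃ s' e', D.IsLeg s' e' ∧ D.Next e' s := by
  have a1 := h.lt; have a2 := h.le
  rcases Nat.eq_zero_or_pos s with rfl | h0
  · have hc : D.cyclic = true := by simpa using hs
    obtain ⟨s', e', h', h3, h4⟩ := exists_isLeg (D := D) (j := D.numSteps - 1) (by omega)
    exact ⟨s', e', h', Or.inr ⟨hc, by have := h'.le; omega, rfl⟩⟩
  · obtain ⟨s', e', h', h3, h4⟩ := exists_isLeg (D := D) (j := s - 1) (by omega)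
    refine ⟨s', e', h', Or.inl ?_⟩
    have := h.trichotomy h'
    omega

theorem IsLeg.exists_after {s e : ℕ} (h : D.IsLeg s e)
    (hs : ¬ (D.cyclic = false ∧ e = D.numSteps)) :
    ∃ s' e', D.IsLeg s' e' ∧ D.Next e s' := by
  have a1 := h.lt; have a2 := h.le
  rcases a2.eq_or_lt with h0 | h0
  · have hc : D.cyclic = true := by simpa [h0] using hs
    obtain ⟨s', e', h', h3, h4⟩ := exists_isLeg (D := D) (j := 0) (by omega)
    exact ⟨s', e', h', Or.inr ⟨hc, h0, by omega⟩⟩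
  · obtain ⟨s', e', h', h3, h4⟩ := exists_isLeg (D := D) (j := e) (by omega)
    refine ⟨s', e', h', Or.inl ?_⟩
    have := h.trichotomy h'
    omega

/-- If each of two legs follows the other, then there are exactly two legs. -/
theorem IsLeg.length_eq_two {s e s' e' : ℕ} (h : D.IsLeg s e) (h' : D.IsLeg s' e')
    (hn : D.Next e s') (hn' : D.Next e' s) : D.cyclic = true ∧ D.k.length = 2 := by
  wlog hlt : s < s' generalizing s e s' e'
  · refine this h' h hn' hn ?_
    have t := h.trichotomy h'
    have := h.lt; have := h'.lt
    have hd := h.dir_ne_of_next h' hn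
    rcases t with t | t | t
    · rw [t.1] at hd; revert hd; cases D.dir s' <;> simp
    · omega
    · omega
  have a1 := h.lt; have a2 := h.le; have a3 := h'.lt; have a4 := h'.le
  have hd := h.dir_ne_of_next h' hn
  obtain rfl : e = s' := by rcases hn with h | h <;> omega
  obtain ⟨hc, he', rfl⟩ : D.cyclic = true ∧ e' = D.numSteps ∧ s = 0 := by
    rcases hn' with h | h
    · omega
    · exact h
  refine ⟨hc, ?_⟩
  rw [D.dir_zero] at hd
  have b0 : blockIndex D.k 0 = 0 := blockIndex_zero D.k_pos
  -- The index grows by at most one per step and its parity is the direction, so it stays `0` on the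
  -- first leg and `1` on the second.
  have c1 : ∀ j, j < e → blockIndex D.k j = 0 := by
    intro j
    induction j with
    | zero => intro _; exact b0
    | succ j ih =>
      intro hj
      have h1 := ih (by omega)
      have h2 := blockIndex_succ_le D.k_pos j
      have h3 := h.dir_eq (j + 1) (by omega) hj
      rw [D.dir_zero] at h3
      simp only [dir, decide_eq_true_eq] at h3
      obtain ⟨r, hr⟩ := h3
      omega
  have c2 : ∀ j, e + j < D.numSteps → blockIndex D.k (e + j) = 1 := by
    intro j
    induction j with
    | zero =>
      intro _
      have h1 := c1 (e - 1) (by omega)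
      have h2 := blockIndex_succ_le D.k_pos (e - 1)
      rw [show e - 1 + 1 = e by omega] at h2
      have h3 : blockIndex D.k e ≠ 0 := by
        intro h0; simp [dir, h0] at hd
      simp only [add_zero]; omega
    | succ j ih =>
      intro hj
      have h1 := ih (by omega)
      have h2 := blockIndex_succ_le D.k_pos (e + j)
      have h4 := blockIndex_le_succ D.k (e + j)
      have h3 := h'.dir_eq (e + j + 1) (by omega) (by omega)
      rw [hd] at h3
      simp only [dir, decide_eq_false_iff_not, Bool.not_true] at h3
      rcases (by omega : blockIndex D.k (e + j + 1) = 1 ∨ blockIndex D.k (e + j + 1) = 2) with h5 | h5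
      · exact h5
      · rw [h5] at h3; exact absurd even_two h3
  have := D.blockIndex_last'
  rw [show D.numSteps - 1 = e + (D.numSteps - 1 - e) by omega, c2 _ (by omega)] at this
  omega

/-- In a cycle with two legs, each leg follows the other. -/
theorem IsLeg.next_of_length_eq_two {s e s' e' : ℕ} (h : D.IsLeg s e) (h' : D.IsLeg s' e')
    (hc : D.cyclic = true) (h2 : D.k.length = 2) :
    (s = s' ∧ e = e') ∨ (D.Next e s' ∧ D.Next e' s) := by
  have hlast := D.blockIndex_last'
  have hb : ∀ j, j < D.numSteps → blockIndex D.k j ≤ 1 := by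
    intro j hj
    have := blockIndex_mono D.k (show j ≤ D.numSteps - 1 by omega)
    omega
  have b0 : blockIndex D.k 0 = 0 := blockIndex_zero D.k_pos
  -- Only the indices `0` and `1` occur, so a forward leg has index `0` and starts at `0`, and a
  -- backward leg has index `1` and runs to the end.
  have key : ∀ {s e}, D.IsLeg s e → (s = 0 ∧ D.dir s = true) ∨ (e = D.numSteps ∧ D.dir s = false) := by
    intro s e h
    have a1 := h.lt; have a2 := h.le
    cases hd : D.dir s with
    | true =>
      refine Or.inl ⟨?_, rfl⟩
      rcases h.left_end with h0 | h0
      · exact h0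
      · by_contra hs
        have h3 := blockIndex_mono D.k (show s - 1 ≤ s by omega)
        have h4 := hb s (by omega)
        rw [hd] at h0
        simp only [dir, decide_eq_true_eq, ne_eq] at hd h0
        obtain ⟨r, hr⟩ := hd
        have : blockIndex D.k (s - 1) = 0 := by omega
        rw [this] at h0; simp at h0
    | false =>
      refine Or.inr ⟨?_, rfl⟩
      rcases h.right_end with h0 | h0
      · exact h0
      · by_contra hs
        have h3 := blockIndex_mono D.k h.lt.le
        have h4 := hb e (by omega)
        rw [hd] at h0
        have h5 : blockIndex D.k s ≠ 0 := by intro h; simp [dir, h] at hd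
        have : blockIndex D.k e = 1 := by omega
        simp [dir, this] at h0
  have a1 := h.lt; have a2 := h'.lt; have a3 := h.le; have a4 := h'.le
  have t := h.trichotomy h'
  have w := h.not_whole hc
  have w' := h'.not_whole hc
  rcases key h with ⟨p, q⟩ | ⟨p, q⟩ <;> rcases key h' with ⟨p', q'⟩ | ⟨p', q'⟩
  · left; omega
  · right
    refine ⟨Or.inl ?_, Or.inr ⟨hc, p', p⟩⟩
    obtain ⟨t1, t2, ht, hn⟩ := h.exists_after (by simp [hc])
    have hd := h.dir_ne_of_next ht hn
    rw [q] at hd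
    rcases key ht with ⟨r, r'⟩ | ⟨r, r'⟩
    · simp [hd] at r'
    · have := ht.trichotomy h'
      have := ht.lt
      rcases hn with hn | hn
      · omega
      · omega
  · right
    refine ⟨Or.inr ⟨hc, p, p'⟩, Or.inl ?_⟩
    obtain ⟨t1, t2, ht, hn⟩ := h'.exists_after (by simp [hc])
    have hd := h'.dir_ne_of_next ht hn
    rw [q'] at hd
    rcases key ht with ⟨r, r'⟩ | ⟨r, r'⟩
    · simp [hd] at r'
    · have := ht.trichotomy h
      have := ht.lt
      rcases hn with hn | hn
      · omega
      · omega
  · left; omega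

end LabShape

/-! ### Contiguous sublists of a list indexed by an interval -/

theorem List.infix_map_range'_iff {α : Type*} (f : ℕ → α) (a m : ℕ) (l : List α) :
    l <:+: (List.range' a m).map f ↔
      ∃ i, i + l.length ≤ m ∧ l = (List.range' (a + i) l.length).map f := by
  rw [List.infix_iff_getElem?]
  constructor
  · rintro ⟨i, hi, h⟩
    simp only [List.length_map, List.length_range'] at hi
    refine ⟨i, by omega, List.ext_getElem (by simp) fun j h1 h2 => ?_⟩
    have := h j h1
    rw [List.getElem?_eq_getElem (by simp; omega)] at this
    simpa [add_assoc, add_comm, add_left_comm] using this.symm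
  · rintro ⟨i, hi, h⟩
    refine ⟨i, by simpa [add_comm] using hi, fun j hj => ?_⟩
    rw [List.getElem?_eq_getElem (by simp; omega)]
    have h1 : j < ((List.range' (a + i) l.length).map f).length := by simpa using hj
    have h2 : l[j] = ((List.range' (a + i) l.length).map f)[j] := by
      simp only [← h]
    rw [h2]
    simp [add_comm, add_left_comm]

/-- A subroute is always considered together with the edges before and after it. If `g` lists the
edges of a route upward, with `g x` just below vertex `x`, then `x` and `y` are the first and the
last vertex of the subroute. -/
theorem List.infix_path_iff {α : Type*} (g : ℕ → α) (lo hi : ℕ) (hle : lo ≤ hi) (a z : α)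
    (c : List α) :
    (a :: c ++ [z]) <:+: (List.range' lo (hi - lo + 2)).map g ↔
      ∃ x y, lo ≤ x ∧ x ≤ y ∧ y ≤ hi ∧ a = g x ∧ z = g (y + 1) ∧
        c = (List.range' (x + 1) (y - x)).map g := by
  rw [List.infix_map_range'_iff]
  have key : ∀ i n, (List.range' (lo + i) (n + 2)).map g =
      g (lo + i) :: (List.range' (lo + i + 1) n).map g ++ [g (lo + i + n + 1)] := by
    intro i n
    rw [List.range'_succ, List.range'_concat]
    simp [add_assoc, add_comm, add_left_comm]
  have hlen : (a :: c ++ [z]).length = c.length + 2 := by simp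
  rw [hlen]
  constructor
  · rintro ⟨i, hi', h⟩
    rw [key] at h
    simp only [List.cons_append, List.cons.injEq] at h
    obtain ⟨h1, h2⟩ := h
    have h3 := List.append_inj' h2 rfl
    refine ⟨lo + i, lo + i + c.length, by omega, by omega, by omega, h1, by simpa using h3.2, ?_⟩
    rw [Nat.add_sub_cancel_left]; exact h3.1
  · rintro ⟨x, y, h1, h2, h3, rfl, rfl, h4⟩
    have h5 : c.length = y - x := by rw [h4]; simp
    refine ⟨x - lo, by omega, ?_⟩
    rw [key, h5, h4]
    rw [show lo + (x - lo) = x by omega, show x + (y - x) = y by omega]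

/-! ### Edges of the DAG and free ends on a leg -/

namespace LabShape

variable {D : LabShape}

/-- The `j`-th inner edge as an edge of the DAG. -/
def stepEdge (D : LabShape) (j : ℕ) : D.dag.Edge :=
  LabEdge.step ⟨j % D.numSteps, Nat.mod_lt _ D.numSteps_pos⟩

/-- A source edge as an edge of the DAG. -/
def srcEdge (v : Fin D.numInner) (c : Bool) (h : D.NeedsSource v c) : D.dag.Edge :=
  LabEdge.fromSource v c h

/-- A sink edge as an edge of the DAG. -/
def snkEdge (v : Fin D.numInner) (c : Bool) (h : D.NeedsSink v c) : D.dag.Edge :=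
  LabEdge.toSink v c h

theorem stepEdge_eq {j : ℕ} (hj : j < D.numSteps) : D.stepEdge j = LabEdge.step ⟨j, hj⟩ :=
  congrArg LabEdge.step (Fin.ext (Nat.mod_eq_of_lt hj))

theorem step_eq_stepEdge (j : Fin D.numSteps) : (LabEdge.step j : D.dag.Edge) = D.stepEdge j :=
  (stepEdge_eq j.2).symm

theorem stepEdge_inj {i j : ℕ} (hi : i < D.numSteps) (hj : j < D.numSteps) :
    D.stepEdge i = D.stepEdge j ↔ i = j := by
  rw [stepEdge_eq hi, stepEdge_eq hj]
  exact ⟨fun h => by injection h with h; exact congrArg Fin.val h, fun h => by subst h; rfl⟩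

variable (D) in
/-- A source or sink edge with label `c` can be attached at the vertex `x` as the edge before a piece
of a leg with direction `b`. -/
def LowFree (b : Bool) (x : ℕ) (c : Bool) : Prop :=
  (b = true → D.NeedsSource (D.vtx x) c) ∧ (b = false → D.NeedsSink (D.vtx x) c)

variable (D) in
/-- A source or sink edge with label `c` can be attached at the vertex `x` as the edge after a piece
of a leg with direction `b`. -/
def HighFree (b : Bool) (x : ℕ) (c : Bool) : Prop :=
  (b = true → D.NeedsSink (D.vtx x) c) ∧ (b = false → D.NeedsSource (D.vtx x) c)

/-- Reversing the direction exchanges source with sink and also the two labels, so one criterion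
serves both directions: the label `b` is blocked by an inner edge just below the vertex, the other
label by an inner edge of opposite direction just above it. -/
theorem lowFree_iff (b : Bool) (x : ℕ) (c : Bool) : D.LowFree b x c ↔
    (c = b → ∀ j, j < D.numSteps → D.dir j = b → D.vtx (j + 1) ≠ D.vtx x) ∧
    (c = !b → ∀ j, j < D.numSteps → D.dir j = !b → D.vtx j ≠ D.vtx x) := by
  cases b <;> cases c <;> simp [LowFree, needsSource_true_iff, needsSource_false_iff,
    needsSink_true_iff, needsSink_false_iff]

theorem highFree_iff (b : Bool) (x : ℕ) (c : Bool) : D.HighFree b x c ↔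
    (c = b → ∀ j, j < D.numSteps → D.dir j = b → D.vtx j ≠ D.vtx x) ∧
    (c = !b → ∀ j, j < D.numSteps → D.dir j = !b → D.vtx (j + 1) ≠ D.vtx x) := by
  cases b <;> cases c <;> simp [HighFree, needsSource_true_iff, needsSource_false_iff,
    needsSink_true_iff, needsSink_false_iff]

/-- The source or sink edge before a piece of a leg with direction `b`. -/
def lowEnd (b : Bool) (x : ℕ) (c : Bool) (h : D.LowFree b x c) : D.dag.Edge :=
  if hb : b = true then srcEdge (D.vtx x) c (h.1 hb)
  else snkEdge (D.vtx x) c (h.2 (by simpa using hb))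

/-- The source or sink edge after a piece of a leg with direction `b`. -/
def highEnd (b : Bool) (x : ℕ) (c : Bool) (h : D.HighFree b x c) : D.dag.Edge :=
  if hb : b = true then snkEdge (D.vtx x) c (h.1 hb)
  else srcEdge (D.vtx x) c (h.2 (by simpa using hb))

theorem tail_srcEdge (v : Fin D.numInner) (c : Bool) (h : D.NeedsSource v c) :
    D.dag.tail (srcEdge v c h) = .source := rfl

theorem head_srcEdge (v : Fin D.numInner) (c : Bool) (h : D.NeedsSource v c) :
    D.dag.head (srcEdge v c h) = .inner v := rfl

theorem tail_snkEdge (v : Fin D.numInner) (c : Bool) (h : D.NeedsSink v c) :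
    D.dag.tail (snkEdge v c h) = .inner v := rfl

theorem edge_cases (e : D.dag.Edge) : (∃ j, j < D.numSteps ∧ e = D.stepEdge j) ∨
    (∃ v c h, e = srcEdge v c h) ∨ (∃ v c h, e = snkEdge v c h) := by
  match e with
  | .step j => exact Or.inl ⟨j, j.2, step_eq_stepEdge j⟩
  | .fromSource v c h => exact Or.inr (Or.inl ⟨v, c, h, rfl⟩)
  | .toSink v c h => exact Or.inr (Or.inr ⟨v, c, h, rfl⟩)

theorem lowEnd_true {x : ℕ} {c : Bool} (h : D.LowFree true x c) :
    lowEnd true x c h = srcEdge (D.vtx x) c (h.1 rfl) := rfl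

theorem lowEnd_false {x : ℕ} {c : Bool} (h : D.LowFree false x c) :
    lowEnd false x c h = snkEdge (D.vtx x) c (h.2 rfl) := rfl

theorem highEnd_true {x : ℕ} {c : Bool} (h : D.HighFree true x c) :
    highEnd true x c h = snkEdge (D.vtx x) c (h.1 rfl) := rfl

theorem highEnd_false {x : ℕ} {c : Bool} (h : D.HighFree false x c) :
    highEnd false x c h = srcEdge (D.vtx x) c (h.2 rfl) := rfl

theorem isTwo_lowEnd {b : Bool} {x : ℕ} {c : Bool} (h : D.LowFree b x c) :
    D.dag.isTwo (lowEnd b x c h) = c := by cases b <;> rfl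

theorem isTwo_highEnd {b : Bool} {x : ℕ} {c : Bool} (h : D.HighFree b x c) :
    D.dag.isTwo (highEnd b x c h) = c := by cases b <;> rfl

theorem isTwo_stepEdge {j : ℕ} (hj : j < D.numSteps) :
    D.dag.isTwo (D.stepEdge j) = D.dir j := by
  rw [stepEdge_eq hj]; rfl

theorem head_stepEdge {j : ℕ} (hj : j < D.numSteps) : D.dag.head (D.stepEdge j) =
    .inner (if D.dir j then D.vtx (j + 1) else D.vtx j) := by
  rw [stepEdge_eq hj, ← D.stepHead_eq ⟨j, hj⟩]; rfl

theorem tail_stepEdge {j : ℕ} (hj : j < D.numSteps) : D.dag.tail (D.stepEdge j) =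
    .inner (if D.dir j then D.vtx j else D.vtx (j + 1)) := by
  rw [stepEdge_eq hj, ← D.stepTail_eq ⟨j, hj⟩]; rfl

/-! ### Routes as intervals in legs -/

/-- An interval in the leg with the vertices `s, …, e`, extended by one more point at each end: the
point `p` with `s < p < e + 2` is the vertex `p - 1`, and an interval with the endpoint `s`
(respectively `e + 2`) encodes a route along this leg whose end edge at `s` (respectively `e`) has
the label of the leg. -/
structure Span (D : LabShape) where
  s : ℕ
  e : ℕ
  u : ℕ
  w : ℕ
  leg : D.IsLeg s e
  s_le : s ≤ u
  le : u ≤ w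
  le_e : w ≤ e + 2
  -- The first alternative says that the route is not confined to an end vertex of its leg. Where
  -- legs meet, the inner edges occupy both incoming or both outgoing places, so no route consists
  -- of that vertex alone; only the two ends of a path remain.
  ok : (s + 2 ≤ w ∧ u ≤ e) ∨
    (D.cyclic = false ∧ ((s = 0 ∧ w = 1) ∨ (e = D.numSteps ∧ u = e + 1)))

namespace Span

variable (c : Span D)

/-- The direction of the leg. -/
def b : Bool := D.dir c.s

/-- The first vertex of the interval. -/
def lo : ℕ := max (c.u - 1) c.s

/-- The last vertex of the interval. -/
def hi : ℕ := min (c.w - 1) c.e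

theorem s_le_lo : c.s ≤ c.lo := le_max_right _ _

theorem hi_le_e : c.hi ≤ c.e := min_le_right _ _

theorem lo_le_hi : c.lo ≤ c.hi := by
  have := c.leg.lt; have := c.s_le; have := c.le; have := c.le_e
  rcases c.ok with h | h
  · simp only [lo, hi]; omega
  · simp only [lo, hi]; omega

theorem hi_le : c.hi ≤ D.numSteps := c.hi_le_e.trans c.leg.le

/-- With the label of the leg the end edge causes no label change, which is the case of an endpoint
at an added point; any other endpoint is a vertex where the label changes. -/
def lowLabel : Bool := if c.u = c.s then c.b else !c.b

def highLabel : Bool := if c.w = c.e + 2 then c.b else !c.b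

/-- Inside a leg the inner edge below occupies the label of the leg, and the other label is free. At
the first vertex both are free, as the edge below, if any, has the opposite direction. At the last
vertex the next leg blocks the other label; there `ok` leaves only the end of a path. -/
theorem lowFree : D.LowFree c.b c.lo c.lowLabel := by
  have a1 := c.s_le_lo; have a2 := c.lo_le_hi; have a3 := c.hi_le_e; have a4 := c.leg.le
  have a5 := c.leg.lt; have a6 := c.s_le; have a7 := c.le; have a8 := c.le_e
  have a9 := c.ok
  rw [lowFree_iff]
  constructor
  · intro h j hj hd hv
    have hu : c.u = c.s := by
      by_contra hu; simp [lowLabel, hu] at h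
    have hl : c.lo = c.s := by simp only [lo]; omega
    rcases c.leg.dir_before (by omega) (by omega) hj hv with h1 | h1
    · omega
    · rw [h1.2, b] at hd; simp at hd
  · intro h j hj hd hv
    have hu : c.u ≠ c.s := by
      intro hu; simp [lowLabel, hu] at h
    rcases c.leg.dir_after (by omega) (by omega) hj hv with h1 | h1
    · rw [h1.2.2, b] at hd; simp at hd
    · have : c.lo = c.e := h1.1
      simp only [lo] at this
      have hc : D.cyclic = false ∧ c.e = D.numSteps := by
        rcases a9 with a9 | a9
        · omega
        · refine ⟨a9.1, ?_⟩; omega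
      rw [D.vtx_eq_iff (by omega) (by omega)] at hv
      rcases hv with hv | hv
      · omega
      · simp [hc.1] at hv

theorem highFree : D.HighFree c.b c.hi c.highLabel := by
  have a1 := c.s_le_lo; have a2 := c.lo_le_hi; have a3 := c.hi_le_e; have a4 := c.leg.le
  have a5 := c.leg.lt; have a6 := c.s_le; have a7 := c.le; have a8 := c.le_e
  have a9 := c.ok
  rw [highFree_iff]
  constructor
  · intro h j hj hd hv
    have hu : c.w = c.e + 2 := by
      by_contra hu; simp [highLabel, hu] at h
    have hl : c.hi = c.e := by simp only [hi]; omega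
    rcases c.leg.dir_after (by omega) (by omega) hj hv with h1 | h1
    · omega
    · rw [h1.2, b] at hd; simp at hd
  · intro h j hj hd hv
    have hu : c.w ≠ c.e + 2 := by
      intro hu; simp [highLabel, hu] at h
    rcases c.leg.dir_before (by omega) (by omega) hj hv with h1 | h1
    · rw [h1.2.2, b] at hd; simp at hd
    · have : c.hi = c.s := h1.1
      simp only [hi] at this
      have hc : D.cyclic = false ∧ c.s = 0 := by
        rcases a9 with a9 | a9
        · omega
        · refine ⟨a9.1, ?_⟩; omega
      rw [D.vtx_eq_iff (by omega) (by omega)] at hv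
      rcases hv with hv | hv
      · omega
      · simp [hc.1] at hv

/-- The source or sink edge at the lower end. -/
def low : D.dag.Edge := lowEnd c.b c.lo c.lowLabel c.lowFree

/-- The source or sink edge at the upper end. -/
def high : D.dag.Edge := highEnd c.b c.hi c.highLabel c.highFree

/-- The edges of the route of an interval, from the lower end to the upper end. -/
def edgeAt (x : ℕ) : D.dag.Edge :=
  if x = c.lo then c.low else if x = c.hi + 1 then c.high else D.stepEdge (x - 1)

theorem edgeAt_lo : c.edgeAt c.lo = c.low := if_pos rfl

theorem edgeAt_hi : c.edgeAt (c.hi + 1) = c.high := by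
  have := c.lo_le_hi
  rw [edgeAt, if_neg (by omega), if_pos rfl]

theorem edgeAt_mid {x : ℕ} (h1 : c.lo < x) (h2 : x ≤ c.hi) : c.edgeAt x = D.stepEdge (x - 1) := by
  rw [edgeAt, if_neg (by omega), if_neg (by omega)]

theorem dir_mid {x : ℕ} (h1 : c.lo < x) (h2 : x ≤ c.hi) : D.dir (x - 1) = c.b := by
  have a1 := c.s_le_lo; have a3 := c.hi_le_e
  exact c.leg.dir_eq _ (by omega) (by omega)

/-- The labels on the two sides of a vertex depend only on whether its point is an endpoint of the
interval. This turns conflicts and `g`-vectors into statements about `u` and `w`. -/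
theorem isTwo_edgeAt {x : ℕ} (h1 : c.lo ≤ x) (h2 : x ≤ c.hi) :
    D.dag.isTwo (c.edgeAt x) = if c.u = x + 1 then !c.b else c.b := by
  have a1 := c.s_le_lo; have a2 := c.hi_le; have a6 := c.s_le; have a3 := c.hi_le_e
  rcases h1.eq_or_lt with rfl | h1
  · rw [edgeAt_lo, low, isTwo_lowEnd, lowLabel]
    have : c.u = c.s ↔ ¬ (c.u = c.lo + 1) := by simp only [lo]; omega
    simp only [this]; split_ifs <;> simp_all
  · rw [c.edgeAt_mid h1 h2, isTwo_stepEdge (by omega), c.dir_mid h1 h2, if_neg]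
    simp only [lo] at h1; omega

theorem isTwo_edgeAt_succ {x : ℕ} (h1 : c.lo ≤ x) (h2 : x ≤ c.hi) :
    D.dag.isTwo (c.edgeAt (x + 1)) = if c.w = x + 1 then !c.b else c.b := by
  have a1 := c.s_le_lo; have a2 := c.hi_le; have a6 := c.s_le; have a7 := c.le_e
  have a8 := c.le; have a9 := c.ok; have a10 := c.leg.lt; have a3 := c.hi_le_e
  rcases h2.eq_or_lt with rfl | h2
  · rw [edgeAt_hi, high, isTwo_highEnd, highLabel]
    have : c.w = c.e + 2 ↔ ¬ (c.w = c.hi + 1) := by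
      have := c.lo_le_hi
      simp only [hi, lo] at *; omega
    simp only [this]; split_ifs <;> simp_all
  · rw [c.edgeAt_mid (by omega) (by omega), isTwo_stepEdge (by omega),
      c.dir_mid (by omega) (by omega), if_neg]
    simp only [hi] at h2; omega

/-- The vertex between two consecutive edges, as the end of the first one. -/
theorem end_edgeAt {x : ℕ} (h1 : c.lo ≤ x) (h2 : x ≤ c.hi) :
    (if c.b then D.dag.head (c.edgeAt x) else D.dag.tail (c.edgeAt x)) = .inner (D.vtx x) := by
  have a2 := c.hi_le
  rcases h1.eq_or_lt with rfl | h1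
  · rw [edgeAt_lo, low]
    generalize c.lowFree = h
    revert h
    cases c.b <;> intro h <;> rfl
  · rw [c.edgeAt_mid h1 h2, head_stepEdge (by omega), tail_stepEdge (by omega), c.dir_mid h1 h2]
    have : x - 1 + 1 = x := by omega
    cases c.b <;> simp [this]

theorem start_edgeAt {x : ℕ} (h1 : c.lo ≤ x) (h2 : x ≤ c.hi) :
    (if c.b then D.dag.tail (c.edgeAt (x + 1)) else D.dag.head (c.edgeAt (x + 1))) =
      .inner (D.vtx x) := by
  have a2 := c.hi_le
  rcases h2.eq_or_lt with rfl | h2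
  · rw [edgeAt_hi, high]
    generalize c.highFree = h
    revert h
    cases c.b <;> intro h <;> rfl
  · rw [c.edgeAt_mid (by omega) (by omega), head_stepEdge (by omega), tail_stepEdge (by omega),
      c.dir_mid (by omega) (by omega)]
    cases c.b <;> simp

/-- The edges of the route from the lower to the upper end of the interval. -/
def edgesUp : List D.dag.Edge := (List.range' c.lo (c.hi - c.lo + 2)).map c.edgeAt

theorem edgesUp_ne_nil : c.edgesUp ≠ [] := by simp [edgesUp]

theorem head_edgesUp : c.edgesUp.head c.edgesUp_ne_nil = c.low := by
  simp [edgesUp, List.head_map, edgeAt_lo]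

theorem getLast_edgesUp : c.edgesUp.getLast c.edgesUp_ne_nil = c.high := by
  have := c.lo_le_hi
  simp only [edgesUp, List.getLast_map, List.getLast_range']
  rw [← edgeAt_hi]; congr 1; omega

theorem isChain_edgesUp : c.edgesUp.IsChain (fun e f =>
    if c.b then D.dag.head e = D.dag.tail f else D.dag.head f = D.dag.tail e) := by
  have := c.lo_le_hi
  rw [List.isChain_iff_getElem]
  intro i hi
  simp only [edgesUp, List.length_map, List.length_range'] at hi
  simp only [edgesUp, List.getElem_map, List.getElem_range']
  have h1 := c.end_edgeAt (x := c.lo + i) (by omega) (by omega)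
  have h2 := c.start_edgeAt (x := c.lo + i) (by omega) (by omega)
  rw [show c.lo + 1 * (i + 1) = c.lo + i + 1 by ring, one_mul]
  split_ifs at h1 h2 ⊢ <;> rw [h1, h2]

/-- The route of an interval. -/
def route : D.LabRoute where
  edges := if c.b then c.edgesUp else c.edgesUp.reverse
  ne_nil := by split_ifs <;> simp [edgesUp_ne_nil]
  chain := by
    have h := c.isChain_edgesUp
    split_ifs with hb
    · simpa [hb] using h
    · rw [List.isChain_reverse]; simpa [hb] using h
  start := by
    have h1 := c.head_edgesUp
    have h2 := c.getLast_edgesUp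
    split_ifs with hb
    · rw [h1, low]
      generalize c.lowFree = h
      revert h; rw [hb]; intro h; rfl
    · rw [List.head_reverse, h2, high]
      generalize c.highFree = h
      revert h; rw [Bool.not_eq_true] at hb; rw [hb]; intro h; rfl
  finish := by
    have h1 := c.head_edgesUp
    have h2 := c.getLast_edgesUp
    split_ifs with hb
    · rw [h2, high]
      generalize c.highFree = h
      revert h; rw [hb]; intro h; rfl
    · rw [List.getLast_reverse, h1, low]
      generalize c.lowFree = h
      revert h; rw [Bool.not_eq_true] at hb; rw [hb]; intro h; rfl

theorem route_edges : c.route.edges = if c.b then c.edgesUp else c.edgesUp.reverse := rfl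

theorem first_route : c.route.first = if c.b then c.low else c.high := by
  unfold FramedDag.Route.first
  simp only [route_edges]
  split_ifs
  · exact c.head_edgesUp
  · rw [List.head_reverse]; exact c.getLast_edgesUp

theorem last_route : c.route.last = if c.b then c.high else c.low := by
  unfold FramedDag.Route.last
  simp only [route_edges]
  split_ifs
  · exact c.getLast_edgesUp
  · rw [List.getLast_reverse]; exact c.head_edgesUp

end Span

end LabShape

/-! ### Every route is the route of an interval -/

namespace LabShape

variable {D : LabShape}

theorem Span.edgesUp_eq (c : Span D) : c.edgesUp =
    c.low :: (List.range' c.lo (c.hi - c.lo)).map D.stepEdge ++ [c.high] := by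
  have := c.lo_le_hi
  rw [edgesUp, List.range'_succ, List.range'_concat, List.map_cons, List.map_append, edgeAt_lo]
  simp only [List.cons_append, List.cons.injEq, true_and, List.map_cons, List.map_nil]
  congr 1
  · refine List.ext_getElem (by simp) fun i h1 h2 => ?_
    simp only [List.length_map, List.length_range'] at h2
    simp only [List.getElem_map, List.getElem_range', one_mul]
    rw [c.edgeAt_mid (by omega) (by omega)]
    congr 1; omega
  · rw [← edgeAt_hi]; congr 2; omega

theorem lowEnd_congr {b b' : Bool} {x x' : ℕ} {c c' : Bool} (hb : b = b') (hx : x = x')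
    (hc : c = c') (h : D.LowFree b x c) (h' : D.LowFree b' x' c') :
    lowEnd b x c h = lowEnd b' x' c' h' := by
  subst hb hx hc; rfl

theorem highEnd_congr {b b' : Bool} {x x' : ℕ} {c c' : Bool} (hb : b = b') (hx : x = x')
    (hc : c = c') (h : D.HighFree b x c) (h' : D.HighFree b' x' c') :
    highEnd b x c h = highEnd b' x' c' h' := by
  subst hb hx hc; rfl

/-- The interval of a list of inner edges in a leg with source and sink edges attached. -/
theorem exists_span_of_edges {b : Bool} {lo hi : ℕ} (hlt : lo < hi) (hN : hi ≤ D.numSteps)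
    (hd : ∀ i, lo ≤ i → i < hi → D.dir i = b) (c c' : Bool) (h : D.LowFree b lo c)
    (h' : D.HighFree b hi c') : ∃ p : Span D, p.b = b ∧ p.edgesUp =
      lowEnd b lo c h :: (List.range' lo (hi - lo)).map D.stepEdge ++ [highEnd b hi c' h'] := by
  obtain ⟨s, e, hl, h1, h2⟩ := exists_isLeg (D := D) (j := lo) (by omega)
  have hsb : D.dir s = b := by rw [← hl.dir_eq lo h1 h2, hd lo le_rfl hlt]
  have hhe : hi ≤ e := by
    by_contra hc
    rcases hl.right_end with h0 | h0
    · omega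
    · exact h0 (by rw [hsb, hd e (by omega) (by omega)])
  have hN' := hl.le
  -- Above the first vertex of the leg, the inner edge below already occupies the label of the leg.
  have hcs : c = b → lo = s := by
    intro hc
    by_contra hne
    have hd' := hl.dir_eq (lo - 1) (by omega) (by omega)
    refine ((lowFree_iff _ _ _).1 h).1 hc (lo - 1) (by omega) (by rw [hd', hsb]) ?_
    congr 1; omega
  have hce : c' = b → hi = e := by
    intro hc
    by_contra hne
    have hd' := hl.dir_eq hi (by omega) (by omega)
    exact ((highFree_iff _ _ _).1 h').1 hc hi (by omega) (by rw [hd', hsb]) rfl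
  let p : Span D :=
    { s := s, e := e, u := if c = b then lo else lo + 1, w := if c' = b then hi + 2 else hi + 1
      leg := hl
      s_le := by split_ifs <;> omega
      le := by split_ifs <;> omega
      le_e := by split_ifs with h; · have := hce h; omega
                 · omega
      ok := Or.inl (by split_ifs <;> omega) }
  have hpb : p.b = b := hsb
  have hplo : p.lo = lo := by
    show max ((if c = b then lo else lo + 1) - 1) s = lo
    split_ifs with h
    · have := hcs h; omega
    · omega
  have hphi : p.hi = hi := by
    show min ((if c' = b then hi + 2 else hi + 1) - 1) e = hi
    split_ifs with h
    · have := hce h; omega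
    · omega
  have hpl : p.lowLabel = c := by
    simp only [Span.lowLabel, hpb, p]
    by_cases hc : c = b
    · have := hcs hc; simp [hc, this]
    · rw [if_neg hc, if_neg (by omega)]; revert hc; cases c <;> cases b <;> simp
  have hph : p.highLabel = c' := by
    simp only [Span.highLabel, hpb, p]
    by_cases hc : c' = b
    · have := hce hc; simp [hc, this]
    · rw [if_neg hc, if_neg (by omega)]; revert hc; cases c' <;> cases b <;> simp
  refine ⟨p, hpb, ?_⟩
  rw [p.edgesUp_eq, hplo, hphi]
  congr 1
  · congr 1
    exact lowEnd_congr hpb hplo hpl _ _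
  · congr 1
    exact highEnd_congr hpb hphi hph _ _

theorem tail_ne_sink (e : D.dag.Edge) : D.dag.tail e ≠ .sink := by
  rcases edge_cases e with ⟨j, hj, rfl⟩ | ⟨v, c, h, rfl⟩ | ⟨v, c, h, rfl⟩
  · rw [tail_stepEdge hj]; simp
  · simp [tail_srcEdge]
  · simp [tail_snkEdge]

theorem eq_nil_of_isChain_snkEdge {v : Fin D.numInner} {c : Bool} {h : D.NeedsSink v c}
    {l : List D.dag.Edge}
    (hch : (snkEdge v c h :: l).IsChain (fun e f => D.dag.head e = D.dag.tail f)) : l = [] := by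
  cases l with
  | nil => rfl
  | cons g l =>
    rw [List.isChain_cons_cons] at hch
    exact absurd hch.1.symm (tail_ne_sink g)

/-- A route on a forward leg can only continue along it or leave by a sink edge: at the end of the
leg, the next leg runs against it. -/
theorem edges_forward (l : List D.dag.Edge) (j : ℕ) (hj : j < D.numSteps) (hd : D.dir j = true)
    (hch : (D.stepEdge j :: l).IsChain (fun e f => D.dag.head e = D.dag.tail f))
    (hsink : D.dag.head ((D.stepEdge j :: l).getLast (List.cons_ne_nil _ _)) = .sink) :
    ∃ m, j < m ∧ m ≤ D.numSteps ∧ (∀ i, j ≤ i → i < m → D.dir i = true) ∧ ∃ c h,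
      D.stepEdge j :: l = (List.range' j (m - j)).map D.stepEdge ++ [highEnd true m c h] := by
  induction l generalizing j with
  | nil =>
    rw [List.getLast_singleton, head_stepEdge hj] at hsink
    exact absurd hsink (by simp)
  | cons f l ih =>
    rw [List.isChain_cons_cons, head_stepEdge hj, if_pos hd] at hch
    obtain ⟨h1, h2⟩ := hch
    rcases edge_cases f with ⟨j', hj', rfl⟩ | ⟨v, c, h, rfl⟩ | ⟨v, c, h, rfl⟩
    · rw [tail_stepEdge hj', DagVertex.inner.injEq] at h1
      obtain ⟨s, e, hl, h3, h4⟩ := exists_isLeg hj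
      have hds := hl.dir_eq j h3 h4
      have hj'' : j' = j + 1 ∧ D.dir j' = true := by
        cases hd' : D.dir j' with
        | true =>
          rw [if_pos hd'] at h1
          rcases hl.dir_after (by omega) h4 hj' h1.symm with h5 | h5
          · exact ⟨h5.2.1.symm, rfl⟩
          · rw [h5.2, ← hds, hd] at hd'; simp at hd'
        | false =>
          rw [hd', if_neg (by simp)] at h1
          rcases hl.dir_before (by omega) h4 hj' h1.symm with h5 | h5
          · rw [h5.2.2, ← hds, hd] at hd'; simp at hd'
          · omega
      obtain ⟨rfl, hd'⟩ := hj''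
      rw [List.getLast_cons (List.cons_ne_nil _ _)] at hsink
      obtain ⟨m, h5, h6, h7, c, h, h8⟩ := ih (j + 1) hj' hd' h2 hsink
      refine ⟨m, by omega, h6, fun i h9 h10 => ?_, c, h, ?_⟩
      · rcases h9.eq_or_lt with rfl | h9
        · exact hd
        · exact h7 i h9 h10
      · rw [h8, show m - j = (m - (j + 1)) + 1 by omega, List.range'_succ]; simp
    · rw [tail_srcEdge] at h1; simp at h1
    · rw [tail_snkEdge, DagVertex.inner.injEq] at h1
      subst h1
      obtain rfl := eq_nil_of_isChain_snkEdge h2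
      refine ⟨j + 1, by omega, by omega, fun i h3 h4 => ?_, c, ⟨fun _ => h, by simp⟩, ?_⟩
      · rw [show i = j by omega, hd]
      · rw [Nat.add_sub_cancel_left]; rfl

theorem edges_backward (l : List D.dag.Edge) (j : ℕ) (hj : j < D.numSteps) (hd : D.dir j = false)
    (hch : (D.stepEdge j :: l).IsChain (fun e f => D.dag.head e = D.dag.tail f))
    (hsink : D.dag.head ((D.stepEdge j :: l).getLast (List.cons_ne_nil _ _)) = .sink) :
    ∃ m, m ≤ j ∧ (∀ i, m ≤ i → i ≤ j → D.dir i = false) ∧ ∃ c h,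
      (D.stepEdge j :: l).reverse =
        lowEnd false m c h :: (List.range' m (j + 1 - m)).map D.stepEdge := by
  induction l generalizing j with
  | nil =>
    rw [List.getLast_singleton, head_stepEdge hj] at hsink
    exact absurd hsink (by simp)
  | cons f l ih =>
    rw [List.isChain_cons_cons, head_stepEdge hj, hd, if_neg (by simp)] at hch
    obtain ⟨h1, h2⟩ := hch
    rcases edge_cases f with ⟨j', hj', rfl⟩ | ⟨v, c, h, rfl⟩ | ⟨v, c, h, rfl⟩
    · rw [tail_stepEdge hj', DagVertex.inner.injEq] at h1
      obtain ⟨s, e, hl, h3, h4⟩ := exists_isLeg hj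
      have hds := hl.dir_eq j h3 h4
      have hj'' : j = j' + 1 ∧ D.dir j' = false := by
        cases hd' : D.dir j' with
        | true =>
          rw [if_pos hd'] at h1
          rcases hl.dir_after h3 h4.le hj' h1.symm with h5 | h5
          · rw [h5.2.2, ← hds, hd] at hd'; simp at hd'
          · omega
        | false =>
          rw [hd', if_neg (by simp)] at h1
          rcases hl.dir_before h3 h4.le hj' h1.symm with h5 | h5
          · exact ⟨h5.2.1, rfl⟩
          · rw [h5.2, ← hds, hd] at hd'; simp at hd'
      obtain ⟨rfl, hd'⟩ := hj''
      rw [List.getLast_cons (List.cons_ne_nil _ _)] at hsink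
      obtain ⟨m, h5, h7, c, h, h8⟩ := ih j' hj' hd' h2 hsink
      refine ⟨m, by omega, fun i h9 h10 => ?_, c, h, ?_⟩
      · rcases h10.eq_or_lt with rfl | h10
        · exact hd
        · exact h7 i h9 (by omega)
      · rw [List.reverse_cons, h8, show j' + 1 + 1 - m = (j' + 1 - m) + 1 by omega,
          List.range'_concat]
        simp only [List.cons_append, List.map_append, List.map_cons, List.map_nil, one_mul]
        congr 4; omega
    · rw [tail_srcEdge] at h1; simp at h1
    · rw [tail_snkEdge, DagVertex.inner.injEq] at h1
      subst h1
      obtain rfl := eq_nil_of_isChain_snkEdge h2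
      refine ⟨j, le_rfl, fun i h3 h4 => ?_, c, ⟨by simp, fun _ => h⟩, ?_⟩
      · rw [show i = j by omega, hd]
      · rw [Nat.add_sub_cancel_left]; rfl

/-- A route with two edges comes from an interval. -/
theorem exists_span_of_two_edges (v : Fin D.numInner) (c c' : Bool) (h : D.NeedsSource v c)
    (h' : D.NeedsSink v c') : ∃ p : Span D,
      p.route.edges = [srcEdge v c h, snkEdge v c' h'] := by
  have hN := D.numSteps_pos
  obtain ⟨x, hx, rfl⟩ : ∃ x, x < D.numInner ∧ D.vtx x = v := ⟨v, v.2, D.vtx_coe v⟩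
  have key : ∀ p : Span D, p.lo = x → p.hi = x →
      (p.b = true → p.lowLabel = c ∧ p.highLabel = c') →
      (p.b = false → p.lowLabel = c' ∧ p.highLabel = c) →
      p.route.edges = [srcEdge (D.vtx x) c h, snkEdge (D.vtx x) c' h'] := by
    intro p h1 h2 h3 h4
    rw [p.route_edges, p.edgesUp_eq, h1, h2, Span.low, Span.high]
    generalize p.lowFree = q1
    generalize p.highFree = q2
    revert q1 q2
    cases hb : p.b with
    | true =>
      obtain ⟨h5, h6⟩ := h3 hb
      rw [h1, h2, h5, h6]; intro q1 q2
      simp [lowEnd_true, highEnd_true]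
    | false =>
      obtain ⟨h5, h6⟩ := h4 hb
      rw [h1, h2, h5, h6]; intro q1 q2
      simp [lowEnd_false, highEnd_false]
  have hst := (D.needsSource_true_iff x)
  have hsf := (D.needsSource_false_iff x)
  have hkt := (D.needsSink_true_iff x)
  have hkf := (D.needsSink_false_iff x)
  have hcc : ∀ d, D.dir d = true ∨ D.dir d = false := fun d => by cases D.dir d <;> simp
  -- A vertex with inner edges on both sides carries a two-edge route only inside a leg, since at a
  -- junction both outgoing or both incoming places are taken. Inside a leg both labels are forced,
  -- and the interval is a point.
  have inner : ∀ j, j < D.numSteps → D.vtx (j + 1) = D.vtx x → x < D.numSteps →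
      ∃ p : Span D, p.route.edges =
        [srcEdge (D.vtx x) c h, snkEdge (D.vtx x) c' h'] := by
    intro j hj hv hxN
    obtain ⟨s, e, hl, h3, h4⟩ := exists_isLeg hxN
    have hds := hl.dir_eq x h3 h4
    have hsx : s < x := by
      rcases hl.dir_before h3 h4.le hj hv with h5 | h5
      · exact h5.1
      · exfalso
        rcases hcc x with hx | hx
        · have hj0 : D.dir j = false := by rw [h5.2, ← hds, hx]; rfl
          cases c' with
          | true => exact hkt.1 h' x hxN hx rfl
          | false => exact hkf.1 h' j hj hj0 hv
        · have hj0 : D.dir j = true := by rw [h5.2, ← hds, hx]; rfl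
          cases c with
          | true => exact hst.1 h j hj hj0 hv
          | false => exact hsf.1 h x hxN hx rfl
    let p : Span D :=
      { s := s, e := e, u := x + 1, w := x + 1, leg := hl, s_le := by omega, le := le_rfl
        le_e := by omega, ok := Or.inl (by omega) }
    have hdb : D.dir (x - 1) = D.dir x := by rw [hds, hl.dir_eq (x - 1) (by omega) (by omega)]
    have hvb : D.vtx (x - 1 + 1) = D.vtx x := by congr 1; omega
    refine ⟨p, key p ?_ ?_ ?_ ?_⟩
    · simp only [Span.lo, p]; omega
    · simp only [Span.hi, p]; omega
    · intro hb
      have hx : D.dir x = true := hds.trans hb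
      have e1 : c = false := by
        rw [← Bool.not_eq_true]; rintro rfl
        exact hst.1 h (x - 1) (by omega) (by rw [hdb, hx]) hvb
      have e2 : c' = false := by
        rw [← Bool.not_eq_true]; rintro rfl
        exact hkt.1 h' x hxN hx rfl
      rw [e1, e2, Span.lowLabel, Span.highLabel, hb]
      simp only [p]
      rw [if_neg (by omega), if_neg (by omega)]; simp
    · intro hb
      have hx : D.dir x = false := hds.trans hb
      have e1 : c = true := by
        rw [← Bool.not_eq_false]; rintro rfl
        exact hsf.1 h x hxN hx rfl
      have e2 : c' = true := by
        rw [← Bool.not_eq_false]; rintro rfl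
        exact hkf.1 h' (x - 1) (by omega) (by rw [hdb, hx]) hvb
      rw [e1, e2, Span.lowLabel, Span.highLabel, hb]
      simp only [p]
      rw [if_neg (by omega), if_neg (by omega)]; simp
  cases hc : D.cyclic with
  | true =>
    have hn := D.numInner_of_cyclic hc
    rcases Nat.eq_zero_or_pos x with rfl | h0
    · refine inner (D.numSteps - 1) (by omega) ?_ (by omega)
      rw [D.vtx_eq_iff (by omega) (by omega)]
      right; exact ⟨hc, Or.inr ⟨by omega, rfl⟩⟩
    · exact inner (x - 1) (by omega) (by congr 1; omega) (by omega)
  | false =>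
    have hn := D.numInner_of_not_cyclic hc
    rcases Nat.eq_zero_or_pos x with rfl | h0
    · obtain ⟨s, e, hl, h3, h4⟩ := exists_isLeg hN
      obtain rfl : s = 0 := by omega
      -- At the first vertex of a path both incoming edges come from the source, so the source label
      -- is free; it decides between `u = 0` and `u = 1`.
      let p : Span D :=
        { s := 0, e := e, u := if c = true then 0 else 1, w := 1, leg := hl, s_le := by omega
          le := by split_ifs <;> omega
          le_e := by omega, ok := Or.inr ⟨hc, Or.inl ⟨rfl, rfl⟩⟩ }
      have e2 : c' = false := by
        rw [← Bool.not_eq_true]; rintro rfl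
        exact hkt.1 h' 0 hN D.dir_zero rfl
      have hb : p.b = true := D.dir_zero
      refine ⟨p, key p ?_ ?_ ?_ ?_⟩
      · simp only [Span.lo, p]; split_ifs <;> omega
      · simp only [Span.hi, p]; omega
      · intro _
        rw [Span.lowLabel, Span.highLabel, hb]
        simp only [p, e2]
        rw [if_neg (by omega : ¬ (1 = e + 2))]
        cases c <;> simp
      · intro h; rw [hb] at h; simp at h
    · rcases (by omega : x < D.numSteps ∨ x = D.numSteps) with hxN | rfl
      · exact inner (x - 1) (by omega) (by congr 1; omega) hxN
      · obtain ⟨s, e, hl, h3, h4⟩ := exists_isLeg (D := D) (j := D.numSteps - 1) (by omega)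
        obtain rfl : e = D.numSteps := by have := hl.le; omega
        have hds := hl.dir_eq _ h3 h4
        have hvb : D.vtx (D.numSteps - 1 + 1) = D.vtx D.numSteps := by congr 1; omega
        -- At the last vertex of a path the upper end edge is the sink edge on a forward leg and the
        -- source edge on a backward leg; its label is free and decides `w`.
        let p : Span D :=
          { s := s, e := D.numSteps, u := D.numSteps + 1
            w := if (if D.dir s then c' else c) = D.dir s then D.numSteps + 2 else D.numSteps + 1
            leg := hl, s_le := by omega
            le := by split_ifs <;> omega
            le_e := by split_ifs <;> omega, ok := Or.inr ⟨hc, Or.inr ⟨rfl, rfl⟩⟩ }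
        refine ⟨p, key p ?_ ?_ ?_ ?_⟩
        · simp only [Span.lo, p]; omega
        · simp only [Span.hi, p]; split_ifs <;> omega
        · intro hb
          have hbs : D.dir s = true := hb
          have e1 : c = false := by
            rw [← Bool.not_eq_true]; rintro rfl
            exact hst.1 h _ (by omega) (hds.trans hbs) hvb
          rw [Span.lowLabel, Span.highLabel, hb]
          simp only [p, e1, hbs]
          rw [if_neg (by omega)]
          cases c' <;> simp
        · intro hb
          have hbs : D.dir s = false := hb
          have e1 : c' = true := by
            rw [← Bool.not_eq_false]; rintro rfl
            exact hkf.1 h' _ (by omega) (hds.trans hbs) hvb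
          rw [Span.lowLabel, Span.highLabel, hb]
          simp only [p, e1, hbs]
          rw [if_neg (by omega)]
          cases c <;> simp

/-- Every route comes from an interval in a leg. -/
theorem exists_span (R : D.LabRoute) : ∃ p : Span D, p.route = R := by
  obtain ⟨l, hne, hch, hst, hfi⟩ := R
  suffices ∃ p : Span D, p.route.edges = l by
    obtain ⟨p, hp⟩ := this
    exact ⟨p, FramedDag.Route.ext hp⟩
  cases l with
  | nil => exact absurd rfl hne
  | cons e0 l =>
  rw [List.head_cons] at hst
  rcases edge_cases e0 with ⟨j, hj, rfl⟩ | ⟨v, c, h, rfl⟩ | ⟨v, c, h, rfl⟩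
  · rw [tail_stepEdge hj] at hst; simp at hst
  swap
  · rw [tail_snkEdge] at hst; simp at hst
  cases l with
  | nil => rw [List.getLast_singleton, head_srcEdge] at hfi; simp at hfi
  | cons f l =>
  rw [List.isChain_cons_cons, head_srcEdge] at hch
  obtain ⟨h1, h2⟩ := hch
  rw [List.getLast_cons (List.cons_ne_nil _ _)] at hfi
  rcases edge_cases f with ⟨j, hj, rfl⟩ | ⟨v', c', h', rfl⟩ | ⟨v', c', h', rfl⟩
  · rw [tail_stepEdge hj, DagVertex.inner.injEq] at h1
    cases hd : D.dir j with
    | true =>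
      rw [if_pos hd] at h1
      subst h1
      obtain ⟨m, h5, h6, h7, c', h', h8⟩ := edges_forward l j hj hd h2 hfi
      obtain ⟨p, hp1, hp2⟩ := exists_span_of_edges h5 h6 h7 c c' ⟨fun _ => h, by simp⟩ h'
      refine ⟨p, ?_⟩
      rw [p.route_edges, hp1, if_pos rfl, hp2, h8]
      rfl
    | false =>
      rw [hd, if_neg (by simp)] at h1
      subst h1
      obtain ⟨m, h5, h7, c', h', h8⟩ := edges_backward l j hj hd h2 hfi
      obtain ⟨p, hp1, hp2⟩ := exists_span_of_edges (b := false) (lo := m) (hi := j + 1) (by omega)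
        hj (fun i h9 h10 => h7 i h9 (by omega)) c' c h' ⟨by simp, fun _ => h⟩
      refine ⟨p, ?_⟩
      rw [p.route_edges, hp1, if_neg (by simp), hp2, List.reverse_append]
      rw [← h8]
      simp
      rfl
  · rw [tail_srcEdge] at h1; simp at h1
  · rw [tail_snkEdge, DagVertex.inner.injEq] at h1
    subst h1
    obtain rfl := eq_nil_of_isChain_snkEdge h2
    exact exists_span_of_two_edges v c c' h h'

end LabShape

namespace LabShape

open FramedDag

variable {D : LabShape}

namespace Span

/-! ### Subroutes -/

theorem infix_route_iff (p : Span D) (e f : D.dag.Edge) (l : List D.dag.Edge) :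
    (e :: l ++ [f]) <:+: p.route.edges ↔ ∃ x y, p.lo ≤ x ∧ x ≤ y ∧ y ≤ p.hi ∧
      (if p.b then e = p.edgeAt x ∧ f = p.edgeAt (y + 1) ∧
        l = (List.range' x (y - x)).map D.stepEdge
      else f = p.edgeAt x ∧ e = p.edgeAt (y + 1) ∧
        l.reverse = (List.range' x (y - x)).map D.stepEdge) := by
  have key : ∀ x y, p.lo ≤ x → x ≤ y → y ≤ p.hi →
      (List.range' (x + 1) (y - x)).map p.edgeAt = (List.range' x (y - x)).map D.stepEdge := by
    intro x y h1 h2 h3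
    refine List.ext_getElem (by simp) fun i h4 h5 => ?_
    simp only [List.length_map, List.length_range'] at h5
    simp only [List.getElem_map, List.getElem_range', one_mul]
    rw [p.edgeAt_mid (by omega) (by omega)]
    congr 1; omega
  rw [p.route_edges]
  cases hb : p.b with
  | true =>
    simp only [if_true]
    rw [edgesUp, List.infix_path_iff _ _ _ p.lo_le_hi]
    refine exists_congr fun x => exists_congr fun y => ?_
    constructor
    · rintro ⟨h1, h2, h3, h4, h5, h6⟩
      exact ⟨h1, h2, h3, h4, h5, by rw [h6, key x y h1 h2 h3]⟩
    · rintro ⟨h1, h2, h3, h4, h5, h6⟩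
      exact ⟨h1, h2, h3, h4, h5, by rw [h6, key x y h1 h2 h3]⟩
  | false =>
    simp only [Bool.false_eq_true, if_false]
    rw [← List.reverse_infix, List.reverse_reverse]
    have : (e :: l ++ [f]).reverse = f :: l.reverse ++ [e] := by simp
    rw [this, edgesUp, List.infix_path_iff _ _ _ p.lo_le_hi]
    refine exists_congr fun x => exists_congr fun y => ?_
    constructor
    · rintro ⟨h1, h2, h3, h4, h5, h6⟩
      exact ⟨h1, h2, h3, h4, h5, by rw [h6, key x y h1 h2 h3]⟩
    · rintro ⟨h1, h2, h3, h4, h5, h6⟩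
      exact ⟨h1, h2, h3, h4, h5, by rw [h6, key x y h1 h2 h3]⟩

/-- The arithmetic form of conflict. -/
def Clash (p q : Span D) : Prop :=
  (p.s = q.s ∧ p.e = q.e ∧ p.u < q.u ∧ q.u ≤ p.w ∧ p.w < q.w) ∨
    (D.Next p.e q.s ∧ p.w = p.e + 1 ∧ q.u = q.s + 1)

theorem b_eq_of_s_eq {p q : Span D} (h : p.s = q.s) : p.b = q.b := by rw [b, b, h]

theorem lo_le_iff (p : Span D) (x : ℕ) : p.lo ≤ x ↔ p.u ≤ x + 1 ∧ p.s ≤ x := by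
  rw [lo]; omega

theorem le_hi_iff (p : Span D) (x : ℕ) (h : 0 < x ∨ 0 < p.w) :
    x ≤ p.hi ↔ x + 1 ≤ p.w ∧ x ≤ p.e := by
  rw [hi]; omega

theorem w_pos (p : Span D) : 0 < p.w := by
  have := p.ok; have := p.le; omega

theorem stepEdge_mem_iff {x y t : ℕ} (hy : y ≤ D.numSteps) (ht : t < D.numSteps) (hxy : x ≤ y) :
    D.stepEdge t ∈ (List.range' x (y - x)).map D.stepEdge ↔ x ≤ t ∧ t < y := by
  rw [List.mem_map]
  constructor
  · rintro ⟨i, hi, h⟩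
    rw [List.mem_range'_1] at hi
    rw [stepEdge_inj (by omega) ht] at h
    omega
  · intro h
    exact ⟨t, by rw [List.mem_range'_1]; omega, rfl⟩

/-- Where two routes share a subroute. -/
theorem common_subroute {p q : Span D} {e e' f f' : D.dag.Edge} {l : List D.dag.Edge}
    (h1 : (e :: l ++ [f]) <:+: p.route.edges) (h2 : (e' :: l ++ [f']) <:+: q.route.edges)
    (h3 : D.dag.head e = D.dag.head e') :
    ∃ x y x' y', p.lo ≤ x ∧ x ≤ y ∧ y ≤ p.hi ∧ q.lo ≤ x' ∧ x' ≤ y' ∧ y' ≤ q.hi ∧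
      (if p.b then e = p.edgeAt x ∧ f = p.edgeAt (y + 1)
        else f = p.edgeAt x ∧ e = p.edgeAt (y + 1)) ∧
      (if q.b then e' = q.edgeAt x' ∧ f' = q.edgeAt (y' + 1)
        else f' = q.edgeAt x' ∧ e' = q.edgeAt (y' + 1)) ∧
      ((p.s = q.s ∧ p.e = q.e ∧ x = x' ∧ y = y') ∨
        (x = y ∧ x' = y' ∧ ((D.Next p.e q.s ∧ x = p.e ∧ x' = q.s) ∨
          (D.Next q.e p.s ∧ x' = q.e ∧ x = p.s)))) := by
  rw [infix_route_iff] at h1 h2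
  obtain ⟨x, y, a1, a2, a3, a4⟩ := h1
  obtain ⟨x', y', b1, b2, b3, b4⟩ := h2
  have c1 := p.s_le_lo; have c2 := p.hi_le_e; have c3 := p.leg.le
  have d1 := q.s_le_lo; have d2 := q.hi_le_e; have d3 := q.leg.le
  refine ⟨x, y, x', y', a1, a2, a3, b1, b2, b3, ?_, ?_, ?_⟩
  · split_ifs at a4 ⊢ <;> exact ⟨a4.1, a4.2.1⟩
  · split_ifs at b4 ⊢ <;> exact ⟨b4.1, b4.2.1⟩
  have hmem : ∀ t, t < D.numSteps → (D.stepEdge t ∈ l ↔ x ≤ t ∧ t < y) := by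
    intro t ht
    rw [← stepEdge_mem_iff (show y ≤ D.numSteps by omega) ht a2]
    split_ifs at a4
    · rw [a4.2.2]
    · rw [← a4.2.2, List.mem_reverse]
  have hmem' : ∀ t, t < D.numSteps → (D.stepEdge t ∈ l ↔ x' ≤ t ∧ t < y') := by
    intro t ht
    rw [← stepEdge_mem_iff (show y' ≤ D.numSteps by omega) ht b2]
    split_ifs at b4
    · rw [b4.2.2]
    · rw [← b4.2.2, List.mem_reverse]
  have hlen : l.length = y - x := by
    split_ifs at a4
    · simpa using congrArg List.length a4.2.2
    · simpa using congrArg List.length a4.2.2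
  have hlen' : l.length = y' - x' := by
    split_ifs at b4
    · simpa using congrArg List.length b4.2.2
    · simpa using congrArg List.length b4.2.2
  -- A common subroute without edges is a vertex, which may be a junction of two legs; a common
  -- inner edge determines the leg.
  rcases a2.eq_or_lt with rfl | hlt
  · have hxy' : x' = y' := by omega
    subst hxy'
    have e1 := p.end_edgeAt a1 a3
    have e2 := p.start_edgeAt a1 a3
    have e3 := q.end_edgeAt b1 b3
    have e4 := q.start_edgeAt b1 b3
    have hv : D.vtx x = D.vtx x' := by
      have e5 : D.dag.head e = .inner (D.vtx x) := by
        split_ifs at a4 e1 e2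
        · rw [a4.1, e1]
        · rw [a4.2.1, e2]
      have e6 : D.dag.head e' = .inner (D.vtx x') := by
        split_ifs at b4 e3 e4
        · rw [b4.1, e3]
        · rw [b4.2.1, e4]
      rw [e5, e6, DagVertex.inner.injEq] at h3
      exact h3
    rcases p.leg.vtx_eq q.leg (by omega) (by omega) (by omega) (by omega) hv with h | h | h
    · exact Or.inl ⟨h.1, h.2.1, h.2.2, h.2.2⟩
    · exact Or.inr ⟨rfl, rfl, Or.inl h⟩
    · exact Or.inr ⟨rfl, rfl, Or.inr h⟩
  · have m3 := (hmem x' (by omega)).symm.trans (hmem' x' (by omega))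
    have m4 := (hmem x (by omega)).symm.trans (hmem' x (by omega))
    have hx : x' ≤ x ∧ x < y' := m4.1 ⟨le_rfl, hlt⟩
    have hxx : x = x' := by
      have := m3.2 ⟨le_rfl, by omega⟩
      omega
    left
    have t := p.leg.trichotomy q.leg
    omega

/-- On one leg the labels differ below a common subroute only if exactly one interval starts there,
and above it only if exactly one ends there. The opposite framing orders mean that these are
different intervals, so they cross instead of being nested. At a junction the legs have different
labels, and there is a conflict only if both routes change label. -/
theorem clash_of_conflict {p q : Span D} (h : Conflict p.route q.route) :
    Clash p q ∨ Clash q p := by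
  obtain ⟨e, e', f, f', l, h1, h2, h3, h4⟩ := h
  obtain ⟨x, y, x', y', a1, a2, a3, b1, b2, b3, a4, b4, h5⟩ := common_subroute h1 h2 h3
  have l1 := p.isTwo_edgeAt a1 (a2.trans a3)
  have l2 := p.isTwo_edgeAt_succ (a1.trans a2) a3
  have l3 := q.isTwo_edgeAt b1 (b2.trans b3)
  have l4 := q.isTwo_edgeAt_succ (b1.trans b2) b3
  have hw := p.w_pos
  have hw' := q.w_pos
  rw [lo_le_iff] at a1 b1
  rw [le_hi_iff _ _ (Or.inr ‹_›)] at a3 b3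
  have c2 := p.hi_le_e; have c5 := p.leg.lt; have d5 := q.leg.lt
  have c6 := p.le_e; have d6 := q.le_e; have c7 := p.s_le; have d7 := q.s_le
  rcases h5 with ⟨hs, he, rfl, rfl⟩ | ⟨rfl, rfl, hn⟩
  · have hb := b_eq_of_s_eq hs
    rw [← hb] at l3 l4 b4
    have key : (p.u = x + 1 ∧ q.u ≠ x + 1 ∧ q.w = y + 1 ∧ p.w ≠ y + 1) ∨
        (q.u = x + 1 ∧ p.u ≠ x + 1 ∧ p.w = y + 1 ∧ q.w ≠ y + 1) := by
      cases hpb : p.b <;> simp only [hpb, if_true, Bool.false_eq_true, if_false] at a4 b4 l1 l2 l3 l4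
      all_goals
        rw [a4.1, a4.2, b4.1, b4.2, l1, l2, l3, l4] at h4
        revert h4
        split_ifs <;> simp_all
    simp only [Clash]
    rcases key with k | k
    · right; left; omega
    · left; left; omega
  · rcases hn with ⟨hn, rfl, rfl⟩ | ⟨hn, rfl, rfl⟩
    · left; right
      refine ⟨hn, ?_⟩
      have hb : q.b = !p.b := p.leg.dir_ne_of_next q.leg hn
      rw [hb] at l3 l4 b4
      have hu : p.u ≠ p.e + 1 := by
        intro hu
        rcases p.ok with h | h
        · omega
        · rcases hn with hn | hn
          · have := q.leg.le; omega
          · rw [h.1] at hn; simp at hn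
      have hv : q.w ≠ q.s + 1 := by
        intro hu
        rcases q.ok with h | h
        · omega
        · rcases hn with hn | hn
          · have := p.leg.le; omega
          · rw [h.1] at hn; simp at hn
      cases hpb : p.b <;> simp only [hpb, if_true, Bool.false_eq_true, if_false, Bool.not_true,
          Bool.not_false] at a4 b4 l1 l2 l3 l4
      all_goals
        rw [if_neg (by omega)] at l1 l4
        rw [a4.1, a4.2, b4.1, b4.2, l1, l2, l3, l4] at h4
        revert h4
        split_ifs <;> simp_all
    · right; right
      refine ⟨hn, ?_⟩
      have hb : p.b = !q.b := q.leg.dir_ne_of_next p.leg hn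
      rw [hb] at l1 l2 a4
      have hu : q.u ≠ q.e + 1 := by
        intro hu
        rcases q.ok with h | h
        · omega
        · rcases hn with hn | hn
          · have := p.leg.le; omega
          · rw [h.1] at hn; simp at hn
      have hv : p.w ≠ p.s + 1 := by
        intro hu
        rcases p.ok with h | h
        · omega
        · rcases hn with hn | hn
          · have := q.leg.le; omega
          · rw [h.1] at hn; simp at hn
      cases hpb : q.b <;> simp only [hpb, if_true, Bool.false_eq_true, if_false, Bool.not_true,
          Bool.not_false] at a4 b4 l1 l2 l3 l4
      all_goals
        rw [if_neg (by omega)] at l2 l3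
        rw [a4.1, a4.2, b4.1, b4.2, l1, l2, l3, l4] at h4
        revert h4
        split_ifs <;> simp_all

theorem conflict_symm {p q : Span D} (h : Conflict p.route q.route) :
    Conflict q.route p.route := by
  obtain ⟨e, e', f, f', l, h1, h2, h3, h4⟩ := h
  exact ⟨e', e, f', f, l, h2, h1, h3.symm, h4.symm⟩

theorem not_path_end_of_next {p q : Span D} (hn : D.Next p.e q.s) :
    (p.s + 2 ≤ p.w ∧ p.u ≤ p.e ∨ (p.s = 0 ∧ p.w = 1)) ∧
      (q.s + 2 ≤ q.w ∧ q.u ≤ q.e ∨ (q.e = D.numSteps ∧ q.u = q.e + 1)) := by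
  have c5 := p.leg.lt; have d5 := q.leg.lt; have c6 := p.leg.le; have d6 := q.leg.le
  have h1 := p.ok; have h2 := q.ok
  rcases hn with hn | hn
  · omega
  · rw [hn.1] at h1 h2; simp at h1 h2; omega

theorem conflict_of_clash {p q : Span D} (h : Clash p q) : Conflict p.route q.route := by
  have hw := p.w_pos
  have hw' := q.w_pos
  have c5 := p.leg.lt; have d5 := q.leg.lt
  have c6 := p.le_e; have d6 := q.le_e; have c7 := p.s_le; have d7 := q.s_le
  have c8 := p.ok; have d8 := q.ok; have c9 := p.le; have d9 := q.le
  rcases h with ⟨hs, he, h1, h2, h3⟩ | ⟨hn, h1, h2⟩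
  · have hb := b_eq_of_s_eq hs
    have a1 : p.lo ≤ q.u - 1 := by rw [lo_le_iff]; omega
    have b1 : q.lo ≤ q.u - 1 := by rw [lo_le_iff]; omega
    have a3 : p.w - 1 ≤ p.hi := by rw [le_hi_iff _ _ (Or.inr ‹_›)]; omega
    have b3 : p.w - 1 ≤ q.hi := by rw [le_hi_iff _ _ (Or.inr ‹_›)]; omega
    have a2 : q.u - 1 ≤ p.w - 1 := by omega
    have l1 := p.isTwo_edgeAt a1 (a2.trans a3)
    have l2 := p.isTwo_edgeAt_succ (a1.trans a2) a3
    have l3 := q.isTwo_edgeAt b1 (a2.trans b3)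
    have l4 := q.isTwo_edgeAt_succ (b1.trans a2) b3
    rw [if_neg (by omega)] at l1 l4
    rw [if_pos (by omega)] at l2 l3
    have e1 := p.end_edgeAt a1 (a2.trans a3)
    have e2 := p.start_edgeAt (a1.trans a2) a3
    have e3 := q.end_edgeAt b1 (a2.trans b3)
    have e4 := q.start_edgeAt (b1.trans a2) b3
    rw [← hb] at l3 l4 e3 e4
    cases hpb : p.b with
    | true =>
      simp only [hpb, if_true, Bool.not_true] at l1 l2 l3 l4 e1 e2 e3 e4
      refine ⟨p.edgeAt (q.u - 1), q.edgeAt (q.u - 1), p.edgeAt (p.w - 1 + 1), q.edgeAt (p.w - 1 + 1),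
        (List.range' (q.u - 1) (p.w - 1 - (q.u - 1))).map D.stepEdge, ?_, ?_, e1.trans e3.symm, ?_⟩
      · rw [infix_route_iff]
        refine ⟨_, _, a1, a2, a3, ?_⟩
        rw [hpb]; simp
      · rw [infix_route_iff]
        refine ⟨_, _, b1, a2, b3, ?_⟩
        rw [← hb, hpb]; simp
      · rw [l1, l2, l3, l4]; simp
    | false =>
      simp only [hpb, Bool.not_false, Bool.false_eq_true, if_false] at l1 l2 l3 l4 e1 e2 e3 e4
      refine ⟨p.edgeAt (p.w - 1 + 1), q.edgeAt (p.w - 1 + 1), p.edgeAt (q.u - 1), q.edgeAt (q.u - 1),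
        ((List.range' (q.u - 1) (p.w - 1 - (q.u - 1))).map D.stepEdge).reverse, ?_, ?_,
        e2.trans e4.symm, ?_⟩
      · rw [infix_route_iff]
        refine ⟨_, _, a1, a2, a3, ?_⟩
        rw [hpb]; simp
      · rw [infix_route_iff]
        refine ⟨_, _, b1, a2, b3, ?_⟩
        rw [← hb, hpb]; simp
      · rw [l1, l2, l3, l4]; simp
  · have hb : q.b = !p.b := p.leg.dir_ne_of_next q.leg hn
    obtain ⟨n1, n2⟩ := not_path_end_of_next hn
    have a1 : p.lo ≤ p.e := by rw [lo_le_iff]; omega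
    have b1 : q.lo ≤ q.s := by rw [lo_le_iff]; omega
    have a3 : p.e ≤ p.hi := by rw [le_hi_iff _ _ (Or.inr ‹_›)]; omega
    have b3 : q.s ≤ q.hi := by rw [le_hi_iff _ _ (Or.inr ‹_›)]; omega
    have l1 := p.isTwo_edgeAt a1 a3
    have l2 := p.isTwo_edgeAt_succ a1 a3
    have l3 := q.isTwo_edgeAt b1 b3
    have l4 := q.isTwo_edgeAt_succ b1 b3
    rw [if_neg (by omega)] at l1 l4
    rw [if_pos (by omega)] at l2 l3
    have e1 := p.end_edgeAt a1 a3
    have e2 := p.start_edgeAt a1 a3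
    have e3 := q.end_edgeAt b1 b3
    have e4 := q.start_edgeAt b1 b3
    have hv : D.vtx p.e = D.vtx q.s := by
      rw [D.vtx_eq_iff p.leg.le (d5.le.trans q.leg.le)]
      rcases hn with hn | hn
      · exact Or.inl hn
      · exact Or.inr ⟨hn.1, Or.inr hn.2⟩
    cases hpb : p.b with
    | true =>
      simp only [hb, hpb, if_true, Bool.not_true, Bool.not_false, Bool.false_eq_true, if_false]
        at l1 l2 l3 l4 e1 e2 e3 e4
      refine ⟨p.edgeAt p.e, q.edgeAt (q.s + 1), p.edgeAt (p.e + 1), q.edgeAt q.s, [], ?_, ?_,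
        by rw [e1, e4, hv], ?_⟩
      · rw [infix_route_iff]
        refine ⟨_, _, a1, le_rfl, a3, ?_⟩
        rw [hpb]; simp
      · rw [infix_route_iff]
        refine ⟨_, _, b1, le_rfl, b3, ?_⟩
        rw [hb, hpb]; simp
      · rw [l1, l2, l3, l4]; simp
    | false =>
      simp only [hb, hpb, if_true, Bool.not_true, Bool.not_false, Bool.false_eq_true, if_false]
        at l1 l2 l3 l4 e1 e2 e3 e4
      refine ⟨p.edgeAt (p.e + 1), q.edgeAt q.s, p.edgeAt p.e, q.edgeAt (q.s + 1), [], ?_, ?_,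
        by rw [e2, e3, hv], ?_⟩
      · rw [infix_route_iff]
        refine ⟨_, _, a1, le_rfl, a3, ?_⟩
        rw [hpb]; simp
      · rw [infix_route_iff]
        refine ⟨_, _, b1, le_rfl, b3, ?_⟩
        rw [hb, hpb]; simp
      · rw [l1, l2, l3, l4]; simp

theorem conflict_iff (p q : Span D) : Conflict p.route q.route ↔ Clash p q ∨ Clash q p :=
  ⟨clash_of_conflict, fun h => h.elim conflict_of_clash fun h => conflict_symm (conflict_of_clash h)⟩

/-! ### `g`-vectors -/

variable (D) in
/-- The basis vector of a point of an extended leg, which is zero at the two ends. -/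
noncomputable def pt (s e p : ℕ) : Fin D.numInner → ℝ :=
  if s < p ∧ p < e + 2 then Pi.single (D.vtx (p - 1)) 1 else 0

theorem pair_infix_iff (p : Span D) (v : Fin D.numInner) (c c' : Bool) :
    (∃ e f, [e, f] <:+: p.route.edges ∧ D.dag.head e = .inner v ∧
      D.dag.isTwo e = c ∧ D.dag.isTwo f = c') ↔
    ∃ x, p.lo ≤ x ∧ x ≤ p.hi ∧ D.vtx x = v ∧
      (if p.u = x + 1 then !p.b else p.b) = (if p.b then c else c') ∧
      (if p.w = x + 1 then !p.b else p.b) = (if p.b then c' else c) := by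
  constructor
  · rintro ⟨e, f, h1, h2, h3, h4⟩
    have h1 : (e :: [] ++ [f]) <:+: p.route.edges := h1
    rw [infix_route_iff] at h1
    obtain ⟨x, y, a1, a2, a3, a4⟩ := h1
    have hxy : x = y := by
      split_ifs at a4
      · have := congrArg List.length a4.2.2; simp at this; omega
      · have := congrArg List.length a4.2.2; simp at this; omega
    subst hxy
    have l1 := p.isTwo_edgeAt a1 a3
    have l2 := p.isTwo_edgeAt_succ a1 a3
    have e1 := p.end_edgeAt a1 a3
    have e2 := p.start_edgeAt a1 a3
    refine ⟨x, a1, a3, ?_⟩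
    rw [← l1, ← l2]
    split_ifs at a4 e1 e2 ⊢
    · rw [← a4.1] at e1 ⊢
      rw [← a4.2.1]
      rw [e1, DagVertex.inner.injEq] at h2
      exact ⟨h2, h3, h4⟩
    · rw [← a4.2.1] at e2 ⊢
      rw [← a4.1]
      rw [e2, DagVertex.inner.injEq] at h2
      exact ⟨h2, h4, h3⟩
  · rintro ⟨x, a1, a3, h2, h3, h4⟩
    have l1 := p.isTwo_edgeAt a1 a3
    have l2 := p.isTwo_edgeAt_succ a1 a3
    have e1 := p.end_edgeAt a1 a3
    have e2 := p.start_edgeAt a1 a3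
    rw [← l1] at h3
    rw [← l2] at h4
    cases hb : p.b with
    | true =>
      simp only [hb, if_true] at e1 e2 h3 h4
      refine ⟨p.edgeAt x, p.edgeAt (x + 1), ?_, by rw [e1, h2], h3, h4⟩
      refine (p.infix_route_iff _ _ []).2 ⟨x, x, a1, le_rfl, a3, ?_⟩
      rw [hb]; simp
    | false =>
      simp only [hb, Bool.false_eq_true, if_false] at e1 e2 h3 h4
      refine ⟨p.edgeAt (x + 1), p.edgeAt x, ?_, by rw [e2, h2], h4, h3⟩
      refine (p.infix_route_iff _ _ []).2 ⟨x, x, a1, le_rfl, a3, ?_⟩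
      rw [hb]; simp

theorem gVec_route_aux (p : Span D) (v : Fin D.numInner) : gVec p.route v =
    (open Classical in
      if ∃ x, p.lo ≤ x ∧ x ≤ p.hi ∧ D.vtx x = v ∧ p.u = x + 1 ∧ p.w ≠ x + 1 then -1
      else if ∃ x, p.lo ≤ x ∧ x ≤ p.hi ∧ D.vtx x = v ∧ p.u ≠ x + 1 ∧ p.w = x + 1 then 1 else 0) := by
  classical
  unfold gVec
  rw [if_congr (p.pair_infix_iff v false true) rfl (if_congr (p.pair_infix_iff v true false) rfl rfl)]
  refine if_congr ?_ rfl (if_congr ?_ rfl rfl)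
  · refine exists_congr fun x => and_congr_right fun _ => and_congr_right fun _ =>
      and_congr_right fun _ => ?_
    cases p.b <;> simp
  · refine exists_congr fun x => and_congr_right fun _ => and_congr_right fun _ =>
      and_congr_right fun _ => ?_
    cases p.b <;> simp

/-- The signs do not depend on the direction of the leg: reversing it exchanges the two labels and
also entering with leaving. If both endpoints are at the same vertex, they cancel. -/
theorem gVec_route (p : Span D) : gVec p.route = pt D p.s p.e p.w - pt D p.s p.e p.u := by
  classical
  have hw := p.w_pos
  have c1 := p.s_le_lo; have c2 := p.hi_le_e; have c3 := p.leg.le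
  have c5 := p.leg.lt; have c6 := p.le_e; have c7 := p.s_le; have c8 := p.ok; have c9 := p.le
  funext v
  rw [gVec_route_aux, Pi.sub_apply]
  have A : pt D p.s p.e p.u v =
      if ∃ x, p.lo ≤ x ∧ x ≤ p.hi ∧ D.vtx x = v ∧ p.u = x + 1 then 1 else 0 := by
    unfold pt
    by_cases h : p.s < p.u
    · rw [if_pos (by omega), Pi.single_apply]
      refine if_congr ⟨fun hv => ⟨p.u - 1, ?_, ?_, hv.symm, by omega⟩, ?_⟩ rfl rfl
      · rw [lo_le_iff]; omega
      · rw [le_hi_iff _ _ (Or.inr hw)]; omega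
      · rintro ⟨x, -, -, h1, h2⟩
        rw [← h1, h2]; simp
    · rw [if_neg (by omega), if_neg]; · rfl
      rintro ⟨x, h1, -, -, h2⟩
      omega
  have B : pt D p.s p.e p.w v =
      if ∃ x, p.lo ≤ x ∧ x ≤ p.hi ∧ D.vtx x = v ∧ p.w = x + 1 then 1 else 0 := by
    unfold pt
    by_cases h : p.w < p.e + 2
    · rw [if_pos (by omega), Pi.single_apply]
      refine if_congr ⟨fun hv => ⟨p.w - 1, ?_, ?_, hv.symm, by omega⟩, ?_⟩ rfl rfl
      · rw [lo_le_iff]; omega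
      · rw [le_hi_iff _ _ (Or.inr hw)]; omega
      · rintro ⟨x, -, -, h1, h2⟩
        rw [← h1, h2]; simp
    · rw [if_neg (by omega), if_neg]; · rfl
      rintro ⟨x, h1, h3, -, h2⟩
      omega
  rw [A, B]
  -- Different positions on a leg are different vertices, as a leg does not follow itself.
  have huniq : ∀ x y, p.lo ≤ x → x ≤ p.hi → D.vtx x = v → p.lo ≤ y → y ≤ p.hi → D.vtx y = v →
      x = y := by
    intro x y h1 h2 h3 h4 h5 h6
    rcases p.leg.vtx_eq p.leg (by omega) (by omega) (by omega) (by omega) (h3.trans h6.symm) with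
      h | h | h
    · exact h.2.2
    · have := p.leg.dir_ne_of_next p.leg h.1; simp at this
    · have := p.leg.dir_ne_of_next p.leg h.1; simp at this
  by_cases hex : ∃ x, p.lo ≤ x ∧ x ≤ p.hi ∧ D.vtx x = v
  · obtain ⟨x, h1, h2, h3⟩ := hex
    have red : ∀ P : ℕ → Prop, (∃ y, p.lo ≤ y ∧ y ≤ p.hi ∧ D.vtx y = v ∧ P y) ↔ P x := by
      intro P
      constructor
      · rintro ⟨y, h4, h5, h6, h7⟩
        rwa [huniq x y h1 h2 h3 h4 h5 h6]
      · intro h; exact ⟨x, h1, h2, h3, h⟩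
    simp only [red]
    by_cases e1 : p.u = x + 1 <;> by_cases e2 : p.w = x + 1 <;> simp [e1, e2]
  · have red : ∀ P : ℕ → Prop, ¬ (∃ y, p.lo ≤ y ∧ y ≤ p.hi ∧ D.vtx y = v ∧ P y) := by
      rintro P ⟨y, h4, h5, h6, h7⟩
      exact hex ⟨y, h4, h5, h6⟩
    rw [if_neg (red _), if_neg (red _), if_neg (red _), if_neg (red _)]; simp

end Span

end LabShape

/-! ### Routes with a common source or sink edge -/

namespace LabShape

open FramedDag

variable {D : LabShape}

theorem srcEdge_inj {v v' : Fin D.numInner} {c c' : Bool} {h : D.NeedsSource v c}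
    {h' : D.NeedsSource v' c'} : srcEdge v c h = srcEdge v' c' h' ↔ v = v' ∧ c = c' := by
  constructor
  · intro h; injection h with h1 h2; exact ⟨h1, h2⟩
  · rintro ⟨rfl, rfl⟩; rfl

theorem snkEdge_inj {v v' : Fin D.numInner} {c c' : Bool} {h : D.NeedsSink v c}
    {h' : D.NeedsSink v' c'} : snkEdge v c h = snkEdge v' c' h' ↔ v = v' ∧ c = c' := by
  constructor
  · intro h; injection h with h1 h2; exact ⟨h1, h2⟩
  · rintro ⟨rfl, rfl⟩; rfl

theorem lowEnd_inj {b b' : Bool} (hb : b = b') {x x' : ℕ} {c c' : Bool} {h : D.LowFree b x c}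
    {h' : D.LowFree b' x' c'} :
    lowEnd b x c h = lowEnd b' x' c' h' ↔ D.vtx x = D.vtx x' ∧ c = c' := by
  subst hb
  cases b
  · rw [lowEnd_false, lowEnd_false, snkEdge_inj]
  · rw [lowEnd_true, lowEnd_true, srcEdge_inj]

theorem highEnd_inj {b b' : Bool} (hb : b = b') {x x' : ℕ} {c c' : Bool} {h : D.HighFree b x c}
    {h' : D.HighFree b' x' c'} :
    highEnd b x c h = highEnd b' x' c' h' ↔ D.vtx x = D.vtx x' ∧ c = c' := by
  subst hb
  cases b
  · rw [highEnd_false, highEnd_false, srcEdge_inj]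
  · rw [highEnd_true, highEnd_true, snkEdge_inj]

/-- For opposite directions the upper end of one leg and the lower end of the other are both source
edges or both sink edges, so consecutive legs can share an end edge. -/
theorem highEnd_eq_lowEnd {b b' : Bool} (hb : b' = !b) {x x' : ℕ} {c c' : Bool}
    {h : D.HighFree b x c} {h' : D.LowFree b' x' c'} :
    highEnd b x c h = lowEnd b' x' c' h' ↔ D.vtx x = D.vtx x' ∧ c = c' := by
  subst hb
  cases b
  · rw [highEnd_false]; exact srcEdge_inj
  · rw [highEnd_true]; exact snkEdge_inj

namespace Span

/-- The two intervals lie in the same leg. -/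
def SameLeg (p q : Span D) : Prop := p.s = q.s ∧ p.e = q.e

/-- `q` is obtained from `p` by raising the upper end. -/
def HU (p q : Span D) : Prop := p.SameLeg q ∧ p.u = q.u ∧ p.w < q.w

/-- `q` is obtained from `p` by raising the lower end. -/
def LU (p q : Span D) : Prop := p.SameLeg q ∧ p.w = q.w ∧ p.u < q.u

/-- The leg of `q` follows the leg of `p`, and the routes share an end edge there. -/
def NX (p q : Span D) : Prop :=
  -- The end edges at the junction agree if `p.w = p.e + 1` and `q.u = q.s`, or `p.w = p.e + 2` and
  -- `q.u = q.s + 1`: a label change for one route is none for the other. The equation covers both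
  -- cases.
  D.Next p.e q.s ∧ p.e + 1 ≤ p.w ∧ p.w + q.s = q.u + p.e + 1

theorem SameLeg.b_eq {p q : Span D} (h : p.SameLeg q) : p.b = q.b := b_eq_of_s_eq h.1

theorem b_ne_of_next {p q : Span D} (h : D.Next p.e q.s) : q.b = !p.b :=
  p.leg.dir_ne_of_next q.leg h

theorem NX.b_ne {p q : Span D} (h : p.NX q) : q.b = !p.b := b_ne_of_next h.1

theorem u_le_e_of_next {p q : Span D} (hn : D.Next p.e q.s) : p.u ≤ p.e := by
  have h1 := p.leg.lt; have h2 := q.leg.lt; have h3 := q.leg.le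
  rcases p.ok with h | h
  · exact h.2
  · rcases hn with hn | hn
    · have := p.le; omega
    · rw [h.1] at hn; simp at hn

theorem le_w_of_next {p q : Span D} (hn : D.Next p.e q.s) : q.s + 2 ≤ q.w := by
  have h1 := p.leg.lt; have h2 := q.leg.lt; have h3 := p.leg.le
  rcases q.ok with h | h
  · exact h.1
  · rcases hn with hn | hn
    · have := q.le; omega
    · rw [h.1] at hn; simp at hn

theorem vtx_eq_of_next {e s : ℕ} (he : e ≤ D.numSteps) (hs : s ≤ D.numSteps) (hn : D.Next e s) :
    D.vtx e = D.vtx s := by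
  rw [D.vtx_eq_iff he hs]
  rcases hn with hn | hn
  · exact Or.inl hn
  · exact Or.inr ⟨hn.1, Or.inr hn.2⟩

theorem low_eq_iff {p q : Span D} (hb : p.b = q.b) :
    (D.vtx p.lo = D.vtx q.lo ∧ p.lowLabel = q.lowLabel) ↔ p.SameLeg q ∧ p.u = q.u := by
  have c1 := p.s_le_lo; have c2 := p.hi_le_e; have c3 := p.lo_le_hi
  have d1 := q.s_le_lo; have d2 := q.hi_le_e; have d3 := q.lo_le_hi
  constructor
  · rintro ⟨h1, h2⟩
    rcases p.leg.vtx_eq q.leg c1 (by omega) d1 (by omega) h1 with ⟨h3, h4, h5⟩ | ⟨h3, -⟩ | ⟨h3, -⟩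
    · refine ⟨⟨h3, h4⟩, ?_⟩
      have : p.u = p.s ↔ q.u = q.s := by
        rw [lowLabel, lowLabel, hb] at h2
        by_cases k1 : p.u = p.s <;> by_cases k2 : q.u = q.s <;> simp_all
      have := p.s_le; have := q.s_le
      simp only [lo] at h5
      omega
    · have := b_ne_of_next h3; rw [hb] at this; simp at this
    · have := b_ne_of_next h3; rw [hb] at this; simp at this
  · rintro ⟨⟨h1, h2⟩, h3⟩
    simp only [lo, lowLabel, h1, h3, hb, and_self]

theorem high_eq_iff {p q : Span D} (hb : p.b = q.b) :
    (D.vtx p.hi = D.vtx q.hi ∧ p.highLabel = q.highLabel) ↔ p.SameLeg q ∧ p.w = q.w := by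
  have c1 := p.s_le_lo; have c2 := p.hi_le_e; have c3 := p.lo_le_hi
  have d1 := q.s_le_lo; have d2 := q.hi_le_e; have d3 := q.lo_le_hi
  constructor
  · rintro ⟨h1, h2⟩
    rcases p.leg.vtx_eq q.leg (by omega) c2 (by omega) d2 h1 with ⟨h3, h4, h5⟩ | ⟨h3, -⟩ | ⟨h3, -⟩
    · refine ⟨⟨h3, h4⟩, ?_⟩
      have : p.w = p.e + 2 ↔ q.w = q.e + 2 := by
        rw [highLabel, highLabel, hb] at h2
        by_cases k1 : p.w = p.e + 2 <;> by_cases k2 : q.w = q.e + 2 <;> simp_all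
      have := p.le_e; have := q.le_e; have := p.w_pos; have := q.w_pos
      simp only [hi] at h5
      omega
    · have := b_ne_of_next h3; rw [hb] at this; simp at this
    · have := b_ne_of_next h3; rw [hb] at this; simp at this
  · rintro ⟨⟨h1, h2⟩, h3⟩
    simp only [hi, highLabel, h2, h3, hb, and_self]

theorem high_eq_low_iff {p q : Span D} (hb : q.b = !p.b) :
    (D.vtx p.hi = D.vtx q.lo ∧ p.highLabel = q.lowLabel) ↔ p.NX q := by
  have c1 := p.s_le_lo; have c2 := p.hi_le_e; have c3 := p.lo_le_hi
  have d1 := q.s_le_lo; have d2 := q.hi_le_e; have d3 := q.lo_le_hi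
  have := p.le_e; have := q.s_le; have := p.w_pos; have := p.leg.lt; have := q.leg.lt
  have lab : p.highLabel = q.lowLabel ↔ (p.w = p.e + 2 ↔ ¬ q.u = q.s) := by
    rw [highLabel, lowLabel, hb]
    by_cases k1 : p.w = p.e + 2 <;> by_cases k2 : q.u = q.s <;> simp_all
  rw [lab]
  constructor
  · rintro ⟨h1, h2⟩
    rcases p.leg.vtx_eq q.leg (by omega) c2 d1 (by omega) h1 with ⟨h3, -⟩ | ⟨h3, h4, h5⟩ | ⟨h3, h4, h5⟩
    · have := b_eq_of_s_eq h3; rw [hb] at this; simp at this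
    · refine ⟨h3, ?_⟩
      simp only [hi, lo] at h4 h5
      omega
    · have := u_le_e_of_next h3
      simp only [lo] at h4; omega
  · rintro ⟨h1, h2, h3⟩
    have k1 : p.hi = p.e := by simp only [hi]; omega
    have k2 : q.lo = q.s := by simp only [lo]; omega
    rw [k1, k2]
    exact ⟨vtx_eq_of_next p.leg.le (q.leg.lt.le.trans q.leg.le) h1, by omega⟩

theorem low_inj {p q : Span D} (hb : p.b = q.b) : p.low = q.low ↔ p.SameLeg q ∧ p.u = q.u := by
  rw [low, low, lowEnd_inj hb, low_eq_iff hb]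

theorem high_inj {p q : Span D} (hb : p.b = q.b) :
    p.high = q.high ↔ p.SameLeg q ∧ p.w = q.w := by
  rw [high, high, highEnd_inj hb, high_eq_iff hb]

theorem high_eq_low {p q : Span D} (hb : q.b = !p.b) : p.high = q.low ↔ p.NX q := by
  rw [high, low, highEnd_eq_lowEnd hb, high_eq_low_iff hb]

theorem first_eq_iff (p q : Span D) : p.route.first = q.route.first ↔
    (p.SameLeg q ∧ ((p.b = true ∧ p.u = q.u) ∨ (p.b = false ∧ p.w = q.w))) ∨
      (p.b = true ∧ q.NX p) ∨ (p.b = false ∧ p.NX q) := by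
  rw [first_route, first_route]
  have hcc := fun h : p.SameLeg q => h.b_eq
  have hx1 := fun h : p.NX q => h.b_ne
  have hx2 := fun h : q.NX p => h.b_ne
  cases hp : p.b <;> cases hq : q.b <;>
    simp only [hp, hq, if_true, Bool.false_eq_true, if_false] at hcc hx1 hx2 ⊢
  · rw [high_inj (hp.trans hq.symm)]; simp at hcc hx1 hx2 ⊢; tauto
  · rw [high_eq_low (by rw [hp, hq]; rfl)]; simp at hcc hx1 hx2 ⊢; tauto
  · rw [eq_comm, high_eq_low (by rw [hp, hq]; rfl)]; simp at hcc hx1 hx2 ⊢; tauto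
  · rw [low_inj (hp.trans hq.symm)]; simp at hcc hx1 hx2 ⊢; tauto

theorem last_eq_iff (p q : Span D) : p.route.last = q.route.last ↔
    (p.SameLeg q ∧ ((p.b = true ∧ p.w = q.w) ∨ (p.b = false ∧ p.u = q.u))) ∨
      (p.b = true ∧ p.NX q) ∨ (p.b = false ∧ q.NX p) := by
  rw [last_route, last_route]
  have hcc := fun h : p.SameLeg q => h.b_eq
  have hx1 := fun h : p.NX q => h.b_ne
  have hx2 := fun h : q.NX p => h.b_ne
  cases hp : p.b <;> cases hq : q.b <;>
    simp only [hp, hq, if_true, Bool.false_eq_true, if_false] at hcc hx1 hx2 ⊢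
  · rw [low_inj (hp.trans hq.symm)]; simp at hcc hx1 hx2 ⊢; tauto
  · rw [eq_comm, high_eq_low (by rw [hp, hq]; rfl)]; simp at hcc hx1 hx2 ⊢; tauto
  · rw [high_eq_low (by rw [hp, hq]; rfl)]; simp at hcc hx1 hx2 ⊢; tauto
  · rw [high_inj (hp.trans hq.symm)]; simp at hcc hx1 hx2 ⊢; tauto

theorem stepEdge_mem_route (p : Span D) {t : ℕ} (ht : t < D.numSteps) :
    D.stepEdge t ∈ p.route.edges ↔ p.lo ≤ t ∧ t < p.hi := by
  have h0 : D.stepEdge t ∈ p.route.edges ↔ D.stepEdge t ∈ p.edgesUp := by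
    rw [route_edges]; split_ifs <;> simp
  have g1 : D.stepEdge t ≠ p.low := by
    rw [low]
    generalize p.lowFree = f
    revert f
    cases p.b <;> intro f <;> rw [stepEdge_eq ht] <;> exact fun h => by injection h
  have g2 : D.stepEdge t ≠ p.high := by
    rw [high]
    generalize p.highFree = f
    revert f
    cases p.b <;> intro f <;> rw [stepEdge_eq ht] <;> exact fun h => by injection h
  rw [h0, edgesUp_eq]
  simp only [List.cons_append, List.mem_cons, List.mem_append, g1, g2, false_or,
    List.not_mem_nil, or_false]
  exact stepEdge_mem_iff p.hi_le ht p.lo_le_hi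

/-! ### Ranks of boxes -/

/-- This is the test for a name without sign, read at the lower end: the end edge lies on a short
exceptional route if an edge with the same label can be attached on the other side of the vertex. -/
theorem highFree_low (p : Span D) : D.HighFree p.b p.lo p.lowLabel ↔
    p.u ≠ p.s ∧ (p.u = p.s + 1 → D.cyclic = false ∧ p.s = 0) := by
  have c1 := p.s_le_lo; have c2 := p.hi_le_e; have c3 := p.lo_le_hi; have c4 := p.leg.le
  have c5 := p.leg.lt; have c6 := p.s_le
  rw [highFree_iff]
  constructor
  · rintro ⟨h1, h2⟩
    have hu : p.u ≠ p.s := by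
      intro hu
      have hl : p.lo = p.s := by simp only [lo]; omega
      exact h1 (by simp [lowLabel, hu]) p.s (by omega) rfl (by rw [hl])
    refine ⟨hu, fun hu' => ?_⟩
    by_contra hs
    obtain ⟨s', e', hl', hn⟩ := p.leg.exists_before hs
    have hl : p.lo = p.s := by simp only [lo]; omega
    have := hl'.lt; have := hl'.le
    refine h2 (by simp [lowLabel, hu]) (e' - 1) (by omega) ?_ ?_
    · rw [hl'.dir_eq (e' - 1) (by omega) (by omega), b, hl'.dir_ne_of_next p.leg hn]; simp
    · rw [hl, ← vtx_eq_of_next (by omega) (by omega) hn]; congr 1; omega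
  · rintro ⟨h1, h2⟩
    refine ⟨fun h => ?_, fun _ j hj hd hv => ?_⟩
    · simp [lowLabel, h1] at h
    · rcases p.leg.dir_before c1 (by omega) hj hv with h | h
      · rw [h.2.2, b] at hd; simp at hd
      · have hu : p.u = p.s + 1 := by
          have := h.1; simp only [lo] at this; omega
        obtain ⟨h3, h4⟩ := h2 hu
        rw [D.vtx_eq_iff (by omega) (by omega)] at hv
        rcases hv with hv | hv
        · omega
        · rw [h3] at hv; simp at hv

theorem lowFree_high (p : Span D) : D.LowFree p.b p.hi p.highLabel ↔
    p.w ≠ p.e + 2 ∧ (p.w = p.e + 1 → D.cyclic = false ∧ p.e = D.numSteps) := by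
  have c1 := p.s_le_lo; have c2 := p.hi_le_e; have c3 := p.lo_le_hi; have c4 := p.leg.le
  have c5 := p.leg.lt; have c6 := p.le_e; have c7 := p.w_pos
  rw [lowFree_iff]
  constructor
  · rintro ⟨h1, h2⟩
    have hu : p.w ≠ p.e + 2 := by
      intro hu
      have hl : p.hi = p.e := by simp only [hi]; omega
      refine h1 (by simp [highLabel, hu]) (p.e - 1) (by omega)
        (p.leg.dir_eq _ (by omega) (by omega)) ?_
      rw [hl]; congr 1; omega
    refine ⟨hu, fun hu' => ?_⟩
    by_contra hs
    obtain ⟨s', e', hl', hn⟩ := p.leg.exists_after hs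
    have hl : p.hi = p.e := by simp only [hi]; omega
    have := hl'.lt; have := hl'.le
    refine h2 (by simp [highLabel, hu]) s' (by omega) ?_ ?_
    · rw [b, p.leg.dir_ne_of_next hl' hn]
    · rw [hl, ← vtx_eq_of_next (by omega) (by omega) hn]
  · rintro ⟨h1, h2⟩
    refine ⟨fun h => ?_, fun _ j hj hd hv => ?_⟩
    · simp [highLabel, h1] at h
    · rcases p.leg.dir_after (by omega) c2 hj hv with h | h
      · rw [h.2.2, b] at hd; simp at hd
      · have hu : p.w = p.e + 1 := by
          have := h.1; simp only [hi] at this; omega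
        obtain ⟨h3, h4⟩ := h2 hu
        rw [D.vtx_eq_iff (by omega) (by omega)] at hv
        rcases hv with hv | hv
        · omega
        · rw [h3] at hv; simp at hv

open Classical in
variable (D) in
/-- The position of the lower end edge. -/
noncomputable def lowRank (p : Span D) : ℤ :=
  3 * ((p.lo : ℤ) + 1) + (if p.u = p.s then -1
    else if p.u = p.s + 1 ∧ ¬ (D.cyclic = false ∧ p.s = 0) then 1 else 0)

open Classical in
variable (D) in
/-- The position of the upper end edge, counted without returning to the first vertex. -/
noncomputable def highRank (p : Span D) : ℤ :=
  3 * ((p.hi : ℤ) + 1) + (if p.w = p.e + 2 then 1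
    else if p.w = p.e + 1 ∧ ¬ (D.cyclic = false ∧ p.e = D.numSteps) then -1 else 0)

theorem vtx_lo_val (p : Span D) : (D.vtx p.lo : ℕ) = p.lo := by
  apply D.vtx_val_of_lt
  have c2 := p.hi_le; have c3 := p.lo_le_hi
  cases hc : D.cyclic with
  | false => rw [D.numInner_of_not_cyclic hc]; omega
  | true =>
    rw [D.numInner_of_cyclic hc]
    have c8 := p.ok; rw [hc] at c8; simp at c8
    have := p.leg.lt; have := p.leg.le
    simp only [lo]; omega

theorem vtx_hi_val (p : Span D) : (D.vtx p.hi : ℕ) =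
    if D.cyclic = true ∧ p.hi = D.numSteps then 0 else p.hi := by
  have c2 := p.hi_le
  split_ifs with h
  · rw [h.2, D.vtx_numSteps h.1]
  · apply D.vtx_val_of_lt
    cases hc : D.cyclic with
    | false => rw [D.numInner_of_not_cyclic hc]; omega
    | true =>
      have : p.hi ≠ D.numSteps := fun h' => h ⟨hc, h'⟩
      rw [D.numInner_of_cyclic hc]; omega

theorem b_eq_false_of_hi (p : Span D) (hc : D.cyclic = true) (h : p.hi = D.numSteps) :
    p.b = false := by
  have := p.hi_le_e; have := p.leg.le; have := p.leg.lt
  have h1 := p.leg.dir_eq (D.numSteps - 1) (by omega) (by omega)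
  rw [D.dir_last hc] at h1
  exact h1.symm

/-- A backward leg has its source edges at upper ends, and only the last leg of a cycle has the
first vertex as its upper end. -/
theorem inBottomRows_iff (p : Span D) :
    D.InBottomRows p.route ↔ D.cyclic = true ∧ p.hi = D.numSteps := by
  have c1 := p.s_le_lo; have c2 := p.hi_le_e; have c3 := p.lo_le_hi; have c4 := p.leg.le
  have c5 := p.leg.lt
  have h0 : (⟨0, D.numInner_pos⟩ : Fin D.numInner) = D.vtx 0 :=
    Fin.ext (D.vtx_val_of_lt D.numInner_pos).symm
  have hhead : p.b = false → D.dag.head p.route.first = .inner (D.vtx p.hi) := by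
    intro hb
    have := p.start_edgeAt p.lo_le_hi le_rfl
    rw [first_route]
    rw [hb] at this ⊢
    simpa [edgeAt_hi] using this
  unfold InBottomRows
  rw [h0]
  constructor
  · rintro ⟨hc, h1, j, h2, h3⟩
    refine ⟨hc, ?_⟩
    have hj := j.2
    have h3 : D.stepEdge j ∈ p.route.edges := by rw [← step_eq_stepEdge]; exact h3
    rw [stepEdge_mem_route p hj] at h3
    have hb : p.b = false := by
      rw [← h2, isForward_eq, p.leg.dir_eq j (by omega) (by omega), b]
    rw [hhead hb, DagVertex.inner.injEq, D.vtx_eq_iff (by omega) (by omega)] at h1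
    rcases h1 with h1 | h1
    · omega
    · omega
  · rintro ⟨hc, h⟩
    have hb := p.b_eq_false_of_hi hc h
    refine ⟨hc, ?_, ?_⟩
    · rw [hhead hb, DagVertex.inner.injEq, D.vtx_eq_iff (by omega) (by omega)]
      right; exact ⟨hc, Or.inr ⟨h, rfl⟩⟩
    · have hlt : p.lo < p.hi := by
        have c8 := p.ok; rw [hc] at c8; simp at c8
        simp only [lo]; omega
      have hN : p.lo < D.numSteps := by omega
      refine ⟨⟨p.lo, hN⟩, ?_, ?_⟩
      · rw [isForward_eq]
        exact (p.leg.dir_eq p.lo (by omega) (by omega)).trans hb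
      · have : D.stepEdge p.lo ∈ p.route.edges := (p.stepEdge_mem_route hN).2 ⟨le_rfl, hlt⟩
        rwa [stepEdge_eq hN] at this

theorem sourceRank_srcEdge (v : Fin D.numInner) (c : Bool) (h : D.NeedsSource v c) :
    D.sourceRank (srcEdge v c h) = 3 * ((v : ℤ) + 1) +
      (open Classical in if D.NeedsSink v c then 0 else if c then -1 else 1) := rfl

theorem sinkRank_snkEdge (v : Fin D.numInner) (c : Bool) (h : D.NeedsSink v c) :
    D.sinkRank (snkEdge v c h) = 3 * ((v : ℤ) + 1) +
      (open Classical in if D.NeedsSource v c then 0 else if c then 1 else -1) := rfl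

theorem rank_low (p : Span D) :
    (if p.b then D.sourceRank p.low else D.sinkRank p.low) = lowRank D p := by
  have h1 := p.highFree_low
  have h2 := p.vtx_lo_val
  have h3 : p.lowLabel = p.b ↔ p.u = p.s := by
    rw [lowLabel]; by_cases h : p.u = p.s <;> simp [h]
  rw [low, lowRank]
  generalize p.lowFree = f
  revert f
  cases hb : p.b with
  | true =>
    intro f
    rw [hb] at h1 h3
    have h4 : D.NeedsSink (D.vtx p.lo) p.lowLabel ↔ D.HighFree true p.lo p.lowLabel := by
      simp [HighFree]
    rw [if_pos rfl, lowEnd_true, sourceRank_srcEdge, h2]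
    simp only [h4, h1, h3]
    congr 1
    split_ifs <;> first | rfl | (exfalso; tauto)
  | false =>
    intro f
    rw [hb] at h1 h3
    have h4 : D.NeedsSource (D.vtx p.lo) p.lowLabel ↔ D.HighFree false p.lo p.lowLabel := by
      simp [HighFree]
    have h5 : p.lowLabel = true ↔ ¬ p.u = p.s := by rw [← h3]; simp
    rw [if_neg (by simp), lowEnd_false, sinkRank_snkEdge, h2]
    simp only [h4, h1, h5]
    congr 1
    split_ifs <;> first | rfl | (exfalso; tauto)

-- The last leg of a cycle ends at position `numSteps`, which is the first vertex. The shift of the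
-- bottom rows in `rowIndex` compensates for the correction here.
open Classical in
theorem rank_high (p : Span D) :
    (if p.b then D.sinkRank p.high else D.sourceRank p.high) = highRank D p -
      (if D.cyclic = true ∧ p.hi = D.numSteps then 3 * (D.numInner : ℤ) else 0) := by
  have h1 := p.lowFree_high
  have h2 := p.vtx_hi_val
  have h3 : p.highLabel = p.b ↔ p.w = p.e + 2 := by
    rw [highLabel]; by_cases h : p.w = p.e + 2 <;> simp [h]
  have h6 : ((D.vtx p.hi : ℕ) : ℤ) = (p.hi : ℤ) -
      (if D.cyclic = true ∧ p.hi = D.numSteps then (D.numInner : ℤ) else 0) := by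
    rw [h2]
    split_ifs with h
    · rw [h.2, D.numInner_of_cyclic h.1]; simp
    · simp
  rw [high, highRank]
  generalize p.highFree = f
  revert f
  cases hb : p.b with
  | true =>
    intro f
    rw [hb] at h1 h3
    have h4 : D.NeedsSource (D.vtx p.hi) p.highLabel ↔ D.LowFree true p.hi p.highLabel := by
      simp [LowFree]
    rw [if_pos rfl, highEnd_true, sinkRank_snkEdge, h6]
    simp only [h4, h1, h3]
    split_ifs <;> first | ring1 | (exfalso; tauto)
  | false =>
    intro f
    rw [hb] at h1 h3
    have h4 : D.NeedsSink (D.vtx p.hi) p.highLabel ↔ D.LowFree false p.hi p.highLabel := by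
      simp [LowFree]
    have h5 : p.highLabel = true ↔ ¬ p.w = p.e + 2 := by rw [← h3]; simp
    rw [if_neg (by simp), highEnd_false, sourceRank_srcEdge, h6]
    simp only [h4, h1, h5]
    split_ifs <;> first | ring1 | (exfalso; tauto)

open Classical in
theorem rowIndex_route (p : Span D) :
    D.rowIndex p.route = if p.b then lowRank D p else highRank D p := by
  have h1 := p.rank_low
  have h2 := p.rank_high
  have h3 := p.b_eq_false_of_hi
  rw [rowIndex, first_route]
  cases hb : p.b with
  | true =>
    simp only [hb, if_true] at h1 ⊢
    rw [h1, if_neg]; · simp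
    rw [inBottomRows_iff]
    rintro ⟨h4, h5⟩
    have := h3 h4 h5
    rw [hb] at this; simp at this
  | false =>
    simp only [hb, Bool.false_eq_true, if_false] at h2 ⊢
    rw [h2, if_congr p.inBottomRows_iff rfl rfl]; ring

theorem colIndex_route (p : Span D) :
    D.colIndex p.route = if p.b then highRank D p else lowRank D p := by
  have h1 := p.rank_low
  have h2 := p.rank_high
  have h3 := p.b_eq_false_of_hi
  rw [colIndex, last_route]
  cases hb : p.b with
  | true =>
    simp only [hb, if_true] at h2 ⊢
    rw [h2, if_neg]; · simp
    rintro ⟨h4, h5⟩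
    have := h3 h4 h5
    rw [hb] at this; simp at this
  | false =>
    simp only [hb, Bool.false_eq_true, if_false] at h1 ⊢
    exact h1

/-- The points `s` and `s + 1` both give the vertex `s` and are separated by the sign in the name;
beyond them the vertex itself increases. -/
theorem lowRank_lt_iff {p q : Span D} (h : p.SameLeg q) :
    lowRank D p < lowRank D q ↔ p.u < q.u := by
  obtain ⟨h1, h2⟩ := h
  have := p.s_le; have := q.s_le
  simp only [lowRank, lo, h1]
  by_cases hP : D.cyclic = false ∧ q.s = 0 <;> simp only [hP, not_true_eq_false, and_false,
    and_true, not_false_eq_true, if_false, and_self] <;> split_ifs <;> omega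

theorem highRank_lt_iff {p q : Span D} (h : p.SameLeg q) :
    highRank D p < highRank D q ↔ p.w < q.w := by
  obtain ⟨h1, h2⟩ := h
  have := p.le_e; have := q.le_e; have := p.w_pos; have := q.w_pos
  simp only [highRank, hi, h2]
  by_cases hP : D.cyclic = false ∧ q.e = D.numSteps <;> simp only [hP, not_true_eq_false, and_false,
    and_true, not_false_eq_true, if_false, and_self] <;> split_ifs <;> omega

theorem lowRank_lt_highRank {p q : Span D} (h : p.NX q) (h' : p.e = q.s) :
    lowRank D p < highRank D q := by
  have h1 := u_le_e_of_next h.1; have h2 := le_w_of_next h.1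
  have := p.leg.lt; have := q.leg.lt
  simp only [lowRank, highRank, lo, hi]
  split_ifs <;> omega

theorem NX.e_eq_of_left {p q : Span D} (h : p.NX q) (hb : p.b = true) : p.e = q.s := by
  rcases h.1 with h1 | ⟨h1, h2, h3⟩
  · exact h1
  · have h4 := h.b_ne
    rw [hb, b, h3, D.dir_zero] at h4
    simp at h4

/-! ### The four directions -/

theorem not_bottom_of_b {p : Span D} (h : p.b = true) : ¬ D.InBottomRows p.route := by
  rw [inBottomRows_iff]
  rintro ⟨h1, h2⟩
  have := p.b_eq_false_of_hi h1 h2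
  rw [h] at this; simp at this

theorem not_sameLeg_of_NX {p q : Span D} (h : p.NX q) : ¬ p.SameLeg q := by
  intro h'
  have := h.b_ne
  rw [h'.b_eq] at this; simp at this

/-- A column fixes the sink edge. On a forward leg this is the upper end, so going down raises the
lower end or passes through the shared sink edge to the next leg; on a backward leg only the upper
end can rise. The other three directions are analogous. -/
theorem mem_south_iff (p q : Span D) : q.route ∈ D.south p.route ↔
    (p.b = true ∧ (p.LU q ∨ p.NX q)) ∨ (p.b = false ∧ p.HU q) := by
  simp only [south, Set.mem_ofPred_eq, last_eq_iff, rowIndex_route]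
  constructor
  · rintro ⟨⟨h1, h2⟩ | ⟨h1, h2⟩ | ⟨h1, h2⟩, h3⟩
    · have h1' : p.SameLeg q := ⟨h1.1.symm, h1.2.symm⟩
      have hb := h1.b_eq
      rcases h2 with ⟨h2, h4⟩ | ⟨h2, h4⟩
      · rw [hb] at h2
        rw [h2, if_pos rfl, hb, h2, if_pos rfl, lowRank_lt_iff h1'] at h3
        exact Or.inl ⟨h2, Or.inl ⟨h1', h4.symm, h3⟩⟩
      · rw [hb] at h2
        rw [h2, if_neg (by simp), hb, h2, if_neg (by simp), highRank_lt_iff h1'] at h3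
        exact Or.inr ⟨h2, h1', h4.symm, h3⟩
    · have hb := h2.b_ne
      rw [h1] at hb
      have := lowRank_lt_highRank h2 (h2.e_eq_of_left h1)
      rw [h1, hb] at h3
      simp at h3
      omega
    · have hb := h2.b_ne
      rw [h1] at hb
      have : p.b = true := by revert hb; cases p.b <;> simp
      exact Or.inl ⟨this, Or.inr h2⟩
  · rintro (⟨h1, ⟨h2, h3, h4⟩ | h2⟩ | ⟨h1, h2, h3, h4⟩)
    · have hb := h2.b_eq
      rw [h1] at hb
      refine ⟨Or.inl ⟨⟨h2.1.symm, h2.2.symm⟩, Or.inl ⟨hb.symm, h3.symm⟩⟩, ?_⟩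
      rw [h1, ← hb, if_pos rfl, if_pos rfl, lowRank_lt_iff h2]; exact h4
    · have hb := h2.b_ne
      rw [h1] at hb
      refine ⟨Or.inr (Or.inr ⟨hb, h2⟩), ?_⟩
      rw [h1, hb, if_pos rfl, if_neg (by simp)]
      exact lowRank_lt_highRank h2 (h2.e_eq_of_left h1)
    · have hb := h2.b_eq
      rw [h1] at hb
      refine ⟨Or.inl ⟨⟨h2.1.symm, h2.2.symm⟩, Or.inr ⟨hb.symm, h3.symm⟩⟩, ?_⟩
      rw [h1, ← hb, if_neg (by simp), if_neg (by simp), highRank_lt_iff h2]; exact h4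

theorem mem_north_iff (p q : Span D) : q.route ∈ D.north p.route ↔
    (p.b = true ∧ q.LU p) ∨ (p.b = false ∧ (q.HU p ∨ q.NX p)) := by
  have h : q.route ∈ D.north p.route ↔ p.route ∈ D.south q.route := by
    simp only [north, south, Set.mem_ofPred_eq]
    exact and_congr_left fun _ => eq_comm
  rw [h, mem_south_iff]
  have h1 : q.LU p → q.b = p.b := fun h => h.1.b_eq
  have h2 : q.HU p → q.b = p.b := fun h => h.1.b_eq
  have h3 : q.NX p → p.b = !q.b := fun h => h.b_ne
  cases hp : p.b <;> cases hq : q.b <;> simp [hp, hq] at h1 h2 h3 ⊢ <;> tauto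

theorem inBottomRows_congr {p q : Span D} (h : p.SameLeg q) (hw : p.w = q.w) :
    D.InBottomRows p.route ↔ D.InBottomRows q.route := by
  rw [inBottomRows_iff, inBottomRows_iff, hi, hi, h.2, hw]

/-- The gluing is used here. A backward leg shares source edges with the next leg, which continues
the row to the right; at the wrap-around, the row is continued from the bottom rows to the top rows.
-/
theorem isRightOf_of_NX {p q : Span D} (h : p.NX q) (hb : p.b = false) :
    D.IsRightOf q.route p.route := by
  have hq : q.b = true := by rw [h.b_ne, hb]; rfl
  have hn := not_bottom_of_b hq
  by_cases hbot : D.InBottomRows p.route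
  · exact Or.inl ⟨hbot, hn⟩
  · refine Or.inr ⟨by tauto, ?_⟩
    rw [colIndex_route, colIndex_route, hb, hq, if_neg (by simp), if_pos rfl]
    apply lowRank_lt_highRank h
    rcases h.1 with h1 | ⟨h1, h2, h3⟩
    · exact h1
    · refine absurd ((inBottomRows_iff p).2 ⟨h1, ?_⟩) hbot
      have := h.2.1
      simp only [hi]; omega

theorem not_isRightOf_of_NX {p q : Span D} (h : p.NX q) (hb : p.b = false) :
    ¬ D.IsRightOf p.route q.route := by
  have h1 := isRightOf_of_NX h hb
  have hq : q.b = true := by rw [h.b_ne, hb]; rfl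
  have hn := not_bottom_of_b hq
  unfold IsRightOf at *
  rcases h1 with h1 | h1
  · tauto
  · have := h1.2
    rintro (h2 | h2)
    · exact hn h2.1
    · have := h2.2; omega

theorem mem_east_iff (p q : Span D) : q.route ∈ D.east p.route ↔
    (p.b = true ∧ p.HU q) ∨ (p.b = false ∧ (p.LU q ∨ p.NX q)) := by
  simp only [east, Set.mem_ofPred_eq, first_eq_iff]
  constructor
  · rintro ⟨⟨h1, h2⟩ | ⟨h1, h2⟩ | ⟨h1, h2⟩, h3⟩
    · have h1' : p.SameLeg q := ⟨h1.1.symm, h1.2.symm⟩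
      have hb := h1.b_eq
      rcases h2 with ⟨h2, h4⟩ | ⟨h2, h4⟩
      · have hp := hb.symm.trans h2
        have n1 := not_bottom_of_b hp
        have n2 := not_bottom_of_b h2
        simp only [IsRightOf, n1, n2, false_and, false_or, true_and, not_false_eq_true,
          colIndex_route, hp, h2, if_true, highRank_lt_iff h1'] at h3
        exact Or.inl ⟨hp, h1', h4.symm, h3⟩
      · have hp := hb.symm.trans h2
        have n := inBottomRows_congr h1 h4
        simp only [IsRightOf, n, and_not_self, false_or, true_and,
          colIndex_route, hp, h2, Bool.false_eq_true, if_false, lowRank_lt_iff h1'] at h3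
        exact Or.inr ⟨hp, Or.inl ⟨h1', h4.symm, h3⟩⟩
    · have hb : p.b = false := by
        have := h2.b_ne; rw [h1] at this; revert this; cases p.b <;> simp
      exact Or.inr ⟨hb, Or.inr h2⟩
    · exact absurd h3 (not_isRightOf_of_NX h2 h1)
  · rintro (⟨h1, h2, h3, h4⟩ | ⟨h1, ⟨h2, h3, h4⟩ | h2⟩)
    · have hb := h2.b_eq
      rw [h1] at hb
      refine ⟨Or.inl ⟨⟨h2.1.symm, h2.2.symm⟩, Or.inl ⟨hb.symm, h3.symm⟩⟩, Or.inr ⟨?_, ?_⟩⟩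
      · have n1 := not_bottom_of_b h1
        have n2 := not_bottom_of_b hb.symm
        tauto
      · rw [colIndex_route, colIndex_route, h1, ← hb, if_pos rfl, if_pos rfl, highRank_lt_iff h2]
        exact h4
    · have hb := h2.b_eq
      rw [h1] at hb
      refine ⟨Or.inl ⟨⟨h2.1.symm, h2.2.symm⟩, Or.inr ⟨hb.symm, h3.symm⟩⟩,
        Or.inr ⟨inBottomRows_congr h2 h3, ?_⟩⟩
      rw [colIndex_route, colIndex_route, h1, ← hb, if_neg (by simp), if_neg (by simp),
        lowRank_lt_iff h2]
      exact h4
    · have hb := h2.b_ne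
      rw [h1] at hb
      exact ⟨Or.inr (Or.inl ⟨hb, h2⟩), isRightOf_of_NX h2 h1⟩

theorem mem_west_iff (p q : Span D) : q.route ∈ D.west p.route ↔
    (p.b = true ∧ (q.HU p ∨ q.NX p)) ∨ (p.b = false ∧ q.LU p) := by
  have h : q.route ∈ D.west p.route ↔ p.route ∈ D.east q.route := by
    simp only [west, east, Set.mem_ofPred_eq]
    exact and_congr_left fun _ => eq_comm
  rw [h, mem_east_iff]
  have h1 : q.LU p → q.b = p.b := fun h => h.1.b_eq
  have h2 : q.HU p → q.b = p.b := fun h => h.1.b_eq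
  have h3 : q.NX p → p.b = !q.b := fun h => h.b_ne
  cases hp : p.b <;> cases hq : q.b <;> simp [hp, hq] at h1 h2 h3 ⊢ <;> tauto

end Span

end LabShape

/-! ### Conflict as the relation northwest or southeast -/

namespace LabShape

open FramedDag

variable {D : LabShape}

namespace Span

variable (D) in
/-- A cycle with exactly two legs. -/
def TwoLegs : Prop := D.cyclic = true ∧ D.k.length = 2

/-- Both ends of the interval are ends of the leg. -/
def Extreme (p : Span D) : Prop := p.u ≤ p.s + 1 ∧ p.e + 1 ≤ p.w

/-- The corners of the rectangle subtended by conflicting routes. -/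
def Corner (p q t t' : Span D) : Prop :=
  (p.SameLeg q ∧ p.SameLeg t ∧ p.SameLeg t' ∧ p.u < q.u ∧ p.w < q.w ∧
      t.u = q.u ∧ t.w = p.w ∧ t'.u = p.u ∧ t'.w = q.w) ∨
    (D.Next p.e q.s ∧ p.w = p.e + 1 ∧ q.u = q.s + 1 ∧ p.SameLeg t ∧ t.u = p.u ∧ t.w = p.e + 2 ∧
      q.SameLeg t' ∧ t'.u = q.s ∧ t'.w = q.w)

/-- The corners of the rectangle subtended by nested routes. -/
def NestCorner (p q t t' : Span D) : Prop :=
  (p.SameLeg q ∧ p.SameLeg t ∧ p.SameLeg t' ∧ q.u < p.u ∧ p.w < q.w ∧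
      t.u = p.u ∧ t.w = q.w ∧ t'.u = q.u ∧ t'.w = p.w) ∨
    (D.Next p.e q.s ∧ p.w = p.e + 2 ∧ q.u = q.s ∧ p.SameLeg t ∧ t.u = p.u ∧ t.w = p.e + 1 ∧
      q.SameLeg t' ∧ t'.u = q.s + 1 ∧ t'.w = q.w)

theorem twoLegs_of_next {p q : Span D} (h : D.Next p.e q.s) (h' : D.Next q.e p.s) : TwoLegs D :=
  p.leg.length_eq_two q.leg h h'

theorem SameLeg.symm {p q : Span D} (h : p.SameLeg q) : q.SameLeg p := ⟨h.1.symm, h.2.symm⟩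

theorem SameLeg.trans {p q r : Span D} (h : p.SameLeg q) (h' : q.SameLeg r) : p.SameLeg r :=
  ⟨h.1.trans h'.1, h.2.trans h'.2⟩

theorem Corner.clash {p q t t' : Span D} (h : Corner p q t t') : Clash p q := by
  rcases h with ⟨h1, h2, h3, h4, h5, h6, h7, -⟩ | ⟨h1, h2, h3, -⟩
  · have := t.le
    exact Or.inl ⟨h1.1, h1.2, h4, by omega, h5⟩
  · exact Or.inr ⟨h1, h2, h3⟩

theorem not_next_same {p q : Span D} (h : p.SameLeg q) (h' : D.Next p.e q.s) : False := by
  have := b_ne_of_next h'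
  rw [h.b_eq] at this; simp at this

/-- Following a row and then a column exchanges one endpoint. If `p` and `q` are on the same leg, a
corner may also lie on a leg that both follows and precedes this one; then there are two legs, and
sharing end edges at both junctions makes all endpoints extreme. -/
theorem corner_of_isArray {p q t₁ t₂ : Span D}
    (h : D.IsArray p.route q.route t₁.route t₂.route) :
    Corner p q t₁ t₂ ∨ Corner p q t₂ t₁ ∨
      (TwoLegs D ∧ Extreme p ∧ Extreme q ∧ Clash p q) := by
  simp only [IsArray, Set.mem_inter_iff, mem_west_iff, mem_south_iff, mem_north_iff,
    mem_east_iff] at h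
  obtain ⟨⟨h1, h2⟩, h3, h4⟩ := h
  cases hp : p.b <;> cases hq : q.b <;> simp [hp, hq] at h1 h2 h3 h4
  · have hs : p.SameLeg q := h2.1.trans h1.1
    rcases h3 with h3 | h3 <;> rcases h4 with h4 | h4
    · right; left; left
      exact ⟨hs, h4.1, h2.1, by have := h4.2.2; have := h3.2.1; omega,
        by have := h2.2.2; have := h1.2.1; omega, h3.2.1, h4.2.1.symm, h2.2.1.symm, h1.2.1⟩
    · exact (not_next_same (hs.trans h3.1.symm) h4.1).elim
    · exact (not_next_same (h4.1.symm.trans hs) h3.1).elim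
    · right; right
      obtain ⟨e1, e2, e3⟩ := h1
      obtain ⟨f1, f2, f3⟩ := h2
      obtain ⟨a1, a2, a3⟩ := h3
      obtain ⟨b1, b2, b3⟩ := h4
      obtain ⟨c1, c2⟩ := hs
      have := p.le_e; have := q.s_le; have := q.le_e; have := p.s_le; have := t₂.le_e
      have := t₂.s_le; have := p.leg.lt
      have hn : D.Next t₂.e p.s := by rw [c1]; exact a1
      refine ⟨twoLegs_of_next b1 hn, ?_, ?_, ?_⟩
      · constructor <;> omega
      · constructor <;> omega
      · left; refine ⟨c1, c2, ?_, ?_, ?_⟩ <;> omega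
  · have n1 : D.Next t₁.e q.s := by
      rcases h1 with h1 | h1
      · have a := h1.1.b_eq
        rw [← h2.1.b_eq, hp, hq] at a; simp at a
      · exact h1.1
    have n2 : D.Next p.e t₂.s := by
      rcases h4 with h4 | h4
      · have := h3.1.b_eq
        rw [hq, ← h4.1.b_eq, hp] at this; simp at this
      · exact h4.1
    have k1 : t₁.NX q := by
      rcases h1 with h1 | h1
      · exact (not_next_same h1.1 n1).elim
      · exact h1
    have k2 : p.NX t₂ := by
      rcases h4 with h4 | h4
      · exact (not_next_same h4.1 n2).elim
      · exact h4
    obtain ⟨e1, e2, e3⟩ := h2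
    obtain ⟨f1, f2, f3⟩ := h3
    obtain ⟨a1, a2, a3⟩ := k1
    obtain ⟨b1, b2, b3⟩ := k2
    have g1 := e1.1; have g2 := e1.2; have g3 := f1.1; have g4 := f1.2
    have := t₁.le_e; have := q.s_le; have := t₂.s_le; have := p.le_e
    left; right
    refine ⟨by rw [g2]; exact a1, by omega, by omega, e1, by omega, by omega, f1.symm, by omega,
      by omega⟩
  · obtain ⟨e1, e2, e3⟩ := h4
    obtain ⟨f1, f2, f3⟩ := h1
    have n2 : p.NX t₁ := by
      rcases h2 with h2 | h2
      · have := h2.1.b_eq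
        rw [f1.b_eq, hp, hq] at this; simp at this
      · exact h2
    have n1 : t₂.NX q := by
      rcases h3 with h3 | h3
      · have := h3.1.b_eq
        rw [← e1.b_eq, hp, hq] at this; simp at this
      · exact h3
    obtain ⟨a1, a2, a3⟩ := n1
    obtain ⟨b1, b2, b3⟩ := n2
    have g1 := e1.1; have g2 := e1.2; have g3 := f1.1; have g4 := f1.2
    have := t₂.le_e; have := q.s_le; have := t₁.s_le; have := p.le_e
    right; left; right
    refine ⟨by rw [g2]; exact a1, by omega, by omega, e1, by omega, by omega, f1.symm, by omega,
      by omega⟩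
  · have hs : p.SameLeg q := h4.1.trans h3.1
    rcases h1 with h1 | h1 <;> rcases h2 with h2 | h2
    · left; left
      exact ⟨hs, h2.1, h4.1, by have := h1.2.1; have := h2.2.2; omega,
        by have := h4.2.2; have := h3.2.1; omega, h1.2.1, h2.2.1.symm, h4.2.1.symm, h3.2.1⟩
    · exact (not_next_same (hs.trans h1.1.symm) h2.1).elim
    · exact (not_next_same (h2.1.symm.trans hs) h1.1).elim
    · right; right
      obtain ⟨e1, e2, e3⟩ := h3
      obtain ⟨f1, f2, f3⟩ := h4
      obtain ⟨a1, a2, a3⟩ := h1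
      obtain ⟨b1, b2, b3⟩ := h2
      obtain ⟨c1, c2⟩ := hs
      have := p.le_e; have := q.s_le; have := q.le_e; have := p.s_le; have := t₁.le_e
      have := t₁.s_le; have := p.leg.lt
      have hn : D.Next t₁.e p.s := by rw [c1]; exact a1
      refine ⟨twoLegs_of_next b1 hn, ?_, ?_, ?_⟩
      · constructor <;> omega
      · constructor <;> omega
      · left; refine ⟨c1, c2, ?_, ?_, ?_⟩ <;> omega

theorem exists_corner {p q : Span D} (h : Clash p q) : ∃ t t', Corner p q t t' := by
  have k1 := p.ok; have k2 := q.ok; have := p.s_le; have := q.s_le; have := p.le_e; have := q.le_e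
  have := p.le; have := q.le; have := p.leg.lt; have := q.leg.lt
  rcases h with ⟨h1, h2, h3, h4, h5⟩ | ⟨h1, h2, h3⟩
  · refine ⟨⟨p.s, p.e, q.u, p.w, p.leg, by omega, by omega, by omega, ?_⟩,
      ⟨p.s, p.e, p.u, q.w, p.leg, by omega, by omega, by omega, Or.inl (by omega)⟩,
      Or.inl ⟨⟨h1, h2⟩, ⟨rfl, rfl⟩, ⟨rfl, rfl⟩, h3, h5, rfl, rfl, rfl, rfl⟩⟩
    rcases k1 with k1 | ⟨k0, k1⟩ <;> rcases k2 with k2 | ⟨k0', k2⟩ <;>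
      first
      | exact Or.inl (by omega)
      | exact Or.inr ⟨by assumption, by omega⟩
  · have a1 := u_le_e_of_next h1
    have a2 := le_w_of_next h1
    exact ⟨⟨p.s, p.e, p.u, p.e + 2, p.leg, by omega, by omega, by omega, Or.inl (by omega)⟩,
      ⟨q.s, q.e, q.s, q.w, q.leg, by omega, by omega, by omega, Or.inl (by omega)⟩,
      Or.inr ⟨h1, h2, h3, ⟨rfl, rfl⟩, rfl, rfl, ⟨rfl, rfl⟩, rfl, rfl⟩⟩

/-- Which corner is in the row of `q` depends on the direction of the leg, hence the two orders. -/
theorem isArray_of_corner {p q t t' : Span D} (h : Corner p q t t') :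
    D.IsArray p.route q.route t.route t'.route ∨ D.IsArray p.route q.route t'.route t.route := by
  simp only [IsArray, Set.mem_inter_iff, mem_west_iff, mem_south_iff, mem_north_iff,
    mem_east_iff]
  rcases h with ⟨h1, h2, h3, h4, h5, h6, h7, h8, h9⟩ | ⟨h1, h2, h3, h4, h5, h6, h7, h8, h9⟩
  · have hq := h1.b_eq
    have tq : t.HU q := ⟨h2.symm.trans h1, h6, by omega⟩
    have pt : p.LU t := ⟨h2, h7.symm, by omega⟩
    have tq' : t'.LU q := ⟨h3.symm.trans h1, h9, by omega⟩
    have pt' : p.HU t' := ⟨h3, h8.symm, by omega⟩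
    cases hp : p.b <;> simp [hp] at hq
    · right; simp [*]
    · left; simp [*]
  · have hq := b_ne_of_next h1
    have pt : p.HU t := ⟨h4, h5.symm, by omega⟩
    have tq' : t'.LU q := ⟨h7.symm, h9, by omega⟩
    have n1 : t.NX q := ⟨by rw [← h4.2]; exact h1, by have := h4.2; omega, by have := h4.2; omega⟩
    have n2 : p.NX t' := ⟨by rw [← h7.1]; exact h1, by omega, by have := h7.1; omega⟩
    cases hp : p.b <;> simp [hp] at hq
    · left; simp [*]
    · right; simp [*]

theorem mem_NW_union_SE_iff (p q : Span D) :
    q.route ∈ D.NW p.route ∪ D.SE p.route ↔ Clash p q ∨ Clash q p := by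
  have hNW : ∀ p q : Span D, q.route ∈ D.NW p.route ↔ Clash q p := by
    intro p q
    constructor
    · rintro ⟨T₁, T₂, h⟩
      obtain ⟨t₁, rfl⟩ := exists_span T₁
      obtain ⟨t₂, rfl⟩ := exists_span T₂
      rcases corner_of_isArray (p := q) (q := p) h with h | h | h
      · exact h.clash
      · exact h.clash
      · exact h.2.2.2
    · intro h
      obtain ⟨t, t', h⟩ := exists_corner h
      rcases isArray_of_corner h with h | h
      · exact ⟨_, _, h⟩
      · exact ⟨_, _, h⟩
  have hSE : q.route ∈ D.SE p.route ↔ p.route ∈ D.NW q.route := by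
    constructor
    · rintro ⟨T₁, T₂, h1, h2⟩
      exact ⟨T₂, T₁, ⟨h2.2, h2.1⟩, h1.2, h1.1⟩
    · rintro ⟨T₁, T₂, h1, h2⟩
      exact ⟨T₂, T₁, ⟨h2.2, h2.1⟩, h1.2, h1.1⟩
  rw [Set.mem_union, hSE, hNW, hNW, or_comm]

/-! ### Nested routes -/

/-- On legs of opposite direction each corner lies on one of the two legs and is reached through one
of their junctions. If both corners use the same junction, this is nesting there; if they use
different ones, each leg follows the other. -/
theorem nestCorner_of_NE {p q t₁ t₂ : Span D}
    (h1 : t₁.route ∈ D.east p.route ∩ D.south q.route)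
    (h2 : t₂.route ∈ D.north p.route ∩ D.west q.route) :
    NestCorner p q t₁ t₂ ∨ NestCorner p q t₂ t₁ ∨ NestCorner q p t₁ t₂ ∨ NestCorner q p t₂ t₁ ∨
      (TwoLegs D ∧ Extreme p ∧ Extreme q) := by
  simp only [Set.mem_inter_iff, mem_west_iff, mem_south_iff, mem_north_iff,
    mem_east_iff] at h1 h2
  obtain ⟨h1, h2⟩ := h1
  obtain ⟨h3, h4⟩ := ‹_ ∧ _›
  cases hp : p.b <;> cases hq : q.b <;> simp [hp, hq] at h1 h2 h3 h4
  · have k1 : p.LU t₁ := by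
      rcases h1 with h1 | h1
      · exact h1
      · have := h1.b_ne; rw [← h2.1.b_eq, hp, hq] at this; simp at this
    have k3 : t₂.HU p := by
      rcases h3 with h3 | h3
      · exact h3
      · have := h3.b_ne; rw [h4.1.b_eq, hp, hq] at this; simp at this
    obtain ⟨a1, a2, a3⟩ := k1
    obtain ⟨b1, b2, b3⟩ := k3
    obtain ⟨c1, c2, c3⟩ := h2
    obtain ⟨d1, d2, d3⟩ := h4
    right; right; left; left
    exact ⟨d1.symm.trans b1, c1, d1.symm, by omega, by omega, by omega, by omega, by omega,
      by omega⟩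
  · have e1 : t₁.b = true ∧ p.NX t₁ ∧ q.LU t₁ ∨ t₁.b = false ∧ p.LU t₁ ∧ q.NX t₁ := by
      have x1 := fun h : p.LU t₁ => h.1.b_eq
      have x2 := fun h : q.LU t₁ => h.1.b_eq
      have x3 := fun h : p.NX t₁ => h.b_ne
      have x4 := fun h : q.NX t₁ => h.b_ne
      rw [hp] at x1 x3; rw [hq] at x2 x4
      cases ht : t₁.b <;> rw [ht] at x1 x2 x3 x4 <;> simp at x1 x2 x3 x4 <;> simp <;> tauto
    have e2 : t₂.b = true ∧ t₂.NX p ∧ t₂.HU q ∨ t₂.b = false ∧ t₂.HU p ∧ t₂.NX q := by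
      have x1 := fun h : t₂.HU p => h.1.b_eq
      have x2 := fun h : t₂.HU q => h.1.b_eq
      have x3 := fun h : t₂.NX p => h.b_ne
      have x4 := fun h : t₂.NX q => h.b_ne
      rw [hp] at x1 x3; rw [hq] at x2 x4
      cases ht : t₂.b <;> rw [ht] at x1 x2 x3 x4 <;> simp at x1 x2 x3 x4 <;> simp <;> tauto
    have f1 := p.s_le; have f2 := q.s_le; have f3 := p.le_e; have f4 := q.le_e
    have f5 := t₁.s_le; have f6 := t₁.le_e; have f7 := t₂.s_le; have f8 := t₂.le_e
    rcases e1 with ⟨-, ⟨a1, a2, a3⟩, b1, b2, b3⟩ | ⟨-, ⟨b1, b2, b3⟩, a1, a2, a3⟩ <;>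
    rcases e2 with ⟨-, ⟨c1, c2, c3⟩, d1, d2, d3⟩ | ⟨-, ⟨d1, d2, d3⟩, c1, c2, c3⟩
    · have n1 : D.Next p.e q.s := by rw [b1.1]; exact a1
      have n2 : D.Next q.e p.s := by rw [← d1.2]; exact c1
      have := b1.1; have := b1.2; have := d1.1; have := d1.2
      right; right; right; right
      exact ⟨twoLegs_of_next n1 n2, ⟨by omega, by omega⟩, ⟨by omega, by omega⟩⟩
    · have n1 : D.Next p.e q.s := by rw [b1.1]; exact a1
      have := b1.1; have := b1.2; have := d1.1; have := d1.2
      right; left; right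
      exact ⟨n1, by omega, by omega, d1.symm, by omega, by omega, b1, by omega, by omega⟩
    · have n2 : D.Next q.e p.s := by rw [← d1.2]; exact c1
      have := b1.1; have := b1.2; have := d1.1; have := d1.2
      right; right; right; left; right
      exact ⟨n2, by omega, by omega, d1.symm, by omega, by omega, b1, by omega, by omega⟩
    · have n1 : D.Next p.e q.s := by rw [← d1.2]; exact c1
      have n2 : D.Next q.e p.s := by rw [b1.1]; exact a1
      have := b1.1; have := b1.2; have := d1.1; have := d1.2
      right; right; right; right
      exact ⟨twoLegs_of_next n1 n2, ⟨by omega, by omega⟩, ⟨by omega, by omega⟩⟩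
  · have := h2.1.b_eq
    rw [← h1.1.b_eq, hp, hq] at this; simp at this
  · have k2 : q.LU t₁ := by
      rcases h2 with h2 | h2
      · exact h2
      · have := h2.b_ne; rw [← h1.1.b_eq, hp, hq] at this; simp at this
    have k4 : t₂.HU q := by
      rcases h4 with h4 | h4
      · exact h4
      · have := h4.b_ne; rw [h3.1.b_eq, hp, hq] at this; simp at this
    obtain ⟨a1, a2, a3⟩ := k2
    obtain ⟨b1, b2, b3⟩ := k4
    obtain ⟨c1, c2, c3⟩ := h1
    obtain ⟨d1, d2, d3⟩ := h3
    left; left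
    exact ⟨d1.symm.trans b1, c1, d1.symm, by omega, by omega, by omega, by omega, by omega,
      by omega⟩

theorem mem_SW_iff_NE (R S : D.LabRoute) : S ∈ D.SW R ↔ R ∈ D.NE S := by
  constructor
  · rintro ⟨T₁, T₂, h1, h2⟩
    exact ⟨T₂, T₁, ⟨h2.2, h2.1⟩, h1.2, h1.1⟩
  · rintro ⟨T₁, T₂, h1, h2⟩
    exact ⟨T₂, T₁, ⟨h2.2, h2.1⟩, h1.2, h1.1⟩

theorem nestCorner_of_mem {p q : Span D} (h : q.route ∈ D.NE p.route ∪ D.SW p.route)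
    (ha : ¬ (TwoLegs D ∧ Extreme p ∧ Extreme q)) :
    ∃ t t', (NestCorner p q t t' ∨ NestCorner q p t t') ∧
      (t.route ≠ p.route ∧ t.route ≠ q.route) := by
  have key : ∀ p q : Span D, q.route ∈ D.NE p.route → ¬ (TwoLegs D ∧ Extreme p ∧ Extreme q) →
      ∃ t t', (NestCorner p q t t' ∨ NestCorner q p t t') ∧
        (t.route ≠ p.route ∧ t.route ≠ q.route) := by
    rintro p q ⟨T₁, T₂, h1, h2⟩ ha
    obtain ⟨t₁, rfl⟩ := exists_span T₁
    obtain ⟨t₂, rfl⟩ := exists_span T₂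
    have ne1 : t₁.route ≠ p.route := by
      intro he
      have := h1.1; rw [he, mem_east_iff] at this
      simp only [HU, LU, lt_irrefl, and_false, false_or] at this
      exact not_sameLeg_of_NX this.2 ⟨rfl, rfl⟩
    have ne2 : t₁.route ≠ q.route := by
      intro he
      have := h1.2.2; rw [he] at this; exact lt_irrefl _ this
    have ne3 : t₂.route ≠ p.route := by
      intro he
      have := h2.1.2; rw [he] at this; exact lt_irrefl _ this
    have ne4 : t₂.route ≠ q.route := by
      intro he
      have := h2.2; rw [he, mem_west_iff] at this
      simp only [HU, LU, lt_irrefl, and_false, false_or, or_false] at this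
      exact not_sameLeg_of_NX this.2 ⟨rfl, rfl⟩
    rcases nestCorner_of_NE h1 h2 with h | h | h | h | h
    · exact ⟨t₁, t₂, Or.inl h, ne1, ne2⟩
    · exact ⟨t₂, t₁, Or.inl h, ne3, ne4⟩
    · exact ⟨t₁, t₂, Or.inr h, ne1, ne2⟩
    · exact ⟨t₂, t₁, Or.inr h, ne3, ne4⟩
    · exact absurd h ha
  rcases h with h | h
  · exact key p q h ha
  · rw [mem_SW_iff_NE] at h
    obtain ⟨t, t', h1, h2, h3⟩ := key q p h (by tauto)
    exact ⟨t, t', h1.symm, h3, h2⟩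

/-- The arithmetic form of being nested. -/
def Nested (p q : Span D) : Prop :=
  (p.SameLeg q ∧ q.u < p.u ∧ p.w < q.w) ∨ (D.Next p.e q.s ∧ p.w = p.e + 2 ∧ q.u = q.s)

theorem NestCorner.nested {p q t t' : Span D} (h : NestCorner p q t t') : Nested p q := by
  rcases h with h | h
  · exact Or.inl ⟨h.1, h.2.2.2.1, h.2.2.2.2.1⟩
  · exact Or.inr ⟨h.1, h.2.1, h.2.2.1⟩

theorem mem_of_nested {p q : Span D} (h : Nested p q) :
    q.route ∈ D.NE p.route ∪ D.SW p.route := by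
  have o1 := p.ok
  have o2 := q.ok
  have := p.s_le; have := q.s_le; have := p.le_e; have := q.le_e
  have := p.le; have := q.le; have := p.leg.lt; have := q.leg.lt
  rcases h with ⟨h1, h2, h3⟩ | ⟨h1, h2, h3⟩
  · have hb := h1.b_eq
    obtain ⟨e1, e2⟩ := h1
    let t : Span D := ⟨p.s, p.e, p.u, q.w, p.leg, by omega, by omega, by omega, by
      rcases o1 with c1 | ⟨c0, c1 | c1⟩ <;> rcases o2 with c2 | ⟨c0', c2 | c2⟩ <;>
        first | exact Or.inl (by omega) | exact Or.inr ⟨by assumption, by omega⟩⟩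
    let t' : Span D := ⟨p.s, p.e, q.u, p.w, p.leg, by omega, by omega, by omega, by
      rcases o1 with c1 | ⟨c0, c1 | c1⟩ <;> rcases o2 with c2 | ⟨c0', c2 | c2⟩ <;>
        first | exact Or.inl (by omega) | exact Or.inr ⟨by assumption, by omega⟩⟩
    have k1 : p.HU t := ⟨⟨rfl, rfl⟩, rfl, h3⟩
    have k2 : q.LU t := ⟨⟨e1.symm, e2.symm⟩, rfl, h2⟩
    have k3 : t'.LU p := ⟨⟨rfl, rfl⟩, rfl, h2⟩
    have k4 : t'.HU q := ⟨⟨e1, e2⟩, rfl, h3⟩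
    cases hp : p.b
    · have hq := hb.symm.trans hp
      exact Or.inr ⟨t'.route, t.route,
        ⟨(mem_west_iff _ _).2 (Or.inr ⟨hp, k3⟩), (mem_north_iff _ _).2 (Or.inr ⟨hq, Or.inl k4⟩)⟩,
        ⟨(mem_south_iff _ _).2 (Or.inr ⟨hp, k1⟩), (mem_east_iff _ _).2 (Or.inr ⟨hq, Or.inl k2⟩)⟩⟩
    · have hq := hb.symm.trans hp
      exact Or.inl ⟨t.route, t'.route,
        ⟨(mem_east_iff _ _).2 (Or.inl ⟨hp, k1⟩), (mem_south_iff _ _).2 (Or.inl ⟨hq, Or.inl k2⟩)⟩,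
        ⟨(mem_north_iff _ _).2 (Or.inl ⟨hp, k3⟩), (mem_west_iff _ _).2 (Or.inl ⟨hq, Or.inl k4⟩)⟩⟩
  · have hb := b_ne_of_next h1
    have a1 := u_le_e_of_next h1
    have a2 := le_w_of_next h1
    let t : Span D := ⟨p.s, p.e, p.u, p.e + 1, p.leg, by omega, by omega, by omega,
      Or.inl (by omega)⟩
    let t' : Span D := ⟨q.s, q.e, q.s + 1, q.w, q.leg, by omega, by omega, by omega,
      Or.inl (by omega)⟩
    have k1 : t.HU p := ⟨⟨rfl, rfl⟩, rfl, by simp only [t]; omega⟩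
    have k2 : q.LU t' := ⟨⟨rfl, rfl⟩, rfl, by simp only [t']; omega⟩
    have k3 : t.NX q := ⟨h1, le_rfl, by simp only [t]; omega⟩
    have k4 : p.NX t' := ⟨h1, by omega, by simp only [t']; omega⟩
    cases hp : p.b
    · have hq : q.b = true := by rw [hb, hp]; rfl
      exact Or.inl ⟨t'.route, t.route,
        ⟨(mem_east_iff _ _).2 (Or.inr ⟨hp, Or.inr k4⟩), (mem_south_iff _ _).2 (Or.inl ⟨hq, Or.inl k2⟩)⟩,
        ⟨(mem_north_iff _ _).2 (Or.inr ⟨hp, Or.inl k1⟩), (mem_west_iff _ _).2 (Or.inl ⟨hq, Or.inr k3⟩)⟩⟩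
    · have hq : q.b = false := by rw [hb, hp]; rfl
      exact Or.inr ⟨t.route, t'.route,
        ⟨(mem_west_iff _ _).2 (Or.inl ⟨hp, Or.inl k1⟩), (mem_north_iff _ _).2 (Or.inr ⟨hq, Or.inr k3⟩)⟩,
        ⟨(mem_south_iff _ _).2 (Or.inl ⟨hp, Or.inr k4⟩), (mem_east_iff _ _).2 (Or.inr ⟨hq, Or.inl k2⟩)⟩⟩

/-- Nested routes are coherent, unless both are extreme in a cycle with two legs. -/
theorem not_clash_of_nested {p q : Span D} (h : Nested p q)
    (ha : ¬ (TwoLegs D ∧ Extreme p ∧ Extreme q)) : ¬ (Clash p q ∨ Clash q p) := by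
  have := p.s_le; have := q.s_le; have := p.le_e; have := q.le_e
  rintro (h' | h')
  · rcases h with ⟨h1, h2, h3⟩ | ⟨h1, h2, h3⟩ <;> rcases h' with ⟨k1, k2, k3⟩ | ⟨k1, k2, k3⟩
    · omega
    · exact not_next_same h1 k1
    · exact not_next_same ⟨k1, k2⟩ h1
    · omega
  · rcases h with ⟨h1, h2, h3⟩ | ⟨h1, h2, h3⟩ <;> rcases h' with ⟨k1, k2, k3⟩ | ⟨k1, k2, k3⟩
    · omega
    · exact not_next_same h1.symm k1
    · exact not_next_same ⟨k1.symm, k2.symm⟩ h1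
    · exact ha ⟨twoLegs_of_next h1 k1, ⟨by omega, by omega⟩, ⟨by omega, by omega⟩⟩

end Span

end LabShape

namespace LabShape

open FramedDag

variable {D : LabShape}

namespace Span

theorem route_ext {p q : Span D} (h : p.SameLeg q) (hu : p.u = q.u) (hw : p.w = q.w) :
    p.route = q.route := by
  obtain ⟨h1, h2⟩ := h
  cases p; cases q
  simp only at h1 h2 hu hw
  subst h1 h2 hu hw
  rfl

/-! ### Sums of `g`-vectors -/

theorem pt_next {s e s' e' : ℕ} (h : D.IsLeg s e) (h' : D.IsLeg s' e') (hn : D.Next e s') :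
    pt D s e (e + 1) = pt D s' e' (s' + 1) := by
  have := h.lt; have := h'.lt; have := h.le; have := h'.le
  rw [pt, pt, if_pos (by omega), if_pos (by omega), Nat.add_sub_cancel, Nat.add_sub_cancel,
    vtx_eq_of_next (by omega) (by omega) hn]

theorem pt_left (s e : ℕ) : pt D s e s = 0 := if_neg (by omega)

theorem pt_right (s e : ℕ) : pt D s e (e + 2) = 0 := if_neg (by omega)

/-- On one leg the corners have the same lower and upper endpoints as the pair. At a junction the
contributions of `p` and `q` to the common vertex cancel, and the corners contribute nothing there.
-/
theorem Corner.gVec_add {p q t t' : Span D} (h : Corner p q t t') :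
    gVec p.route + gVec q.route = gVec t.route + gVec t'.route := by
  simp only [gVec_route]
  rcases h with ⟨⟨a1, a2⟩, ⟨a3, a4⟩, ⟨a5, a6⟩, h4, h5, h6, h7, h8, h9⟩ |
    ⟨h1, h2, h3, ⟨a1, a2⟩, h5, h6, ⟨a3, a4⟩, h8, h9⟩
  · rw [← a1, ← a2, ← a3, ← a4, ← a5, ← a6, h6, h7, h8, h9]; abel
  · rw [← a1, ← a2, ← a3, ← a4, h5, h6, h8, h9, h2, h3, pt_right, pt_left,
      pt_next p.leg q.leg h1]; abel

theorem NestCorner.gVec_add {p q t t' : Span D} (h : NestCorner p q t t') :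
    gVec p.route + gVec q.route = gVec t.route + gVec t'.route := by
  simp only [gVec_route]
  rcases h with ⟨⟨a1, a2⟩, ⟨a3, a4⟩, ⟨a5, a6⟩, h4, h5, h6, h7, h8, h9⟩ |
    ⟨h1, h2, h3, ⟨a1, a2⟩, h5, h6, ⟨a3, a4⟩, h8, h9⟩
  · rw [← a1, ← a2, ← a3, ← a4, ← a5, ← a6, h6, h7, h8, h9]; abel
  · rw [← a1, ← a2, ← a3, ← a4, h5, h6, h8, h9, h2, h3, pt_right, pt_left,
      pt_next p.leg q.leg h1]; abel

/-! ### Exceptional routes -/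

/-- The interval is a point or the whole leg. -/
def Trivial (p : Span D) : Prop := p.u = p.w ∨ (p.u = p.s ∧ p.w = p.e + 2)

theorem Trivial.not_clash {p : Span D} (h : Trivial p) (q : Span D) :
    ¬ (Clash p q ∨ Clash q p) := by
  have := p.s_le; have := p.le_e; have := q.s_le; have := q.le_e; have := p.leg.lt
  rintro ((h1 | ⟨h1, h2, h3⟩) | (h1 | ⟨h1, h2, h3⟩))
  · rcases h with h | h <;> omega
  · have := u_le_e_of_next h1
    rcases h with h | h <;> omega
  · rcases h with h | h <;> omega
  · have := le_w_of_next h1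
    rcases h with h | h <;> omega

/-- One endpoint is not an added point. A route that begins where `p` ends, or ends where `p`
begins, is in conflict with `p`; it lies on the same leg, or on the neighbouring leg if the endpoint
is at a junction. -/
theorem exists_clash {p : Span D} (h : ¬ Trivial p) : ∃ q, Clash p q ∨ Clash q p := by
  have h1 := p.s_le; have h2 := p.le_e; have h3 := p.leg.lt; have h4 := p.le
  have ok := p.ok
  rw [Trivial, not_or] at h
  rcases h1.eq_or_lt with h1 | h1
  · have hw : p.w < p.e + 2 := by omega
    by_cases hq : p.w ≤ p.e
    · exact ⟨⟨p.s, p.e, p.w, p.e + 2, p.leg, by omega, by omega, by omega, Or.inl (by omega)⟩,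
        Or.inl (Or.inl ⟨rfl, rfl, by simp only; omega, le_rfl, hw⟩)⟩
    · by_cases he : D.cyclic = false ∧ p.e = D.numSteps
      · exact ⟨⟨p.s, p.e, p.w, p.e + 2, p.leg, by omega, by omega, by omega,
          Or.inr ⟨he.1, Or.inr ⟨he.2, by omega⟩⟩⟩,
          Or.inl (Or.inl ⟨rfl, rfl, by simp only; omega, le_rfl, hw⟩)⟩
      · obtain ⟨s', e', h', hn⟩ := p.leg.exists_after he
        have := h'.lt
        exact ⟨⟨s', e', s' + 1, e' + 2, h', by omega, by omega, by omega, Or.inl (by omega)⟩,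
          Or.inl (Or.inr ⟨hn, by omega, rfl⟩)⟩
  · by_cases hq : p.s + 2 ≤ p.u
    · exact ⟨⟨p.s, p.e, p.s, p.u, p.leg, by omega, by omega, by omega, Or.inl (by omega)⟩,
        Or.inr (Or.inl ⟨rfl, rfl, h1, le_rfl, by simp only; omega⟩)⟩
    · by_cases he : D.cyclic = false ∧ p.s = 0
      · exact ⟨⟨p.s, p.e, p.s, p.u, p.leg, by omega, by omega, by omega,
          Or.inr ⟨he.1, Or.inl ⟨he.2, by omega⟩⟩⟩,
          Or.inr (Or.inl ⟨rfl, rfl, h1, le_rfl, by simp only; omega⟩)⟩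
      · obtain ⟨s', e', h', hn⟩ := p.leg.exists_before he
        have := h'.lt
        exact ⟨⟨s', e', s', e' + 1, h', by omega, by omega, by omega, Or.inl (by omega)⟩,
          Or.inr (Or.inr ⟨hn, by rfl, by omega⟩)⟩

theorem isExceptional_iff (p : Span D) : IsExceptional p.route ↔ Trivial p := by
  constructor
  · intro h
    by_contra h'
    obtain ⟨q, hq⟩ := exists_clash h'
    exact h q.route ((conflict_iff p q).2 hq)
  · intro h R
    obtain ⟨q, rfl⟩ := exists_span R
    rw [Coherent, conflict_iff]
    exact h.not_clash q

theorem Trivial.gVec_eq_zero {p : Span D} (h : Trivial p) : gVec p.route = 0 := by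
  rw [gVec_route]
  rcases h with h | ⟨h, h'⟩
  · rw [h, sub_self]
  · rw [h, h', pt_left, pt_right, sub_self]

/-! ### Anomalous routes -/

theorem mem_route (p : Span D) (e : D.dag.Edge) : e ∈ p.route.edges ↔
    e = p.low ∨ e = p.high ∨ ∃ t, p.lo ≤ t ∧ t < p.hi ∧ e = D.stepEdge t := by
  have hlh := p.lo_le_hi
  have : e ∈ p.route.edges ↔ e ∈ p.edgesUp := by
    rw [p.route_edges]; split_ifs <;> simp
  rw [this, edgesUp, List.mem_map]
  simp only [List.mem_range'_1]
  constructor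
  · rintro ⟨x, hx, rfl⟩
    rcases hx.1.eq_or_lt with h | h
    · left; rw [← h, edgeAt_lo]
    · by_cases h' : x ≤ p.hi
      · exact Or.inr (Or.inr ⟨x - 1, by omega, by omega, p.edgeAt_mid h h'⟩)
      · obtain rfl : x = p.hi + 1 := by omega
        exact Or.inr (Or.inl p.edgeAt_hi)
  · rintro (rfl | rfl | ⟨t, h1, h2, rfl⟩)
    · exact ⟨p.lo, by omega, p.edgeAt_lo⟩
    · exact ⟨p.hi + 1, by omega, p.edgeAt_hi⟩
    · exact ⟨t + 1, by omega, p.edgeAt_mid (by omega) (by omega)⟩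

theorem isLongExceptional_iff (hc : D.cyclic = true) (p : Span D) :
    IsLongExceptional p.route ↔ p.u = p.s ∧ p.w = p.e + 2 := by
  have h1 := p.s_le; have h2 := p.le_e; have h3 := p.leg.lt; have h4 := p.le; have h5 := p.lo_le_hi
  have ok := p.ok
  rw [hc] at ok
  replace ok : p.s + 2 ≤ p.w ∧ p.u ≤ p.e := by simpa using ok
  have hl : p.route.edges.length = p.hi - p.lo + 2 := by
    rw [p.route_edges]; split_ifs <;> simp [edgesUp]
  rw [IsLongExceptional, isExceptional_iff, hl, Trivial]
  simp only [lo, hi]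
  omega

theorem low_ne_step (p : Span D) {t : ℕ} : p.low ≠ D.stepEdge t := by
  rw [low, lowEnd]
  split_ifs <;> intro h <;> cases h

theorem high_ne_step (p : Span D) {t : ℕ} : p.high ≠ D.stepEdge t := by
  rw [high, highEnd]
  split_ifs <;> intro h <;> cases h

theorem b_eq_of_low_eq {p q : Span D} (h : p.low = q.low) : p.b = q.b := by
  rw [low, lowEnd, low, lowEnd] at h
  split_ifs at h with h1 h2 h2
  · rw [h1, h2]
  · cases h
  · cases h
  · simp at h1 h2; rw [h1, h2]

theorem b_eq_of_high_eq {p q : Span D} (h : p.high = q.high) : p.b = q.b := by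
  rw [high, highEnd, high, highEnd] at h
  split_ifs at h with h1 h2 h2
  · rw [h1, h2]
  · cases h
  · cases h
  · simp at h1 h2; rw [h1, h2]

theorem b_eq_of_high_eq_low {p q : Span D} (h : p.high = q.low) : q.b = !p.b := by
  rw [high, highEnd, low, lowEnd] at h
  split_ifs at h with h1 h2 h2
  · cases h
  · simp at h1 h2; rw [h1, h2]; rfl
  · simp at h1 h2; rw [h1, h2]; rfl
  · cases h

/-- With `u = s` the lower end edge lies on the long exceptional route of the leg itself, and with
`u = s + 1` on that of the leg before; other lower end edges lie on none. The upper end is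
analogous. -/
theorem isAnomalous_iff (p : Span D) : D.IsAnomalous p.route ↔ TwoLegs D ∧ Extreme p := by
  have h1 := p.s_le; have h2 := p.le_e; have h3 := p.leg.lt
  constructor
  · rintro ⟨hc, hk, h⟩
    refine ⟨⟨hc, hk⟩, ?_, ?_⟩
    · obtain ⟨L, hL, hm⟩ := h p.low ((p.mem_route _).2 (Or.inl rfl))
      obtain ⟨l, rfl⟩ := exists_span L
      rw [isLongExceptional_iff hc] at hL
      rcases (l.mem_route _).1 hm with h | h | ⟨t, -, -, h⟩
      · have := (low_inj (b_eq_of_low_eq h)).1 h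
        have := this.1.1
        omega
      · have := (high_eq_low (b_eq_of_high_eq_low h.symm)).1 h.symm
        have := this.2
        omega
      · exact (p.low_ne_step h).elim
    · obtain ⟨L, hL, hm⟩ := h p.high ((p.mem_route _).2 (Or.inr (Or.inl rfl)))
      obtain ⟨l, rfl⟩ := exists_span L
      rw [isLongExceptional_iff hc] at hL
      rcases (l.mem_route _).1 hm with h | h | ⟨t, -, -, h⟩
      · have := (high_eq_low (b_eq_of_high_eq_low h)).1 h
        have := this.2
        omega
      · have := (high_inj (b_eq_of_high_eq h)).1 h
        have := this.1.2
        omega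
      · exact (p.high_ne_step h).elim
  · rintro ⟨⟨hc, hk⟩, hl, hh⟩
    refine ⟨hc, hk, fun e he => ?_⟩
    let L : Span D := ⟨p.s, p.e, p.s, p.e + 2, p.leg, by omega, by omega, by omega,
      Or.inl (by omega)⟩
    have hL : IsLongExceptional L.route := (isLongExceptional_iff hc L).2 ⟨rfl, rfl⟩
    obtain ⟨s', e', h', hn⟩ := p.leg.exists_after (by simp [hc])
    obtain ⟨s'', e'', h'', hn'⟩ := p.leg.exists_before (by simp [hc])
    have := h'.lt; have := h''.lt
    let L' : Span D := ⟨s', e', s', e' + 2, h', by omega, by omega, by omega, Or.inl (by omega)⟩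
    have hL' : IsLongExceptional L'.route := (isLongExceptional_iff hc L').2 ⟨rfl, rfl⟩
    let L'' : Span D := ⟨s'', e'', s'', e'' + 2, h'', by omega, by omega, by omega,
      Or.inl (by omega)⟩
    have hL'' : IsLongExceptional L''.route := (isLongExceptional_iff hc L'').2 ⟨rfl, rfl⟩
    have hb : p.b = L.b := rfl
    rcases (p.mem_route _).1 he with rfl | rfl | ⟨t, h4, h5, rfl⟩
    · rcases h1.eq_or_lt with h | h
      · exact ⟨_, hL, (L.mem_route _).2 (Or.inl ((low_inj hb).2 ⟨⟨rfl, rfl⟩, h.symm⟩))⟩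
      · refine ⟨_, hL'', (L''.mem_route _).2 (Or.inr (Or.inl ?_))⟩
        exact ((high_eq_low (p := L'') (b_ne_of_next hn')).2
          ⟨hn', by simp only [L'']; omega, by simp only [L'']; omega⟩).symm
    · rcases h2.eq_or_lt with h | h
      · exact ⟨_, hL, (L.mem_route _).2 (Or.inr (Or.inl ((high_inj hb).2 ⟨⟨rfl, rfl⟩, h⟩)))⟩
      · refine ⟨_, hL', (L'.mem_route _).2 (Or.inl ?_)⟩
        exact (high_eq_low (q := L') (b_ne_of_next hn)).2 ⟨hn, hh, by simp only [L']; omega⟩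
    · refine ⟨_, hL, (L.mem_route _).2 (Or.inr (Or.inr ⟨t, ?_, ?_, rfl⟩))⟩
      · have := p.s_le_lo
        simp only [L, lo]; omega
      · have := p.hi_le_e
        simp only [L, hi]; omega

/-! ### Uniqueness of corners -/

/-- On one leg the two end edges determine the interval. Otherwise the legs meet at both ends, so
that each follows the other. -/
theorem eq_or_next {t t' : Span D} (hf : t.route.first = t'.route.first)
    (hl : t.route.last = t'.route.last) :
    t.route = t'.route ∨ (t'.b = (!t.b) ∧ t.NX t' ∧ t'.NX t) := by
  rw [first_eq_iff] at hf
  rw [last_eq_iff] at hl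
  have key : t.NX t' → t'.NX t → t.route = t'.route ∨ (t'.b = (!t.b) ∧ t.NX t' ∧ t'.NX t) :=
    fun h h' => Or.inr ⟨h.b_ne, h, h'⟩
  rcases hf with ⟨h1, h2⟩ | h1 | h1 <;> rcases hl with ⟨h3, h4⟩ | h3 | h3
  · rcases h2 with ⟨h2, h5⟩ | ⟨h2, h5⟩ <;> rw [h2] at h4 <;> simp at h4
    · exact Or.inl (route_ext h1 h5 h4)
    · exact Or.inl (route_ext h1 h4 h5)
  · exact (not_sameLeg_of_NX h3.2 h1).elim
  · exact (not_sameLeg_of_NX h3.2 h1.symm).elim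
  · exact (not_sameLeg_of_NX h1.2 h3.symm).elim
  · exact key h3.2 h1.2
  · simp [h1.1] at h3
  · exact (not_sameLeg_of_NX h1.2 h3).elim
  · simp [h1.1] at h3
  · exact key h1.2 h3.2

/-- One of the two routes lies on the leg of `p`, and since it shares both end edges with the other
one, its endpoints are at the ends of the leg. The route `p` meets the other leg in a shared end
edge, and its remaining endpoint lies strictly beyond that of the first route, so it is extreme too.
-/
theorem extreme_of_row {p t t' : Span D} (hb : t'.b = !t.b) (h : t.NX t') (h' : t'.NX t)
    (hr : (t.route ∈ D.west p.route ∧ t'.route ∈ D.west p.route) ∨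
      (t.route ∈ D.east p.route ∧ t'.route ∈ D.east p.route)) : Extreme p := by
  have a1 := t.s_le; have a2 := t.le_e; have a3 := t'.s_le; have a4 := t'.le_e
  have a5 := p.s_le; have a6 := p.le_e
  simp only [mem_west_iff, mem_east_iff] at hr
  have x1 := fun h : t.HU p => h.1.b_eq
  have x2 := fun h : t'.HU p => h.1.b_eq
  have x3 := fun h : p.HU t => h.1.b_eq
  have x4 := fun h : p.HU t' => h.1.b_eq
  have y1 := fun h : t.LU p => h.1.b_eq
  have y2 := fun h : t'.LU p => h.1.b_eq
  have y3 := fun h : p.LU t => h.1.b_eq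
  have y4 := fun h : p.LU t' => h.1.b_eq
  have z1 := fun h : t.NX p => h.b_ne
  have z2 := fun h : t'.NX p => h.b_ne
  have z3 := fun h : p.NX t => h.b_ne
  have z4 := fun h : p.NX t' => h.b_ne
  obtain ⟨b1, b2, b3⟩ := h
  obtain ⟨c1, c2, c3⟩ := h'
  have key : (t.HU p ∧ t'.NX p) ∨ (t'.HU p ∧ t.NX p) ∨ (p.LU t ∧ p.NX t') ∨
      (p.LU t' ∧ p.NX t) := by
    revert x1 x2 x3 x4 y1 y2 y3 y4 z1 z2 z3 z4
    rcases hr with ⟨h1, h2⟩ | ⟨h1, h2⟩ <;> revert h1 h2 hb <;> cases p.b <;> cases t.b <;>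
      cases t'.b <;> simp <;> tauto
  rcases key with ⟨⟨⟨d1, d2⟩, d3, d4⟩, e1, e2, e3⟩ | ⟨⟨⟨d1, d2⟩, d3, d4⟩, e1, e2, e3⟩ |
    ⟨⟨⟨d1, d2⟩, d3, d4⟩, e1, e2, e3⟩ | ⟨⟨⟨d1, d2⟩, d3, d4⟩, e1, e2, e3⟩ <;>
  constructor <;> omega

theorem extreme_of_column {p t t' : Span D} (hb : t'.b = !t.b) (h : t.NX t') (h' : t'.NX t)
    (hr : (t.route ∈ D.north p.route ∧ t'.route ∈ D.north p.route) ∨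
      (t.route ∈ D.south p.route ∧ t'.route ∈ D.south p.route)) : Extreme p := by
  have a1 := t.s_le; have a2 := t.le_e; have a3 := t'.s_le; have a4 := t'.le_e
  have a5 := p.s_le; have a6 := p.le_e
  simp only [mem_north_iff, mem_south_iff] at hr
  have x1 := fun h : t.HU p => h.1.b_eq
  have x2 := fun h : t'.HU p => h.1.b_eq
  have x3 := fun h : p.HU t => h.1.b_eq
  have x4 := fun h : p.HU t' => h.1.b_eq
  have y1 := fun h : t.LU p => h.1.b_eq
  have y2 := fun h : t'.LU p => h.1.b_eq
  have y3 := fun h : p.LU t => h.1.b_eq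
  have y4 := fun h : p.LU t' => h.1.b_eq
  have z1 := fun h : t.NX p => h.b_ne
  have z2 := fun h : t'.NX p => h.b_ne
  have z3 := fun h : p.NX t => h.b_ne
  have z4 := fun h : p.NX t' => h.b_ne
  obtain ⟨b1, b2, b3⟩ := h
  obtain ⟨c1, c2, c3⟩ := h'
  have key : (t.HU p ∧ t'.NX p) ∨ (t'.HU p ∧ t.NX p) ∨ (p.LU t ∧ p.NX t') ∨
      (p.LU t' ∧ p.NX t) := by
    revert x1 x2 x3 x4 y1 y2 y3 y4 z1 z2 z3 z4
    rcases hr with ⟨h1, h2⟩ | ⟨h1, h2⟩ <;> revert h1 h2 hb <;> cases p.b <;> cases t.b <;>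
      cases t'.b <;> simp <;> tauto
  rcases key with ⟨⟨⟨d1, d2⟩, d3, d4⟩, e1, e2, e3⟩ | ⟨⟨⟨d1, d2⟩, d3, d4⟩, e1, e2, e3⟩ |
    ⟨⟨⟨d1, d2⟩, d3, d4⟩, e1, e2, e3⟩ | ⟨⟨⟨d1, d2⟩, d3, d4⟩, e1, e2, e3⟩ <;>
  constructor <;> omega

theorem subsingleton_corner {p q : Span D} (ha : ¬ (TwoLegs D ∧ Extreme p ∧ Extreme q))
    {A B : Set D.LabRoute} (hA : A ∈ ({D.west p.route, D.east p.route} : Set (Set D.LabRoute)))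
    (hB : B ∈ ({D.north q.route, D.south q.route} : Set (Set D.LabRoute))) :
    (A ∩ B).Subsingleton := by
  rintro T ⟨h1, h2⟩ T' ⟨h3, h4⟩
  obtain ⟨t, rfl⟩ := exists_span T
  obtain ⟨t', rfl⟩ := exists_span T'
  have hf : t.route.first = t'.route.first := by
    rcases hA with rfl | rfl <;> exact h1.1.trans h3.1.symm
  have hl : t.route.last = t'.route.last := by
    rcases hB with rfl | rfl <;> exact h2.1.trans h4.1.symm
  rcases eq_or_next hf hl with h | ⟨hb, h, h'⟩
  · exact h
  · refine (ha ⟨twoLegs_of_next h.1 h'.1, extreme_of_row hb h h' ?_,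
      extreme_of_column hb h h' ?_⟩).elim
    · rcases hA with rfl | rfl
      · exact Or.inl ⟨h1, h3⟩
      · exact Or.inr ⟨h1, h3⟩
    · rcases hB with rfl | rfl
      · exact Or.inl ⟨h2, h4⟩
      · exact Or.inr ⟨h2, h4⟩

end Span

end LabShape

/-! ### Exposed faces of convex hulls -/

section ConvexHull

variable {E : Type*} [AddCommGroup E] [Module ℝ E]

/-- The bound and the description of the maximizers are proved together, because the points with
both properties form a convex set: a proper convex combination has value `M` only if both points do.
-/
theorem mem_convexHull_maximizers {s : Set E} {l : E →ₗ[ℝ] ℝ} {M : ℝ} (hl : ∀ x ∈ s, l x ≤ M)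
    {x : E} (hx : x ∈ convexHull ℝ s) :
    l x ≤ M ∧ (l x = M → x ∈ convexHull ℝ {y ∈ s | l y = M}) := by
  have hc : Convex ℝ {x : E | l x ≤ M ∧ (l x = M → x ∈ convexHull ℝ {y ∈ s | l y = M})} := by
    rintro x ⟨hx1, hx2⟩ y ⟨hy1, hy2⟩ a b ha hb hab
    simp only [Set.mem_ofPred_eq, map_add, map_smul, smul_eq_mul]
    have hM : a * M + b * M = M := by rw [← add_mul, hab, one_mul]
    have ha' := mul_le_mul_of_nonneg_left hx1 ha
    have hb' := mul_le_mul_of_nonneg_left hy1 hb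
    refine ⟨by linarith, fun h => ?_⟩
    rcases ha.eq_or_lt with rfl | ha
    · obtain rfl : b = 1 := by linarith
      simpa using hy2 (by simpa using h)
    rcases hb.eq_or_lt with rfl | hb
    · obtain rfl : a = 1 := by linarith
      simpa using hx2 (by simpa using h)
    have e1 : l x = M := mul_left_cancel₀ ha.ne' (by linarith)
    have e2 : l y = M := mul_left_cancel₀ hb.ne' (by linarith)
    exact convex_convexHull ℝ _ (hx2 e1) (hy2 e2) ha.le hb.le hab
  exact convexHull_min (fun y hy => show l y ≤ M ∧ (l y = M → y ∈ convexHull ℝ {y ∈ s | l y = M}) from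
    ⟨hl y hy, fun h => subset_convexHull ℝ _ ⟨hy, h⟩⟩) hc hx

theorem convexHull_sep_eq {s : Set E} {l : E →ₗ[ℝ] ℝ} {M : ℝ} (hl : ∀ x ∈ s, l x ≤ M) :
    {x ∈ convexHull ℝ s | l x = M} = convexHull ℝ {x ∈ s | l x = M} := by
  ext x
  constructor
  · rintro ⟨h1, h2⟩
    exact (mem_convexHull_maximizers hl h1).2 h2
  · intro h
    refine ⟨convexHull_mono (Set.sep_subset _ _) h, ?_⟩
    have := convexHull_min (fun y (hy : y ∈ {y ∈ s | l y = M}) => hy.2)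
      (convex_hyperplane l.isLinear M) h
    exact this

end ConvexHull

section Polytope

variable {V : Type}

theorem isExposed_convexHull [Fintype V] {s Y : Set (V → ℝ)} (h : V → ℝ) (M : ℝ)
    (hle : ∀ x ∈ s, ∑ v, h v * x v ≤ M) (hY : Y = {x ∈ s | ∑ v, h v * x v = M}) :
    IsExposed ℝ (convexHull ℝ s) (convexHull ℝ Y) := by
  classical
  let l : (V → ℝ) →ₗ[ℝ] ℝ := ∑ v, h v • LinearMap.proj v
  have hl : ∀ x, l x = ∑ v, h v * x v := fun x => by
    simp [l, LinearMap.sum_apply]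
  have hle' : ∀ x ∈ s, l x ≤ M := fun x hx => by rw [hl]; exact hle x hx
  have hY' : convexHull ℝ Y = {x ∈ convexHull ℝ s | l x = M} := by
    rw [convexHull_sep_eq hle', hY]; simp only [hl]
  -- A point of the face shows that `M` is attained, so the maximizers are the points of value `M`.
  rintro ⟨x₀, hx₀⟩
  rw [hY'] at hx₀
  refine ⟨LinearMap.toContinuousLinearMap l, ?_⟩
  rw [hY']
  ext x
  simp only [Set.mem_ofPred_eq, LinearMap.coe_toContinuousLinearMap']
  refine and_congr_right fun hx => ⟨fun h y hy => ?_, fun h => ?_⟩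
  · rw [h]; exact (mem_convexHull_maximizers hle' hy).1
  · exact le_antisymm (mem_convexHull_maximizers hle' hx).1 (hx₀.2 ▸ h x₀ hx₀.1)

/-- The values at `z` and `z'` add up to twice the maximum, so neither can be smaller than it. -/
theorem IsExposed.mem_of_add_eq {P F : Set (V → ℝ)} (hF : IsExposed ℝ P F) {x y z z' : V → ℝ}
    (hx : x ∈ F) (hy : y ∈ F) (hz : z ∈ P) (hz' : z' ∈ P) (h : x + y = z + z') : z ∈ F := by
  obtain ⟨l, rfl⟩ := hF ⟨x, hx⟩
  refine ⟨hz, fun w hw => ?_⟩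
  have h1 := hx.2 w hw
  have h2 := hx.2 z hz
  have h3 := hy.2 z' hz'
  have h4 : l x + l y = l z + l z' := by rw [← map_add, h, map_add]
  linarith

/-- A functional that is maximal at the origin is nonpositive on each unit vector and on its
negative, hence zero. -/
theorem IsExposed.eq_of_zero_mem [Fintype V] [DecidableEq V] {P F : Set (V → ℝ)} (hF : IsExposed ℝ P F)
    (hP : ∀ v, Pi.single v 1 ∈ P ∧ -Pi.single v 1 ∈ P) (h0 : (0 : V → ℝ) ∈ F) : F = P := by
  obtain ⟨l, rfl⟩ := hF ⟨0, h0⟩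
  have hl : ∀ v, l (Pi.single v 1) = 0 := fun v => by
    have h1 := h0.2 _ (hP v).1
    have h2 := h0.2 _ (hP v).2
    rw [map_zero] at h1 h2
    rw [map_neg] at h2
    linarith
  have hl' : ∀ x, l x = 0 := fun x => by
    have := LinearMap.pi_apply_eq_sum_univ l.toLinearMap x
    simp only [ContinuousLinearMap.coe_coe] at this
    rw [this]
    refine Finset.sum_eq_zero fun i _ => ?_
    have e : (fun j => if i = j then (1 : ℝ) else 0) = Pi.single i 1 := by
      ext j; simp [Pi.single_apply, eq_comm]
    rw [e, hl, smul_zero]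
  ext x
  simp [hl']

theorem IsExposed.eq_convexHull {s F : Set (V → ℝ)} (hF : IsExposed ℝ (convexHull ℝ s) F) :
    F = convexHull ℝ (F ∩ s) := by
  rcases F.eq_empty_or_nonempty with rfl | ⟨x₀, hx₀⟩
  · simp
  obtain ⟨l, rfl⟩ := hF ⟨x₀, hx₀⟩
  have hle : ∀ x ∈ s, l.toLinearMap x ≤ l x₀ := fun x hx => hx₀.2 x (subset_convexHull ℝ s hx)
  have e1 : {x ∈ convexHull ℝ s | ∀ y ∈ convexHull ℝ s, l y ≤ l x} =
      {x ∈ convexHull ℝ s | l.toLinearMap x = l x₀} := by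
    ext x
    refine and_congr_right fun hx => ⟨fun h => ?_, fun h y hy => ?_⟩
    · exact le_antisymm (hx₀.2 x hx) (h x₀ hx₀.1)
    · exact (hx₀.2 y hy).trans (le_of_eq h.symm)
  rw [e1, convexHull_sep_eq hle]
  congr 1
  ext x
  constructor
  · rintro ⟨h1, h2⟩
    exact ⟨subset_convexHull ℝ _ ⟨h1, h2⟩, h1⟩
  · rintro ⟨h1, h2⟩
    rw [← convexHull_sep_eq hle] at h1
    exact ⟨h2, h1.2⟩

/-- A face is spanned by the points of `s` in it, so there are finitely many faces, and a proper one
lies in a maximal one. -/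
theorem exists_isFacet [Fintype V] {s : Set (V → ℝ)} (hs : s.Finite) {F : Set (V → ℝ)}
    (hF : IsExposed ℝ (convexHull ℝ s) F) (hne : F ≠ convexHull ℝ s) :
    ∃ F', IsFacet (convexHull ℝ s) F' ∧ F ⊆ F' := by
  have hfin : {F' : Set (V → ℝ) | IsExposed ℝ (convexHull ℝ s) F' ∧ F' ≠ convexHull ℝ s}.Finite := by
    refine Set.Finite.of_finite_image (f := fun F' => F' ∩ s)
      (hs.finite_subsets.subset ?_) ?_
    · rintro _ ⟨F', -, rfl⟩
      exact Set.inter_subset_right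
    · intro F₁ h₁ F₂ h₂ h
      simp only at h
      rw [h₁.1.eq_convexHull, h₂.1.eq_convexHull, h]
  obtain ⟨F', h1, h2⟩ := hfin.exists_le_maximal ⟨hF, hne⟩
  exact ⟨F', h2, h1⟩

/-- The unit vectors of two coordinates and their negatives do not lie on a line. -/
theorem not_eq_segment [DecidableEq V] {P : Set (V → ℝ)}
    (hP : ∀ v, Pi.single v 1 ∈ P ∧ -Pi.single v 1 ∈ P) {v v' : V} (hv : v ≠ v')
    (x y : V → ℝ) : segment ℝ x y ≠ P := by
  intro h
  have key : ∀ z ∈ P, ∃ a : ℝ, z = x + a • (y - x) := by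
    intro z hz
    rw [← h, segment_eq_image'] at hz
    obtain ⟨a, -, rfl⟩ := hz
    exact ⟨a, rfl⟩
  obtain ⟨a, ha⟩ := key _ (hP v).1
  obtain ⟨b, hb⟩ := key _ (hP v).2
  obtain ⟨c, hc⟩ := key _ (hP v').1
  obtain ⟨d, hd⟩ := key _ (hP v').2
  have a1 := congrFun ha v; have b1 := congrFun hb v
  have c1 := congrFun hc v; have d1 := congrFun hd v
  have c2 := congrFun hc v'; have d2 := congrFun hd v'
  simp only [Pi.add_apply, Pi.smul_apply, Pi.sub_apply, Pi.neg_apply, smul_eq_mul,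
    Pi.single_eq_same, Pi.single_eq_of_ne hv] at *
  have e1 : (a - b) * (y v - x v) = 2 := by linear_combination b1 - a1
  have e2 : (c - d) * (y v - x v) = 0 := by linear_combination d1 - c1
  have e3 : (c - d) * (y v' - x v') = 2 := by linear_combination d2 - c2
  rcases mul_eq_zero.1 e2 with h | h
  · rw [h] at e3; norm_num at e3
  · rw [h] at e1; norm_num at e1

/-- Where `x` and `y` differ, one entry is `0` and the other `1` or `-1`, so every point strictly
between them has a non-integral entry. -/
theorem eq_or_eq_of_mem_segment {x y z : V → ℝ} (hx : ∀ v, x v = -1 ∨ x v = 0 ∨ x v = 1)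
    (hy : ∀ v, y v = -1 ∨ y v = 0 ∨ y v = 1) (hz : ∀ v, z v = -1 ∨ z v = 0 ∨ z v = 1)
    (hxy : ∀ v, 0 ≤ x v * y v) (h : z ∈ segment ℝ x y) : z = x ∨ z = y := by
  obtain ⟨a, b, ha, hb, hab, rfl⟩ := h
  rcases ha.eq_or_lt with rfl | ha
  · right; simp [show b = 1 by linarith]
  rcases hb.eq_or_lt with rfl | hb
  · left; simp [show a = 1 by linarith]
  left
  obtain rfl : b = 1 - a := by linarith
  suffices x = y by subst this; rw [← add_smul, hab, one_smul]
  ext v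
  have h1 := hx v; have h2 := hy v; have h3 := hz v; have h4 := hxy v
  simp only [Pi.add_apply, Pi.smul_apply, smul_eq_mul] at h3
  rcases h1 with h1 | h1 | h1 <;> rcases h2 with h2 | h2 | h2 <;> rw [h1, h2] at h3 h4 ⊢ <;>
    first
    | (exfalso; linarith)
    | (exfalso; rcases h3 with h3 | h3 | h3 <;> linarith)

end Polytope

/-! ### Values and signs of `g`-vectors -/

namespace FramedDag

variable {V : Type} {G : FramedDag V}

theorem gVec_mem_values (R : Route G) (v : V) :
    gVec R v = -1 ∨ gVec R v = 0 ∨ gVec R v = 1 := by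
  unfold gVec; split_ifs <;> simp

theorem finite_range_gVec [Finite V] : (Set.range (gVec (G := G))).Finite := by
  refine (Set.Finite.pi' (t := fun _ : V => ({-1, 0, 1} : Set ℝ)) fun _ => by simp).subset ?_
  rintro _ ⟨R, rfl⟩ v
  simpa using gVec_mem_values R v

theorem gVec_mem_gPolytope (R : Route G) : gVec R ∈ gPolytope G :=
  subset_convexHull ℝ _ ⟨R, rfl⟩

/-- Opposite signs at `v` are a conflict at the subroute consisting of `v` alone. -/
theorem gVec_mul_nonneg {R S : Route G} (h : Coherent R S) (v : V) : 0 ≤ gVec R v * gVec S v := by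
  have hm : ∀ T : Route G, gVec T v = -1 → ∃ e f, [e, f] <:+: T.edges ∧
      G.head e = DagVertex.inner v ∧ G.isTwo e = false ∧ G.isTwo f = true := by
    intro T hT
    unfold gVec at hT
    split_ifs at hT with h1 h2
    · exact h1
    · norm_num at hT
    · norm_num at hT
  have hp : ∀ T : Route G, gVec T v = 1 → ∃ e f, [e, f] <:+: T.edges ∧
      G.head e = DagVertex.inner v ∧ G.isTwo e = true ∧ G.isTwo f = false := by
    intro T hT
    unfold gVec at hT
    split_ifs at hT with h1 h2
    · norm_num at hT
    · exact h2
    · norm_num at hT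
  rcases gVec_mem_values R v with h1 | h1 | h1 <;> rcases gVec_mem_values S v with h2 | h2 | h2 <;>
    rw [h1, h2] <;> try norm_num
  · obtain ⟨e, f, a1, a2, a3, a4⟩ := hm R h1
    obtain ⟨e', f', b1, b2, b3, b4⟩ := hp S h2
    exact (h ⟨e, e', f, f', [], a1, b1, a2.trans b2.symm, Or.inl (by simp [a3, a4, b3, b4])⟩).elim
  · obtain ⟨e, f, a1, a2, a3, a4⟩ := hp R h1
    obtain ⟨e', f', b1, b2, b3, b4⟩ := hm S h2
    exact (h ⟨e, e', f, f', [], a1, b1, a2.trans b2.symm, Or.inr (by simp [a3, a4, b3, b4])⟩).elim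

end FramedDag

/-! ### The origin is interior to the polytope -/

namespace LabShape

open FramedDag

variable {D : LabShape}

namespace Span

theorem two_le_numInner : 2 ≤ D.numInner := by
  obtain ⟨s, e, h, -⟩ := exists_isLeg D.numSteps_pos
  have h1 := h.lt; have h2 := h.le
  rcases hc : D.cyclic with _ | _
  · rw [D.numInner_of_not_cyclic hc]; have := D.numSteps_pos; omega
  · rw [D.numInner_of_cyclic hc]
    by_contra h3
    exact h.not_whole hc ⟨by omega, by omega⟩

theorem single_mem (v : Fin D.numInner) : Pi.single v 1 ∈ D.dag.gPolytope := by
  have hN := D.numSteps_pos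
  suffices ∃ p : Span D, gVec p.route = Pi.single v 1 by
    obtain ⟨p, hp⟩ := this
    rw [← hp]; exact gVec_mem_gPolytope _
  -- A route with upper end at the vertex needs an inner edge before it, so in a cycle the first
  -- vertex is taken as the end of the last leg.
  obtain ⟨x, hx, hx', rfl⟩ : ∃ x, x ≤ D.numSteps ∧ (D.cyclic = true → 0 < x) ∧ D.vtx x = v := by
    rcases Nat.eq_zero_or_pos (v : ℕ) with h | h
    · rcases hc : D.cyclic with _ | _
      · exact ⟨0, by omega, by simp, by rw [← h, D.vtx_coe]⟩
      · refine ⟨D.numSteps, le_rfl, fun _ => hN, ?_⟩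
        rw [← D.vtx_coe v, h, D.vtx_eq_iff le_rfl (by omega)]
        exact Or.inr ⟨hc, Or.inr ⟨rfl, rfl⟩⟩
    · refine ⟨v, ?_, fun _ => h, D.vtx_coe v⟩
      have := v.2
      rcases hc : D.cyclic with _ | _
      · have h2 := D.numInner_of_not_cyclic hc; omega
      · have h2 := D.numInner_of_cyclic hc; omega
  rcases Nat.eq_zero_or_pos x with rfl | h0
  · obtain ⟨s, e, h, h1, h2⟩ := exists_isLeg hN
    have hc : D.cyclic = false := by
      rcases hc : D.cyclic with _ | _
      · rfl
      · exact absurd (hx' hc) (by omega)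
    obtain rfl : s = 0 := by omega
    refine ⟨⟨0, e, 0, 1, h, le_rfl, by omega, by omega, Or.inr ⟨hc, Or.inl ⟨rfl, rfl⟩⟩⟩, ?_⟩
    rw [gVec_route, pt_left, pt, if_pos (by simp only; omega), sub_zero, Nat.sub_self]
  · obtain ⟨s, e, h, h1, h2⟩ := exists_isLeg (D := D) (j := x - 1) (by omega)
    refine ⟨⟨s, e, s, x + 1, h, le_rfl, by omega, by omega, Or.inl (by omega)⟩, ?_⟩
    rw [gVec_route, pt_left, pt, if_pos (by simp only; omega), sub_zero, Nat.add_sub_cancel]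

theorem neg_single_mem (v : Fin D.numInner) : -Pi.single v 1 ∈ D.dag.gPolytope := by
  have hN := D.numSteps_pos
  suffices ∃ p : Span D, gVec p.route = -Pi.single v 1 by
    obtain ⟨p, hp⟩ := this
    rw [← hp]; exact gVec_mem_gPolytope _
  have hv := v.2
  by_cases hx : (v : ℕ) < D.numSteps
  · obtain ⟨s, e, h, h1, h2⟩ := exists_isLeg hx
    refine ⟨⟨s, e, v + 1, e + 2, h, by omega, by omega, le_rfl, Or.inl (by omega)⟩, ?_⟩
    rw [gVec_route, pt_right, pt, if_pos (by simp only; omega), zero_sub, Nat.add_sub_cancel,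
      D.vtx_coe]
  · obtain ⟨s, e, h, h1, h2⟩ := exists_isLeg (D := D) (j := D.numSteps - 1) (by omega)
    have h3 := h.le
    have hc : D.cyclic = false := by
      rcases hc : D.cyclic with _ | _
      · rfl
      · have h4 := D.numInner_of_cyclic hc; omega
    have h4 := D.numInner_of_not_cyclic hc
    obtain rfl : e = D.numSteps := by omega
    refine ⟨⟨s, D.numSteps, D.numSteps + 1, D.numSteps + 2, h, by omega, by omega, le_rfl,
      Or.inr ⟨hc, Or.inr ⟨rfl, rfl⟩⟩⟩, ?_⟩
    rw [gVec_route, pt_right, pt, if_pos (by simp only; omega), zero_sub, Nat.add_sub_cancel]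
    rw [show D.numSteps = (v : ℕ) by omega, D.vtx_coe]

theorem eq_gPolytope_of_zero_mem {F : Set (Fin D.numInner → ℝ)}
    (hF : IsExposed ℝ D.dag.gPolytope F) (h : 0 ∈ F) : F = D.dag.gPolytope :=
  hF.eq_of_zero_mem (fun v => ⟨single_mem v, neg_single_mem v⟩) h

theorem segment_ne_gPolytope (x y : Fin D.numInner → ℝ) : segment ℝ x y ≠ D.dag.gPolytope := by
  have := two_le_numInner (D := D)
  refine not_eq_segment (fun v => ⟨single_mem v, neg_single_mem v⟩)
    (v := ⟨0, by omega⟩) (v' := ⟨1, by omega⟩) (by simp) x y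

theorem isMinimalFace_gPolytope {R S : D.LabRoute}
    (h : ∀ F, IsExposed ℝ D.dag.gPolytope F → gVec R ∈ F → gVec S ∈ F → 0 ∈ F) :
    IsMinimalFace D.dag.gPolytope {gVec R, gVec S} D.dag.gPolytope := by
  refine ⟨⟨IsExposed.refl _, ?_⟩, ?_⟩
  · rintro _ (rfl | rfl) <;> exact gVec_mem_gPolytope _
  · rintro F ⟨h1, h2⟩
    rw [eq_gPolytope_of_zero_mem h1 (h F h1 (h2 (by simp)) (h2 (by simp)))]

end Span

end LabShape

namespace LabShape

/-! ### Height functions on a leg -/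

/-- The value at a point of an extended leg, which is zero at the two ends. -/
def cut (s e : ℕ) (f : ℕ → ℤ) (p : ℕ) : ℤ := if s < p ∧ p < e + 2 then f p else 0

/-- A height function on a leg for the interval from `i` to `j`. -/
def ramp (s e i j p : ℕ) : ℤ :=
  -- The added points have height `0`. If one endpoint is an added point, the other must carry all
  -- of the `6`, and the plateau of height `2` or `-2` lowers the rise of shorter intervals.
  -- Plateaus stay this small because they may be visible on neighbouring legs.
  if i = s then (if p = j then 6 else if p < j then 2 else 0)
  else if j = e + 2 then (if p = i then -6 else if i < p then -2 else 0)
  else if p = i then -3 else if p = j then 3 else 0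

/-- A height function on a leg for the intervals from `i` to `j` and from `i` to `j'`. -/
def rampLow (s e i j j' p : ℕ) : ℤ :=
  if i = s then (if p = j ∨ p = j' then 6 else if p < j' then 2 else 0)
  else if j' = e + 2 then (if p = i then -6 else if p = j then 0 else if i < p then -2 else 0)
  else if p = i then -3 else if p = j ∨ p = j' then 3 else 0

/-- A height function on a leg for the intervals from `i` to `j` and from `i'` to `j`. -/
def rampHigh (s e i i' j p : ℕ) : ℤ :=
  if j = e + 2 then (if p = i ∨ p = i' then -6 else if i < p then -2 else 0)
  else if i = s then (if p = j then 6 else if p = i' then 0 else if p < j then 2 else 0)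
  else if p = i ∨ p = i' then -3 else if p = j then 3 else 0

/-- A height function on a leg for the disjoint intervals from `i` to `j` and from `i'` to `j'`. -/
def rampTwo (s e i j i' j' p : ℕ) : ℤ :=
  if i = s ∨ j' = e + 2 then ramp s e i j p + ramp s e i' j' p
  -- Heights `-3` and `3` on both intervals would also give `6` from `i` to `j'`; with these values
  -- that rise is `4`.
  else if p = i then -2 else if p = j then 4 else if p = i' then -4 else if p = j' then 2 else 0

/-- A height function on a leg for the intervals that start at `i` or `i'` and end at `j` or `j'`. -/
def rampCross (s e i i' j j' p : ℕ) : ℤ :=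
  if i = s then (if p = i' then 0 else if p = j ∨ p = j' then 6 else if p < j' then 2 else 0)
  else if j' = e + 2 then
    (if p = i ∨ p = i' then -6 else if p = j then 0 else if i < p then -2 else 0)
  else if p = i ∨ p = i' then -3 else if p = j ∨ p = j' then 3 else 0

/-- The common refinement of two heights of the same sign. -/
def join (a b : ℤ) : ℤ := max (max a b) 0 + min (min a b) 0

/-- A function on a leg that vanishes except at the first and the last vertex. -/
def atEnds (s e : ℕ) (y z : ℤ) (p : ℕ) : ℤ := if p = s + 1 then y else if p = e + 1 then z else 0

/-- A height function on the first of two consecutive legs. -/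
def upLow (e i p : ℕ) : ℤ := if p = i then -6 else if i < p ∧ p < e + 1 then -2 else 0

/-- A height function on the second of two consecutive legs. -/
def upHigh (s j p : ℕ) : ℤ := if p = j then 6 else if s + 1 < p ∧ p < j then 2 else 0

variable {s e i j i' j' a b : ℕ} {y z : ℤ}

theorem ramp_le (h1 : s ≤ i) (h2 : i < j) (h3 : j ≤ e + 2) (h : ¬ (i = s ∧ j = e + 2))
    (ha : s ≤ a) (hab : a ≤ b) (hb : b ≤ e + 2) :
    cut s e (ramp s e i j) b - cut s e (ramp s e i j) a ≤ 6 ∧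
    (cut s e (ramp s e i j) b - cut s e (ramp s e i j) a = 6 ↔ a = i ∧ b = j) := by
  simp only [cut, ramp]
  grind

theorem rampLow_le (h1 : s ≤ i) (h2 : i < j) (h2' : j < j') (h3 : j' ≤ e + 2) (h : ¬ (i = s ∧ j' = e + 2))
    (ha : s ≤ a) (hab : a ≤ b) (hb : b ≤ e + 2) :
    cut s e (rampLow s e i j j') b - cut s e (rampLow s e i j j') a ≤ 6 ∧
    (cut s e (rampLow s e i j j') b - cut s e (rampLow s e i j j') a = 6 ↔ a = i ∧ (b = j ∨ b = j')) := by
  simp only [cut, rampLow]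
  grind

theorem rampHigh_le (h1 : s ≤ i) (h2 : i < i') (h2' : i' < j) (h3 : j ≤ e + 2) (h : ¬ (i = s ∧ j = e + 2))
    (ha : s ≤ a) (hab : a ≤ b) (hb : b ≤ e + 2) :
    cut s e (rampHigh s e i i' j) b - cut s e (rampHigh s e i i' j) a ≤ 6 ∧
    (cut s e (rampHigh s e i i' j) b - cut s e (rampHigh s e i i' j) a = 6 ↔ (a = i ∨ a = i') ∧ b = j) := by
  simp only [cut, rampHigh]
  grind

theorem rampCross_le (h1 : s ≤ i) (h2 : i < i') (h2' : i' < j) (h3 : j < j') (h4 : j' ≤ e + 2) (h : ¬ (i = s ∧ j' = e + 2))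
    (ha : s ≤ a) (hab : a ≤ b) (hb : b ≤ e + 2) :
    cut s e (rampCross s e i i' j j') b - cut s e (rampCross s e i i' j j') a ≤ 6 ∧
    (cut s e (rampCross s e i i' j j') b - cut s e (rampCross s e i i' j j') a = 6 ↔
      (a = i ∨ a = i') ∧ (b = j ∨ b = j')) := by
  simp only [cut, rampCross]
  grind

theorem rampTwo_le (h1 : s ≤ i) (h2 : i < j) (h2' : j < i') (h3 : i' < j') (h4 : j' ≤ e + 2)
    (ha : s ≤ a) (hab : a ≤ b) (hb : b ≤ e + 2) :
    cut s e (rampTwo s e i j i' j') b - cut s e (rampTwo s e i j i' j') a ≤ 6 ∧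
    (cut s e (rampTwo s e i j i' j') b - cut s e (rampTwo s e i j i' j') a = 6 ↔
      (a = i ∧ b = j) ∨ (a = i' ∧ b = j')) := by
  by_cases h : i = s ∨ j' = e + 2
  · simp only [cut, rampTwo, ramp, if_pos h]
    constructor <;> grind (splits := 20)
  · simp only [cut, rampTwo, if_neg h]
    grind (splits := 20)

/-- The numbers `y` and `z` are the heights that the ramp of a second interval on another leg leaves
at the first and last vertex of this leg. The conditions on `i` and `j` exclude nesting (for `-2`,
`2`) and conflict (for the others) at a junction; `hyz` holds as the second interval is not a whole
leg. -/
theorem join_ramp_le (hse : s < e) (h1 : s ≤ i) (h2 : i < j) (h3 : j ≤ e + 2) (h : ¬ (i = s ∧ j = e + 2))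
    (ha : s ≤ a) (hab : a ≤ b) (hb : b ≤ e + 2)
    (hy : y = 0 ∨ (s + 2 ≤ b ∧ ((y = -2 ∧ i ≠ s) ∨ ((y = 3 ∨ y = 6) ∧ i ≠ s + 1))))
    (hz : z = 0 ∨ (a ≤ e ∧ ((z = 2 ∧ j ≠ e + 2) ∨ ((z = -3 ∨ z = -6) ∧ j ≠ e + 1))))
    (hyz : ¬ (y = -2 ∧ z = 2)) :
    let f := cut s e fun p => join (ramp s e i j p) (atEnds s e y z p)
    f b - f a ≤ 6 ∧ (f b - f a = 6 ↔ a = i ∧ b = j) := by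
  intro f
  have key : ∀ p, ((p ≤ s ∨ e + 2 ≤ p) ∧ f p = 0) ∨ (p = s + 1 ∧ f p = join (ramp s e i j p) y) ∨
    (p = e + 1 ∧ f p = join (ramp s e i j p) z) ∨ (s + 2 ≤ p ∧ p ≤ e ∧ f p = ramp s e i j p) := by
    intro p
    simp only [f, cut, atEnds]
    split_ifs with k1 k2 k3
    · right; left; exact ⟨k2, rfl⟩
    · right; right; left; exact ⟨k3, rfl⟩
    · right; right; right; refine ⟨by omega, by omega, ?_⟩; simp only [join]; omega
    · left; exact ⟨by omega, rfl⟩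
  have ka := key a
  have kb := key b
  have hfab : a = b → f a = f b := fun h => h ▸ rfl
  clear_value f
  clear key
  -- In each shape of the ramp, bounds for the heights at `a` and at `b` separately imply the claim.
  by_cases hi : i = s
  · have hr : ∀ p, (p = j ∧ ramp s e i j p = 6) ∨ (p < j ∧ ramp s e i j p = 2) ∨
        (j < p ∧ ramp s e i j p = 0) := by
      intro p; simp only [ramp]; split_ifs <;> omega
    have ra := hr a; have rb := hr b
    have f1 : 0 ≤ f a ∧ (s < a → a < j → 2 ≤ f a) := by
      clear kb rb; simp only [join] at ka; omega
    have f2 : f b ≤ 6 ∧ (f b = 6 → b = j) := by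
      clear ka ra; simp only [join] at kb; omega
    have f3 : b = j → a = s → f b = 6 ∧ f a = 0 := by
      rintro rfl rfl; simp only [join] at ka kb; omega
    clear ka kb ra rb hr hy hz
    omega
  by_cases hj : j = e + 2
  · have hr : ∀ p, (p = i ∧ ramp s e i j p = -6) ∨ (p < i ∧ ramp s e i j p = 0) ∨
        (i < p ∧ ramp s e i j p = -2) := by
      intro p; simp only [ramp]; split_ifs <;> omega
    have ra := hr a; have rb := hr b
    have f1 : f b ≤ 0 ∧ (b < e + 2 → i < b → f b ≤ -2) := by
      clear ka ra; simp only [join] at kb; omega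
    have f2 : -6 ≤ f a ∧ (f a = -6 → a = i) := by
      clear kb rb; simp only [join] at ka; omega
    have f3 : b = e + 2 → a = i → f b = 0 ∧ f a = -6 := by
      rintro rfl rfl; simp only [join] at ka kb; omega
    clear ka kb ra rb hr hy hz
    omega
  · have hr : ∀ p, (p = i ∧ ramp s e i j p = -3) ∨ (p = j ∧ ramp s e i j p = 3) ∨
        (p ≠ i ∧ p ≠ j ∧ ramp s e i j p = 0) := by
      intro p; simp only [ramp]; split_ifs <;> omega
    have ra := hr a; have rb := hr b
    have f1 : f b ≤ 3 ∧ (f b = 3 → b = j) := by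
      clear ka ra; simp only [join] at kb; omega
    have f2 : -3 ≤ f a ∧ (f a = -3 → a = i) := by
      clear kb rb; simp only [join] at ka; omega
    have f3 : b = j → a = i → f b = 3 ∧ f a = -3 := by
      rintro rfl rfl; simp only [join] at ka kb; omega
    clear ka kb ra rb hr hy hz
    omega

/-- An interval cannot end at a first vertex or start at a last vertex where another leg is
attached. So large positive `y` and large negative `z` are harmless, and the rise is at most `2 +
2`. -/
theorem atEnds_le (ha : s ≤ a) (hab : a ≤ b)
    (hy : y = 0 ∨ (s + 2 ≤ b ∧ -2 ≤ y)) (hz : z = 0 ∨ (a ≤ e ∧ z ≤ 2)) :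
    cut s e (atEnds s e y z) b - cut s e (atEnds s e y z) a < 6 := by
  simp only [cut, atEnds]
  grind

/-- The junction vertex gets height `0`, like the added point beyond it, so the intervals that end
at `e + 1` and at `e + 2` are maximal together. -/
theorem upLow_le (hse : s < e) (h1 : s < i) (h2 : i ≤ e) (ha : s ≤ a) (hab : a ≤ b) (hb : b ≤ e + 2)
    (hy : y = 0 ∨ (s + 2 ≤ b ∧ y = 6 ∧ i ≠ s + 1)) :
    cut s e (fun p => upLow e i p + atEnds s e y 0 p) b -
      cut s e (fun p => upLow e i p + atEnds s e y 0 p) a ≤ 6 ∧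
    (cut s e (fun p => upLow e i p + atEnds s e y 0 p) b -
      cut s e (fun p => upLow e i p + atEnds s e y 0 p) a = 6 ↔
        a = i ∧ (b = e + 1 ∨ b = e + 2)) := by
  simp only [cut, upLow, atEnds]
  constructor <;> grind (splits := 20)

theorem upHigh_le (hse : s < e) (h1 : s + 2 ≤ j) (h2 : j < e + 2) (ha : s ≤ a) (hab : a ≤ b) (hb : b ≤ e + 2)
    (hz : z = 0 ∨ (a ≤ e ∧ z = -6 ∧ j ≠ e + 1)) :
    cut s e (fun p => upHigh s j p + atEnds s e 0 z p) b -
      cut s e (fun p => upHigh s j p + atEnds s e 0 z p) a ≤ 6 ∧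
    (cut s e (fun p => upHigh s j p + atEnds s e 0 z p) b -
      cut s e (fun p => upHigh s j p + atEnds s e 0 z p) a = 6 ↔
        (a = s ∨ a = s + 1) ∧ b = j) := by
  simp only [cut, upHigh, atEnds]
  constructor <;> grind (splits := 20)
end LabShape

namespace LabShape

open FramedDag

variable {D : LabShape}

/-! ### Heights of the vertices -/

open Classical in
variable (D) in
/-- The function on the vertices that is given on a leg by a function of the points of the extended
leg, and vanishes at all other vertices. -/
noncomputable def legFun (s e : ℕ) (φ : ℕ → ℤ) (v : Fin D.numInner) : ℤ :=
  if h : ∃ p, s < p ∧ p < e + 2 ∧ D.vtx (p - 1) = v then φ h.choose else 0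

theorem not_next_self {s e : ℕ} (h : D.IsLeg s e) : ¬ D.Next e s := by
  intro h'
  have := h.dir_ne_of_next h h'
  revert this; cases D.dir s <;> simp

theorem legFun_same {s e p : ℕ} (h : D.IsLeg s e) (φ : ℕ → ℤ) (h1 : s < p) (h2 : p < e + 2) :
    legFun D s e φ (D.vtx (p - 1)) = φ p := by
  have hex : ∃ q, s < q ∧ q < e + 2 ∧ D.vtx (q - 1) = D.vtx (p - 1) := ⟨p, h1, h2, rfl⟩
  rw [legFun, dif_pos hex]
  obtain ⟨a1, a2, a3⟩ := hex.choose_spec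
  rcases h.vtx_eq h (by omega) (by omega) (by omega) (by omega) a3 with h3 | h3 | h3
  · congr 1; omega
  · exact (not_next_self h h3.1).elim
  · exact (not_next_self h h3.1).elim

-- Another leg sees the function only at junctions with this one, of which there are two in a cycle
-- with two legs.
open Classical in
theorem legFun_other {s e s' e' p : ℕ} (h : D.IsLeg s e) (h' : D.IsLeg s' e')
    (hne : ¬ (s = s' ∧ e = e')) (φ : ℕ → ℤ) (h1 : s' < p) (h2 : p < e' + 2) :
    legFun D s e φ (D.vtx (p - 1)) = atEnds s' e' (if D.Next e s' then φ (e + 1) else 0)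
      (if D.Next e' s then φ (s + 1) else 0) p := by
  have a1 := h.lt; have a2 := h'.lt; have a3 := h.le; have a4 := h'.le
  by_cases hex : ∃ q, s < q ∧ q < e + 2 ∧ D.vtx (q - 1) = D.vtx (p - 1)
  · rw [legFun, dif_pos hex]
    obtain ⟨b1, b2, b3⟩ := hex.choose_spec
    rcases h.vtx_eq h' (by omega) (by omega) (by omega) (by omega) b3 with h3 | ⟨h3, h4, h5⟩ |
      ⟨h3, h4, h5⟩
    · exact (hne ⟨h3.1, h3.2.1⟩).elim
    · rw [atEnds, if_pos (by omega), if_pos h3]; congr 1; omega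
    · rw [atEnds, if_neg (by omega), if_pos (by omega), if_pos h3]; congr 1; omega
  · rw [legFun, dif_neg hex, atEnds]
    split_ifs with d1 c1 d2 c2
    · refine (hex ⟨e + 1, by omega, by omega, ?_⟩).elim
      rw [d1, Nat.add_sub_cancel, Nat.add_sub_cancel]
      exact Span.vtx_eq_of_next (by omega) (by omega) c1
    · rfl
    · refine (hex ⟨s + 1, by omega, by omega, ?_⟩).elim
      rw [d2, Nat.add_sub_cancel, Nat.add_sub_cancel]
      exact (Span.vtx_eq_of_next (by omega) (by omega) c2).symm
    · rfl
    · rfl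

namespace Span

/-- The value of a height function of the vertices on the `g`-vector of the route of an interval. -/
def rise (h : Fin D.numInner → ℤ) (r : Span D) : ℤ :=
  cut r.s r.e (fun x => h (D.vtx (x - 1))) r.w - cut r.s r.e (fun x => h (D.vtx (x - 1))) r.u

theorem sum_pt (h : Fin D.numInner → ℤ) (s e p : ℕ) :
    ∑ v, (h v : ℝ) * pt D s e p v = (cut s e (fun x => h (D.vtx (x - 1))) p : ℤ) := by
  rw [pt, cut]
  split_ifs <;> simp [Pi.single_apply]

theorem sum_gVec (h : Fin D.numInner → ℤ) (r : Span D) :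
    ∑ v, (h v : ℝ) * gVec r.route v = (rise h r : ℤ) := by
  rw [gVec_route, rise, Int.cast_sub, ← sum_pt, ← sum_pt, ← Finset.sum_sub_distrib]
  simp only [Pi.sub_apply, mul_sub]

theorem rise_congr (h : Fin D.numInner → ℤ) {r r' : Span D} (hr : r.route = r'.route) :
    rise h r = rise h r' := by
  have h1 := sum_gVec h r
  rw [hr, sum_gVec] at h1
  exact_mod_cast h1.symm

/-- The routes in `Y` are the ones on which some linear functional attains its maximum. -/
def Supported (Y : Set D.LabRoute) : Prop :=
  -- The maximum is normalized to `6`, so that half and a third of it are integers.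
  ∃ h : Fin D.numInner → ℤ, ∀ r : Span D, rise h r ≤ 6 ∧ (rise h r = 6 ↔ r.route ∈ Y)

/-- The functional sees only the `g`-vector, so this vector decides membership. For a single route
it yields injectivity of `gVec`. -/
theorem Supported.mem_iff {Y : Set D.LabRoute} (hY : Supported Y) (R : D.LabRoute) :
    gVec R ∈ gVec '' Y ↔ R ∈ Y := by
  refine ⟨?_, fun h => ⟨R, h, rfl⟩⟩
  rintro ⟨S, hS, hSR⟩
  obtain ⟨h, hh⟩ := hY
  obtain ⟨r, rfl⟩ := exists_span R
  obtain ⟨q, rfl⟩ := exists_span S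
  rw [← (hh r).2]
  have h1 := sum_gVec h r
  rw [← hSR, sum_gVec, Int.cast_inj] at h1
  rw [← h1]
  exact (hh q).2.2 hS

theorem Supported.isExposed {Y : Set D.LabRoute} (hY : Supported Y) :
    IsExposed ℝ D.dag.gPolytope (convexHull ℝ (gVec '' Y)) := by
  have hm := hY.mem_iff
  obtain ⟨h, hh⟩ := hY
  refine isExposed_convexHull (fun v => (h v : ℝ)) 6 ?_ ?_
  · rintro _ ⟨R, rfl⟩
    obtain ⟨r, rfl⟩ := exists_span R
    rw [sum_gVec]
    exact_mod_cast (hh r).1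
  · ext x
    have key : ∀ r : Span D, r.route ∈ Y ↔ ∑ v, (h v : ℝ) * gVec r.route v = 6 := by
      intro r
      rw [sum_gVec, ← (hh r).2]
      norm_cast
    constructor
    · rintro ⟨R, hR, rfl⟩
      obtain ⟨r, rfl⟩ := exists_span R
      exact ⟨⟨_, rfl⟩, (key r).1 hR⟩
    · rintro ⟨⟨R, rfl⟩, h2⟩
      obtain ⟨r, rfl⟩ := exists_span R
      exact ⟨_, (key r).2 h2, rfl⟩

/-- The minimal face of two routes that determine all routes of a supported set. -/
theorem Supported.isMinimalFace {Y : Set D.LabRoute} (hY : Supported Y) {R S : D.LabRoute}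
    (hR : R ∈ Y) (hS : S ∈ Y)
    (h : ∀ F, IsExposed ℝ D.dag.gPolytope F → gVec R ∈ F → gVec S ∈ F → ∀ T ∈ Y, gVec T ∈ F) :
    IsMinimalFace D.dag.gPolytope {gVec R, gVec S} (convexHull ℝ (gVec '' Y)) := by
  refine ⟨⟨hY.isExposed, ?_⟩, ?_⟩
  · rintro _ (rfl | rfl)
    · exact subset_convexHull ℝ _ ⟨R, hR, rfl⟩
    · exact subset_convexHull ℝ _ ⟨S, hS, rfl⟩
  · rintro F ⟨h1, h2⟩
    refine convexHull_min ?_ (h1.convex (convex_convexHull ℝ _))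
    rintro _ ⟨T, hT, rfl⟩
    exact h F h1 (h2 (by simp)) (h2 (by simp)) T hT

/-- Routes that lie on a leg and whose ends satisfy a condition. -/
def onLeg (p : Span D) (Q : ℕ → ℕ → Prop) : Set D.LabRoute :=
  {R | ∃ r : Span D, r.route = R ∧ p.SameLeg r ∧ Q r.u r.w}

theorem cut_congr {s e p : ℕ} {f g : ℕ → ℤ} (h : ∀ x, s < x → x < e + 2 → f x = g x) :
    cut s e f p = cut s e g p := by
  unfold cut; split_ifs with h1
  · exact h p h1.1 h1.2
  · rfl

theorem rise_eq_of {h : Fin D.numInner → ℤ} {r : Span D} {f : ℕ → ℤ}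
    (hf : ∀ x, r.s < x → x < r.e + 2 → h (D.vtx (x - 1)) = f x) :
    rise h r = cut r.s r.e f r.w - cut r.s r.e f r.u := by
  rw [rise, cut_congr hf, cut_congr hf]

/-- The bounds at the two end vertices are what `atEnds_le` requires for the other legs to stay
below the maximum. -/
theorem supported_onLeg (p : Span D) (φ : ℕ → ℤ) (Q : ℕ → ℕ → Prop)
    (hφ : ∀ a b, p.s ≤ a → a ≤ b → b ≤ p.e + 2 →
      cut p.s p.e φ b - cut p.s p.e φ a ≤ 6 ∧ (cut p.s p.e φ b - cut p.s p.e φ a = 6 ↔ Q a b))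
    (h1 : ∀ q : Span D, D.Next p.e q.s → -2 ≤ φ (p.e + 1))
    (h2 : ∀ q : Span D, D.Next q.e p.s → φ (p.s + 1) ≤ 2) :
    Supported (onLeg p Q) := by
  classical
  refine ⟨legFun D p.s p.e φ, ?_⟩
  have same : ∀ r : Span D, p.SameLeg r → rise (legFun D p.s p.e φ) r ≤ 6 ∧
      (rise (legFun D p.s p.e φ) r = 6 ↔ Q r.u r.w) := by
    rintro r ⟨hs, he⟩
    rw [rise_eq_of (f := φ) fun x hx hx' => legFun_same p.leg φ (hs ▸ hx) (he ▸ hx'), ← hs, ← he]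
    exact hφ _ _ (hs ▸ r.s_le) r.le (he ▸ r.le_e)
  have other : ∀ r : Span D, ¬ p.SameLeg r → rise (legFun D p.s p.e φ) r < 6 := by
    intro r hr
    rw [rise_eq_of fun x hx hx' => legFun_other p.leg r.leg hr φ hx hx']
    refine atEnds_le r.s_le r.le ?_ ?_
    · split_ifs with hn
      · exact Or.inr ⟨le_w_of_next hn, h1 r hn⟩
      · exact Or.inl rfl
    · split_ifs with hn
      · exact Or.inr ⟨u_le_e_of_next hn, h2 r hn⟩
      · exact Or.inl rfl
  intro r
  by_cases hr : p.SameLeg r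
  · refine ⟨(same r hr).1, fun h => ⟨r, rfl, hr, (same r hr).2.1 h⟩, ?_⟩
    rintro ⟨r', h3, h4, h5⟩
    rw [← rise_congr _ h3]
    exact (same r' h4).2.2 h5
  · refine ⟨(other r hr).le, fun h => absurd h (other r hr).ne, ?_⟩
    rintro ⟨r', h3, h4, h5⟩
    rw [← rise_congr _ h3]
    exact (same r' h4).2.2 h5

end Span

end LabShape

namespace LabShape

open FramedDag

variable {D : LabShape}

namespace Span

theorem lt_of_not_trivial {p : Span D} (h : ¬ Trivial p) : p.u < p.w ∧ ¬ (p.u = p.s ∧ p.w = p.e + 2) := by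
  have := p.le
  rw [Trivial, not_or] at h
  exact ⟨by omega, h.2⟩

/-! ### Pairs of coherent routes on a leg -/

theorem onLeg_pair {p q : Span D} (h : p.SameLeg q) (Q : ℕ → ℕ → Prop)
    (hQ : ∀ a b, Q a b ↔ (a = p.u ∧ b = p.w) ∨ (a = q.u ∧ b = q.w)) :
    onLeg p Q = {p.route, q.route} := by
  ext R
  constructor
  · rintro ⟨r, rfl, h1, h2⟩
    rcases (hQ _ _).1 h2 with ⟨h3, h4⟩ | ⟨h3, h4⟩
    · exact Or.inl (route_ext h1.symm h3 h4)
    · exact Or.inr (route_ext (h1.symm.trans h) h3 h4)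
  · rintro (rfl | rfl)
    · exact ⟨p, rfl, ⟨rfl, rfl⟩, (hQ _ _).2 (Or.inl ⟨rfl, rfl⟩)⟩
    · exact ⟨q, rfl, h, (hQ _ _).2 (Or.inr ⟨rfl, rfl⟩)⟩

theorem supported_single {p : Span D} (hp : ¬ Trivial p) : Supported {p.route} := by
  obtain ⟨a1, a2⟩ := lt_of_not_trivial hp
  have a3 := p.s_le; have a4 := p.le_e
  rw [← Set.pair_eq_singleton, ← onLeg_pair (p := p) ⟨rfl, rfl⟩ (fun a b => a = p.u ∧ b = p.w)
    (by tauto)]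
  refine supported_onLeg p (ramp p.s p.e p.u p.w) _ (fun a b h1 h2 h3 => ?_) (fun q hq => ?_)
    (fun q hq => ?_)
  · exact ramp_le a3 a1 a4 a2 h1 h2 h3
  · have := u_le_e_of_next hq
    simp only [ramp]; grind
  · have := le_w_of_next hq
    simp only [ramp]; grind

theorem supported_low {p q : Span D} (h : p.SameLeg q) (hp : ¬ Trivial p) (hq : ¬ Trivial q)
    (hu : p.u = q.u) (hw : p.w < q.w) : Supported {p.route, q.route} := by
  obtain ⟨a1, a2⟩ := lt_of_not_trivial hp
  obtain ⟨b1, b2⟩ := lt_of_not_trivial hq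
  have a3 := p.s_le; have a4 := p.le_e; have b3 := q.s_le; have b4 := q.le_e
  obtain ⟨hs, he⟩ := h
  rw [← onLeg_pair (p := p) ⟨hs, he⟩ (fun a b => a = p.u ∧ (b = p.w ∨ b = q.w)) (by grind)]
  refine supported_onLeg p (rampLow p.s p.e p.u p.w q.w) _ (fun a b h1 h2 h3 => ?_)
    (fun r hr => ?_) (fun r hr => ?_)
  · exact rampLow_le a3 a1 hw (by omega) (by omega) h1 h2 h3
  · have := u_le_e_of_next hr
    simp only [rampLow]; grind
  · have := le_w_of_next hr
    simp only [rampLow]; grind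

theorem supported_high {p q : Span D} (h : p.SameLeg q) (hp : ¬ Trivial p) (hq : ¬ Trivial q)
    (hw : p.w = q.w) (hu : p.u < q.u) : Supported {p.route, q.route} := by
  obtain ⟨a1, a2⟩ := lt_of_not_trivial hp
  obtain ⟨b1, b2⟩ := lt_of_not_trivial hq
  have a3 := p.s_le; have a4 := p.le_e; have b3 := q.s_le; have b4 := q.le_e
  obtain ⟨hs, he⟩ := h
  rw [← onLeg_pair (p := p) ⟨hs, he⟩ (fun a b => (a = p.u ∨ a = q.u) ∧ b = p.w) (by grind)]
  refine supported_onLeg p (rampHigh p.s p.e p.u q.u p.w) _ (fun a b h1 h2 h3 => ?_)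
    (fun r hr => ?_) (fun r hr => ?_)
  · exact rampHigh_le a3 hu (by omega) (by omega) (by omega) h1 h2 h3
  · have := u_le_e_of_next hr
    have : q.u ≤ q.e := u_le_e_of_next (he ▸ hr)
    simp only [rampHigh]; grind
  · have := le_w_of_next hr
    simp only [rampHigh]; grind

theorem supported_disjoint {p q : Span D} (h : p.SameLeg q) (hp : ¬ Trivial p) (hq : ¬ Trivial q)
    (hu : p.w < q.u) : Supported {p.route, q.route} := by
  obtain ⟨a1, a2⟩ := lt_of_not_trivial hp
  obtain ⟨b1, b2⟩ := lt_of_not_trivial hq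
  have a3 := p.s_le; have a4 := p.le_e; have b3 := q.s_le; have b4 := q.le_e
  obtain ⟨hs, he⟩ := h
  rw [← onLeg_pair (p := p) ⟨hs, he⟩ (fun a b => (a = p.u ∧ b = p.w) ∨ (a = q.u ∧ b = q.w))
    (by tauto)]
  refine supported_onLeg p (rampTwo p.s p.e p.u p.w q.u q.w) _ (fun a b h1 h2 h3 => ?_)
    (fun r hr => ?_) (fun r hr => ?_)
  · exact rampTwo_le a3 a1 hu b1 (by omega) h1 h2 h3
  · have := u_le_e_of_next hr
    have : q.u ≤ q.e := u_le_e_of_next (he ▸ hr)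
    simp only [rampTwo, ramp]; grind
  · have := le_w_of_next hr
    have : q.s + 2 ≤ q.w := le_w_of_next (hs ▸ hr)
    simp only [rampTwo, ramp]; grind

/-- Two intervals on a leg that neither cross nor are strictly nested have a common endpoint or are
disjoint. -/
theorem supported_sameLeg {p q : Span D} (h : p.SameLeg q) (hp : ¬ Trivial p) (hq : ¬ Trivial q)
    (hc : ¬ (Clash p q ∨ Clash q p)) (hn : ¬ (Nested p q ∨ Nested q p)) :
    Supported {p.route, q.route} := by
  have h' := h.symm
  obtain ⟨a1, a2⟩ := lt_of_not_trivial hp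
  obtain ⟨b1, b2⟩ := lt_of_not_trivial hq
  rcases lt_trichotomy p.u q.u with hu | hu | hu <;> rcases lt_trichotomy p.w q.w with hw | hw | hw
  · by_cases hd : p.w < q.u
    · exact supported_disjoint h hp hq hd
    · exact (hc (Or.inl (Or.inl ⟨h.1, h.2, hu, by omega, hw⟩))).elim
  · exact supported_high h hp hq hw hu
  · exact (hn (Or.inr (Or.inl ⟨h', hu, hw⟩))).elim
  · exact supported_low h hp hq hu hw
  · rw [route_ext h hu hw, Set.pair_eq_singleton]; exact supported_single hq
  · rw [Set.pair_comm]; exact supported_low h' hq hp hu.symm hw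
  · exact (hn (Or.inl (Or.inl ⟨h, hu, hw⟩))).elim
  · rw [Set.pair_comm]; exact supported_high h' hq hp hw.symm hu
  · by_cases hd : q.w < p.u
    · rw [Set.pair_comm]; exact supported_disjoint h' hq hp hd
    · exact (hc (Or.inr (Or.inl ⟨h'.1, h'.2, hu, by omega, hw⟩))).elim

/-! ### Pairs of coherent routes on different legs -/

/-- A ramp is visible beyond its leg only for `j = e + 2` and `j = e + 1`, with different signs;
these are the cases relevant to nesting and to conflict at the junction. -/
theorem ramp_last {s e i j : ℕ} (h2 : i ≤ e) (h4 : j ≤ e + 2)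
    (h : ¬ (i = s ∧ j = e + 2)) :
    ramp s e i j (e + 1) = 0 ∨ (j = e + 2 ∧ ramp s e i j (e + 1) = -2) ∨
      (j = e + 1 ∧ (ramp s e i j (e + 1) = 3 ∨ ramp s e i j (e + 1) = 6)) := by
  simp only [ramp]; grind

theorem ramp_first {s e i j : ℕ} (h1 : s ≤ i) (h2 : s + 2 ≤ j) :
    ramp s e i j (s + 1) = 0 ∨ (i = s ∧ ramp s e i j (s + 1) = 2) ∨
      (i = s + 1 ∧ (ramp s e i j (s + 1) = -3 ∨ ramp s e i j (s + 1) = -6)) := by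
  simp only [ramp]; grind

theorem join_comm (a b : ℤ) : join a b = join b a := by
  rw [join, join, max_comm a b, min_comm a b]

/-- At a junction the two ramps have opposite signs only if the routes are nested or in conflict
there. Otherwise `join` takes the height of larger absolute value, whereas the sum could exceed the
maximum. -/
theorem rise_join_same {p q r : Span D} (h : ¬ p.SameLeg q) (hp : ¬ Trivial p) (hq : ¬ Trivial q)
    (hc : ¬ (Clash p q ∨ Clash q p)) (hn : ¬ (Nested p q ∨ Nested q p)) (hr : p.SameLeg r) :
    let f := fun v => join (legFun D p.s p.e (ramp p.s p.e p.u p.w) v)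
      (legFun D q.s q.e (ramp q.s q.e q.u q.w) v)
    rise f r ≤ 6 ∧ (rise f r = 6 ↔ r.u = p.u ∧ r.w = p.w) := by
  classical
  intro f
  obtain ⟨a1, a2⟩ := lt_of_not_trivial hp
  obtain ⟨b1, b2⟩ := lt_of_not_trivial hq
  have hqp : ¬ (q.s = p.s ∧ q.e = p.e) := fun h' => h ⟨h'.1.symm, h'.2.symm⟩
  obtain ⟨hs, he⟩ := hr
  rw [rise_eq_of (f := fun x => join (ramp p.s p.e p.u p.w x) (atEnds p.s p.e
      (if D.Next q.e p.s then ramp q.s q.e q.u q.w (q.e + 1) else 0)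
      (if D.Next p.e q.s then ramp q.s q.e q.u q.w (q.s + 1) else 0) x)), ← hs, ← he]
  · rw [not_or] at hc hn
    refine join_ramp_le p.leg.lt p.s_le a1 p.le_e a2 (hs ▸ r.s_le) r.le (he ▸ r.le_e) ?_ ?_ ?_
    · split_ifs with hx
      · have k1 : r.s + 2 ≤ r.w := le_w_of_next (p := q) (hs ▸ hx)
        have k2 : p.u = p.s → q.w ≠ q.e + 2 := fun k k' => hn.2 (Or.inr ⟨hx, k', k⟩)
        have k3 : p.u = p.s + 1 → q.w ≠ q.e + 1 := fun k k' => hc.2 (Or.inr ⟨hx, k', k⟩)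
        rcases ramp_last (u_le_e_of_next hx) q.le_e b2 with k | ⟨k, k'⟩ | ⟨k, k'⟩
        · exact Or.inl k
        · exact Or.inr ⟨by omega, Or.inl ⟨k', fun k4 => k2 k4 k⟩⟩
        · exact Or.inr ⟨by omega, Or.inr ⟨k', fun k4 => k3 k4 k⟩⟩
      · exact Or.inl rfl
    · split_ifs with hx
      · have k1 : r.u ≤ r.e := u_le_e_of_next (q := q) (he ▸ hx)
        have k2 : q.u = q.s → p.w ≠ p.e + 2 := fun k k' => hn.1 (Or.inr ⟨hx, k', k⟩)
        have k3 : q.u = q.s + 1 → p.w ≠ p.e + 1 := fun k k' => hc.1 (Or.inr ⟨hx, k', k⟩)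
        rcases ramp_first (e := q.e) q.s_le (le_w_of_next hx) with k | ⟨k, k'⟩ | ⟨k, k'⟩
        · exact Or.inl k
        · exact Or.inr ⟨by omega, Or.inl ⟨k', k2 k⟩⟩
        · exact Or.inr ⟨by omega, Or.inr ⟨k', k3 k⟩⟩
      · exact Or.inl rfl
    · rintro ⟨k1, k2⟩
      split_ifs at k1 with hx
      split_ifs at k2 with hx'
      swap
      · omega
      rcases ramp_last (u_le_e_of_next hx) q.le_e b2 with k | ⟨k, k'⟩ | ⟨k, k'⟩ <;>
      rcases ramp_first (e := q.e) q.s_le (le_w_of_next hx') with l | ⟨l, l'⟩ | ⟨l, l'⟩ <;> omega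
  · intro x hx hx'
    simp only [f]
    rw [legFun_same p.leg _ (hs ▸ hx) (he ▸ hx'), legFun_other q.leg p.leg hqp _ (hs ▸ hx) (he ▸ hx')]

theorem supported_pair {p q : Span D} (hp : ¬ Trivial p) (hq : ¬ Trivial q)
    (hc : ¬ (Clash p q ∨ Clash q p)) (hn : ¬ (Nested p q ∨ Nested q p)) :
    Supported {p.route, q.route} := by
  classical
  by_cases h : p.SameLeg q
  · exact supported_sameLeg h hp hq hc hn
  have h' : ¬ q.SameLeg p := fun h' => h h'.symm
  obtain ⟨a1, a2⟩ := lt_of_not_trivial hp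
  obtain ⟨b1, b2⟩ := lt_of_not_trivial hq
  let f := fun v => join (legFun D p.s p.e (ramp p.s p.e p.u p.w) v)
      (legFun D q.s q.e (ramp q.s q.e q.u q.w) v)
  have fp : ∀ r : Span D, p.SameLeg r → rise f r ≤ 6 ∧ (rise f r = 6 ↔ r.u = p.u ∧ r.w = p.w) :=
    fun r hr => rise_join_same h hp hq hc hn hr
  have fq : ∀ r : Span D, q.SameLeg r → rise f r ≤ 6 ∧ (rise f r = 6 ↔ r.u = q.u ∧ r.w = q.w) := by
    intro r hr
    have := rise_join_same h' hq hp (fun k => hc k.symm) (fun k => hn k.symm) hr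
    simp only [join_comm (legFun D q.s q.e _ _)] at this
    exact this
  have fo : ∀ r : Span D, ¬ p.SameLeg r → ¬ q.SameLeg r → rise f r < 6 := by
    intro r hr hr'
    have hpl := fun k => ramp_last (i := p.u) k p.le_e a2
    have hql := fun k => ramp_last (i := q.u) k q.le_e b2
    have hpf := fun k => ramp_first (e := p.e) (j := p.w) p.s_le k
    have hqf := fun k => ramp_first (e := q.e) (j := q.w) q.s_le k
    rw [rise_eq_of (f := atEnds r.s r.e
      (join (if D.Next p.e r.s then ramp p.s p.e p.u p.w (p.e + 1) else 0)
        (if D.Next q.e r.s then ramp q.s q.e q.u q.w (q.e + 1) else 0))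
      (join (if D.Next r.e p.s then ramp p.s p.e p.u p.w (p.s + 1) else 0)
        (if D.Next r.e q.s then ramp q.s q.e q.u q.w (q.s + 1) else 0)))]
    · refine atEnds_le r.s_le r.le ?_ ?_
      · by_cases hx : D.Next p.e r.s
        · have k1 := hpl (u_le_e_of_next hx)
          refine Or.inr ⟨le_w_of_next hx, ?_⟩
          rw [if_pos hx, join]
          split_ifs with hx'
          · have k2 := hql (u_le_e_of_next hx')
            omega
          · omega
        · rw [if_neg hx, join]
          split_ifs with hx'
          · have k2 := hql (u_le_e_of_next hx')
            exact Or.inr ⟨le_w_of_next hx', by omega⟩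
          · exact Or.inl (by simp)
      · by_cases hx : D.Next r.e p.s
        · have k1 := hpf (le_w_of_next hx)
          refine Or.inr ⟨u_le_e_of_next hx, ?_⟩
          rw [if_pos hx, join]
          split_ifs with hx'
          · have k2 := hqf (le_w_of_next hx')
            omega
          · omega
        · rw [if_neg hx, join]
          split_ifs with hx'
          · have k2 := hqf (le_w_of_next hx')
            exact Or.inr ⟨u_le_e_of_next hx', by omega⟩
          · exact Or.inl (by simp)
    · intro x hx hx'
      simp only [f]
      rw [legFun_other p.leg r.leg hr _ hx hx', legFun_other q.leg r.leg hr' _ hx hx']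
      simp only [atEnds]; split_ifs <;> simp [join]
  refine ⟨f, fun r => ?_⟩
  have back : r.route ∈ ({p.route, q.route} : Set D.LabRoute) → rise f r = 6 := by
    rintro (hr | hr)
    · rw [rise_congr f hr]; exact (fp p ⟨rfl, rfl⟩).2.2 ⟨rfl, rfl⟩
    · rw [rise_congr f hr]; exact (fq q ⟨rfl, rfl⟩).2.2 ⟨rfl, rfl⟩
  by_cases hr : p.SameLeg r
  · refine ⟨(fp r hr).1, fun k => Or.inl ?_, back⟩
    obtain ⟨k1, k2⟩ := (fp r hr).2.1 k
    exact route_ext hr.symm k1 k2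
  by_cases hr' : q.SameLeg r
  · refine ⟨(fq r hr').1, fun k => Or.inr ?_, back⟩
    obtain ⟨k1, k2⟩ := (fq r hr').2.1 k
    exact route_ext hr'.symm k1 k2
  · exact ⟨(fo r hr hr').le, fun k => absurd k (fo r hr hr').ne, back⟩

end Span

end LabShape

namespace LabShape

open FramedDag

variable {D : LabShape}

namespace Span

/-! ### Arrays of conflicting routes -/

theorem supported_corner_sameLeg {p q t t' : Span D} (h : p.SameLeg q) (h2 : p.SameLeg t)
    (h3 : p.SameLeg t') (hu : p.u < q.u) (hw : p.w < q.w) (tu : t.u = q.u) (tw : t.w = p.w)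
    (tu' : t'.u = p.u) (tw' : t'.w = q.w) (ht : ¬ Trivial t) (ht' : ¬ Trivial t') :
    Supported {p.route, q.route, t.route, t'.route} := by
  obtain ⟨a1, -⟩ := lt_of_not_trivial ht
  obtain ⟨-, b2⟩ := lt_of_not_trivial ht'
  have a3 := p.s_le; have a4 := p.le_e; have b3 := q.s_le; have b4 := q.le_e
  have hY : onLeg p (fun a b => (a = p.u ∨ a = q.u) ∧ (b = p.w ∨ b = q.w)) =
      {p.route, q.route, t.route, t'.route} := by
    ext R
    constructor
    · rintro ⟨r, rfl, k, k1 | k1, k2 | k2⟩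
      · exact Or.inl (route_ext k.symm k1 k2)
      · exact Or.inr (Or.inr (Or.inr (route_ext (k.symm.trans h3) (by omega) (by omega))))
      · exact Or.inr (Or.inr (Or.inl (route_ext (k.symm.trans h2) (by omega) (by omega))))
      · exact Or.inr (Or.inl (route_ext (k.symm.trans h) k1 k2))
    · rintro (rfl | rfl | rfl | rfl)
      · exact ⟨p, rfl, ⟨rfl, rfl⟩, Or.inl rfl, Or.inl rfl⟩
      · exact ⟨q, rfl, h, Or.inr rfl, Or.inr rfl⟩
      · exact ⟨t, rfl, h2, Or.inr tu, Or.inl tw⟩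
      · exact ⟨t', rfl, h3, Or.inl tu', Or.inr tw'⟩
  obtain ⟨hs, he⟩ := h
  obtain ⟨hs3, he3⟩ := h3
  rw [← hY]
  refine supported_onLeg p (rampCross p.s p.e p.u q.u p.w q.w) _ (fun a b h1 h2 h3 => ?_)
    (fun r hr => ?_) (fun r hr => ?_)
  · exact rampCross_le a3 hu (by omega) hw (by omega) (by omega) h1 h2 h3
  · have := u_le_e_of_next hr
    have : q.u ≤ q.e := u_le_e_of_next (he ▸ hr)
    simp only [rampCross]; grind
  · have := le_w_of_next hr
    simp only [rampCross]; grind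

/-- The height is the sum of one function for each leg, both zero at the junction. In a cycle with
two legs they meet again at the other junction, where `-6` and `6` would cancel if `p.u = p.s + 1`
and `q.w = q.e + 1`; then both routes are extreme, which `ha` excludes. -/
theorem supported_corner_next {p q t t' : Span D} (h : D.Next p.e q.s) (pw : p.w = p.e + 1)
    (qu : q.u = q.s + 1) (h2 : p.SameLeg t) (tu : t.u = p.u) (tw : t.w = p.e + 2)
    (h3 : q.SameLeg t') (tu' : t'.u = q.s) (tw' : t'.w = q.w) (ht : ¬ Trivial t)
    (ht' : ¬ Trivial t') (ha : ¬ (TwoLegs D ∧ Extreme p ∧ Extreme q)) :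
    Supported {p.route, q.route, t.route, t'.route} := by
  classical
  have a1 := lt_of_not_trivial ht
  have a2 := lt_of_not_trivial ht'
  have a3 := p.s_le; have a4 := p.le_e; have b3 := q.s_le; have b4 := q.le_e
  have a5 := u_le_e_of_next h; have b5 := le_w_of_next h
  have a6 := h2.1; have a7 := h2.2; have b6 := h3.1; have b7 := h3.2
  have hpq : ¬ (p.s = q.s ∧ p.e = q.e) := fun k => not_next_same k h
  have hqp : ¬ (q.s = p.s ∧ q.e = p.e) := fun k => hpq ⟨k.1.symm, k.2.symm⟩
  have hx : D.Next q.e p.s → ¬ (p.u = p.s + 1 ∧ q.w = q.e + 1) := fun k k' =>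
    ha ⟨twoLegs_of_next h k, ⟨by omega, by omega⟩, ⟨by omega, by omega⟩⟩
  have e1 : upLow p.e p.u (p.e + 1) = 0 := by
    rw [upLow, if_neg (by omega), if_neg (by omega)]
  have e2 : upHigh q.s q.w (q.s + 1) = 0 := by
    rw [upHigh, if_neg (by omega), if_neg (by omega)]
  have e3 : (upLow p.e p.u (p.s + 1) = 0) ∨ (p.u = p.s + 1 ∧ upLow p.e p.u (p.s + 1) = -6) := by
    simp only [upLow]; grind
  have e4 : (upHigh q.s q.w (q.e + 1) = 0) ∨ (q.w = q.e + 1 ∧ upHigh q.s q.w (q.e + 1) = 6) := by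
    simp only [upHigh]; grind
  let f := fun v => legFun D p.s p.e (upLow p.e p.u) v + legFun D q.s q.e (upHigh q.s q.w) v
  have fp : ∀ r : Span D, p.SameLeg r → rise f r ≤ 6 ∧
      (rise f r = 6 ↔ r.u = p.u ∧ (r.w = p.e + 1 ∨ r.w = p.e + 2)) := by
    rintro r ⟨hs, he⟩
    rw [rise_eq_of (f := fun x => upLow p.e p.u x + atEnds p.s p.e
      (if D.Next q.e p.s then upHigh q.s q.w (q.e + 1) else 0) 0 x), ← hs, ← he]
    · refine upLow_le p.leg.lt (by omega) a5 (hs ▸ r.s_le) r.le (he ▸ r.le_e) ?_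
      split_ifs with hn
      · have : r.s + 2 ≤ r.w := le_w_of_next (p := q) (hs ▸ hn)
        have := hx hn
        omega
      · exact Or.inl rfl
    · intro x k k'
      simp only [f]
      rw [legFun_same p.leg _ (hs ▸ k) (he ▸ k'), legFun_other q.leg p.leg hqp _ (hs ▸ k) (he ▸ k'),
        e2, ite_self]
  have fq : ∀ r : Span D, q.SameLeg r → rise f r ≤ 6 ∧
      (rise f r = 6 ↔ (r.u = q.s ∨ r.u = q.s + 1) ∧ r.w = q.w) := by
    rintro r ⟨hs, he⟩
    rw [rise_eq_of (f := fun x => upHigh q.s q.w x + atEnds q.s q.e 0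
      (if D.Next q.e p.s then upLow p.e p.u (p.s + 1) else 0) x), ← hs, ← he]
    · refine upHigh_le q.leg.lt b5 (by omega) (hs ▸ r.s_le) r.le (he ▸ r.le_e) ?_
      split_ifs with hn
      · have : r.u ≤ r.e := u_le_e_of_next (q := p) (he ▸ hn)
        have := hx hn
        omega
      · exact Or.inl rfl
    · intro x k k'
      simp only [f]
      rw [legFun_same q.leg _ (hs ▸ k) (he ▸ k'), legFun_other p.leg q.leg hpq _ (hs ▸ k) (he ▸ k'),
        e1, ite_self, add_comm]
  have fo : ∀ r : Span D, ¬ p.SameLeg r → ¬ q.SameLeg r → rise f r < 6 := by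
    intro r hr hr'
    rw [rise_eq_of (f := atEnds r.s r.e
      (if D.Next q.e r.s then upHigh q.s q.w (q.e + 1) else 0)
      (if D.Next r.e p.s then upLow p.e p.u (p.s + 1) else 0))]
    · refine atEnds_le r.s_le r.le ?_ ?_
      · split_ifs with hn
        · exact Or.inr ⟨le_w_of_next hn, by omega⟩
        · exact Or.inl rfl
      · split_ifs with hn
        · exact Or.inr ⟨u_le_e_of_next hn, by omega⟩
        · exact Or.inl rfl
    · intro x k k'
      simp only [f]
      rw [legFun_other p.leg r.leg hr _ k k', legFun_other q.leg r.leg hr' _ k k', e1, e2,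
        ite_self, ite_self]
      simp only [atEnds]
      split_ifs <;> omega
  refine ⟨f, fun r => ?_⟩
  have back : r.route ∈ ({p.route, q.route, t.route, t'.route} : Set D.LabRoute) →
      rise f r = 6 := by
    rintro (hr | hr | hr | hr) <;> rw [rise_congr f hr]
    · exact (fp p ⟨rfl, rfl⟩).2.2 ⟨rfl, Or.inl pw⟩
    · exact (fq q ⟨rfl, rfl⟩).2.2 ⟨Or.inr qu, rfl⟩
    · exact (fp t h2).2.2 ⟨tu, Or.inr tw⟩
    · exact (fq t' h3).2.2 ⟨Or.inl tu', tw'⟩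
  by_cases hr : p.SameLeg r
  · refine ⟨(fp r hr).1, fun k => ?_, back⟩
    obtain ⟨k1, k2 | k2⟩ := (fp r hr).2.1 k
    · exact Or.inl (route_ext hr.symm k1 (by omega))
    · exact Or.inr (Or.inr (Or.inl (route_ext (hr.symm.trans h2) (by omega) (by omega))))
  by_cases hr' : q.SameLeg r
  · refine ⟨(fq r hr').1, fun k => ?_, back⟩
    obtain ⟨k1 | k1, k2⟩ := (fq r hr').2.1 k
    · exact Or.inr (Or.inr (Or.inr (route_ext (hr'.symm.trans h3) (by omega) (by omega))))
    · exact Or.inr (Or.inl (route_ext hr'.symm (by omega) k2))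
  · exact ⟨(fo r hr hr').le, fun k => absurd k (fo r hr hr').ne, back⟩

theorem supported_corner {p q t t' : Span D} (h : Corner p q t t') (ht : ¬ Trivial t)
    (ht' : ¬ Trivial t') (ha : ¬ (TwoLegs D ∧ Extreme p ∧ Extreme q)) :
    Supported {p.route, q.route, t.route, t'.route} := by
  rcases h with ⟨h1, h2, h3, h4, h5, h6, h7, h8, h9⟩ | ⟨h1, h2, h3, h4, h5, h6, h7, h8, h9⟩
  · exact supported_corner_sameLeg h1 h2 h3 h4 h5 h6 h7 h8 h9 ht ht'
  · exact supported_corner_next h1 h2 h3 h4 h5 h6 h7 h8 h9 ht ht' ha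

/-! ### Minimal faces -/

theorem mem_face {p q t t' : Span D} {F : Set (Fin D.numInner → ℝ)}
    (hF : IsExposed ℝ D.dag.gPolytope F) (hp : gVec p.route ∈ F) (hq : gVec q.route ∈ F)
    (h : gVec p.route + gVec q.route = gVec t.route + gVec t'.route) :
    gVec t.route ∈ F ∧ gVec t'.route ∈ F :=
  ⟨hF.mem_of_add_eq hp hq (gVec_mem_gPolytope _) (gVec_mem_gPolytope _) h,
    hF.mem_of_add_eq hp hq (gVec_mem_gPolytope _) (gVec_mem_gPolytope _)
      (h.trans (add_comm _ _))⟩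

theorem gVec_injective {p q : Span D} (hp : ¬ Trivial p) (h : gVec q.route = gVec p.route) :
    q.route = p.route :=
  ((supported_single hp).mem_iff q.route).1 ⟨_, rfl, h.symm⟩

theorem isMinimalFace_segment {p q : Span D} (h : Supported {p.route, q.route}) :
    IsMinimalFace D.dag.gPolytope {gVec p.route, gVec q.route}
      (segment ℝ (gVec p.route) (gVec q.route)) := by
  have e : convexHull ℝ (gVec '' {p.route, q.route}) =
      segment ℝ (gVec p.route) (gVec q.route) := by rw [Set.image_pair, convexHull_pair]
  rw [← e]
  refine h.isMinimalFace (Or.inl rfl) (Or.inr rfl) ?_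
  rintro F - h1 h2 T (rfl | rfl)
  · exact h1
  · exact h2

theorem isEdge_of_supported {p q : Span D} (h : Supported {p.route, q.route})
    (hp : ¬ Trivial p) (hne : p.route ≠ q.route) :
    IsEdge D.dag.gPolytope (gVec p.route) (gVec q.route) :=
  ⟨fun k => hne (gVec_injective hp k.symm).symm, (isMinimalFace_segment h).1.1⟩

theorem exists_facet {p : Span D} (hp : ¬ Trivial p) :
    ∃ F, IsFacet D.dag.gPolytope F ∧ gVec p.route ∈ F := by
  have h := (supported_single hp).isExposed
  rw [Set.image_singleton, convexHull_singleton] at h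
  obtain ⟨F, h1, h2⟩ := exists_isFacet finite_range_gVec h (by
    rw [← segment_same ℝ (gVec p.route)]; exact segment_ne_gPolytope _ _)
  exact ⟨F, h1, h2 rfl⟩

/-- If the segment were a face, it would contain the `g`-vector of `t`. By coherence no `g`-vector
lies strictly inside the segment, and by injectivity `t` would be one of the two routes. Injectivity
applies because an exceptional end would put the origin on a proper face. -/
theorem not_isEdge {p q t t' : Span D} (hc : Coherent p.route q.route)
    (h : gVec p.route + gVec q.route = gVec t.route + gVec t'.route)
    (hp : t.route ≠ p.route) (hq : t.route ≠ q.route) :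
    ¬ IsEdge D.dag.gPolytope (gVec p.route) (gVec q.route) := by
  rintro ⟨-, hF⟩
  have mp := left_mem_segment ℝ (gVec p.route) (gVec q.route)
  have mq := right_mem_segment ℝ (gVec p.route) (gVec q.route)
  have mt := (mem_face hF mp mq h).1
  have key : ∀ r : Span D, gVec r.route ∈ segment ℝ (gVec p.route) (gVec q.route) →
      ¬ Trivial r := by
    intro r hr htr
    rw [htr.gVec_eq_zero] at hr
    exact segment_ne_gPolytope _ _ (eq_gPolytope_of_zero_mem hF hr)
  rcases eq_or_eq_of_mem_segment (gVec_mem_values _) (gVec_mem_values _) (gVec_mem_values _)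
    (gVec_mul_nonneg hc) mt with k | k
  · exact hp (gVec_injective (key p mp) k)
  · exact hq (gVec_injective (key q mq) k)

/-- For extreme routes one corner is a whole leg, hence has `g`-vector `0`, with one exception: both
routes change label at both junctions. -/
theorem zero_mem_of_extreme {p q : Span D} (h2 : TwoLegs D) (hp : Extreme p) (hq : Extreme q)
    (hc : Clash p q) {F : Set (Fin D.numInner → ℝ)} (hF : IsExposed ℝ D.dag.gPolytope F)
    (mp : gVec p.route ∈ F) (mq : gVec q.route ∈ F) : 0 ∈ F := by
  obtain ⟨p1, p2⟩ := hp
  obtain ⟨q1, q2⟩ := hq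
  have a1 := p.s_le; have a2 := p.le_e; have b1 := q.s_le; have b2 := q.le_e
  have a3 := p.leg.lt
  obtain ⟨t, t', h⟩ := exists_corner hc
  obtain ⟨m, m'⟩ := mem_face hF mp mq h.gVec_add
  have key : Trivial t ∨ Trivial t' → 0 ∈ F := by
    rintro (k | k)
    · rwa [k.gVec_eq_zero] at m
    · rwa [k.gVec_eq_zero] at m'
  rcases h with ⟨⟨c1, c2⟩, -, ⟨c3, c4⟩, h1, h2, -, -, h3, h4⟩ |
    ⟨h1, h3, h4, ⟨c1, c2⟩, h5, h6, ⟨c3, c4⟩, h7, h8⟩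
  · exact key (Or.inr (Or.inr ⟨by omega, by omega⟩))
  · by_cases k : p.u = p.s
    · exact key (Or.inl (Or.inr ⟨by omega, by omega⟩))
    by_cases k' : q.w = q.e + 2
    · exact key (Or.inr (Or.inr ⟨by omega, by omega⟩))
    have hn : D.Next q.e p.s := by
      rcases p.leg.next_of_length_eq_two q.leg h2.1 h2.2 with l | l
      · exact (not_next_same l h1).elim
      · exact l.2
    let z : Span D := ⟨p.s, p.e, p.s, p.e + 2, p.leg, le_rfl, by omega, le_rfl, Or.inl (by omega)⟩
    have hz : gVec z.route = 0 := Trivial.gVec_eq_zero (p := z) (Or.inr ⟨rfl, rfl⟩)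
    -- In the exceptional case the two `g`-vectors are opposite, since the upper end of each leg is
    -- the lower end of the other.
    have hsum : gVec p.route + gVec q.route = gVec z.route + gVec z.route := by
      rw [hz, gVec_route, gVec_route, h3, h4, show p.u = p.s + 1 by omega,
        show q.w = q.e + 1 by omega, pt_next p.leg q.leg h1, pt_next q.leg p.leg hn]
      abel
    rw [← hz]
    exact (mem_face hF mp mq hsum).1

/-- On one leg the outer interval would be the whole leg. If extreme, non-exceptional routes are
nested at one junction, then both change label at the other, and this is a conflict. -/
theorem not_nested_of_extreme {p q : Span D} (h2 : TwoLegs D) (hp : Extreme p) (hq : Extreme q)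
    (tp : ¬ Trivial p) (tq : ¬ Trivial q) (hc : ¬ Clash q p) : ¬ Nested p q := by
  obtain ⟨p1, p2⟩ := hp
  obtain ⟨q1, q2⟩ := hq
  have a1 := p.s_le; have a2 := p.le_e; have b1 := q.s_le; have b2 := q.le_e
  obtain ⟨-, a3⟩ := lt_of_not_trivial tp
  obtain ⟨-, b3⟩ := lt_of_not_trivial tq
  rintro (⟨⟨h1, h3⟩, h4, h5⟩ | ⟨h1, h3, h4⟩)
  · omega
  · rcases p.leg.next_of_length_eq_two q.leg h2.1 h2.2 with l | l
    · exact not_next_same l h1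
    · exact hc (Or.inr ⟨l.2, by omega, by omega⟩)

/-- An exceptional corner puts the origin on every face with both routes. Otherwise the supporting
height bounds the minimal face from above and the identity of `g`-vectors bounds it from below. -/
theorem array_faces {p q t₁ t₂ : Span D} (h : D.IsArray p.route q.route t₁.route t₂.route)
    (ha : ¬ (TwoLegs D ∧ Extreme p ∧ Extreme q)) :
    (Trivial t₁ ∨ Trivial t₂ →
      (∃ F, IsFacet D.dag.gPolytope F ∧ gVec p.route ∈ F) ∧
      (∃ F, IsFacet D.dag.gPolytope F ∧ gVec q.route ∈ F) ∧
      (¬ ∃ F, IsFacet D.dag.gPolytope F ∧ gVec p.route ∈ F ∧ gVec q.route ∈ F) ∧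
      IsMinimalFace D.dag.gPolytope {gVec p.route, gVec q.route} D.dag.gPolytope) ∧
    (¬ (Trivial t₁ ∨ Trivial t₂) →
      IsMinimalFace D.dag.gPolytope {gVec p.route, gVec q.route}
        (convexHull ℝ (gVec '' {p.route, q.route, t₁.route, t₂.route}))) := by
  have key : ∀ t t' : Span D, Corner p q t t' →
      (Trivial t ∨ Trivial t' →
        (∃ F, IsFacet D.dag.gPolytope F ∧ gVec p.route ∈ F) ∧
        (∃ F, IsFacet D.dag.gPolytope F ∧ gVec q.route ∈ F) ∧
        (¬ ∃ F, IsFacet D.dag.gPolytope F ∧ gVec p.route ∈ F ∧ gVec q.route ∈ F) ∧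
        IsMinimalFace D.dag.gPolytope {gVec p.route, gVec q.route} D.dag.gPolytope) ∧
      (¬ (Trivial t ∨ Trivial t') →
        IsMinimalFace D.dag.gPolytope {gVec p.route, gVec q.route}
          (convexHull ℝ (gVec '' {p.route, q.route, t.route, t'.route}))) := by
    intro t t' hc
    have hcl := hc.clash
    have np : ¬ Trivial p := fun k => k.not_clash q (Or.inl hcl)
    have nq : ¬ Trivial q := fun k => k.not_clash p (Or.inr hcl)
    constructor
    · intro ht
      have h0 : ∀ F, IsExposed ℝ D.dag.gPolytope F → gVec p.route ∈ F → gVec q.route ∈ F →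
          0 ∈ F := by
        intro F hF mp mq
        obtain ⟨m, m'⟩ := mem_face hF mp mq hc.gVec_add
        rcases ht with ht | ht
        · rwa [ht.gVec_eq_zero] at m
        · rwa [ht.gVec_eq_zero] at m'
      refine ⟨exists_facet np, exists_facet nq, ?_, isMinimalFace_gPolytope h0⟩
      rintro ⟨F, hF, mp, mq⟩
      exact hF.1.2 (eq_gPolytope_of_zero_mem hF.1.1 (h0 F hF.1.1 mp mq))
    · intro ht
      rw [not_or] at ht
      refine (supported_corner hc ht.1 ht.2 ha).isMinimalFace (by simp) (by simp) ?_
      intro F hF mp mq T hT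
      obtain ⟨m, m'⟩ := mem_face hF mp mq hc.gVec_add
      rcases hT with rfl | rfl | rfl | rfl
      · exact mp
      · exact mq
      · exact m
      · exact m'
  rcases corner_of_isArray h with h | h | ⟨h1, h2, h3, -⟩
  · exact key t₁ t₂ h
  · have := key t₂ t₁ h
    rw [Set.pair_comm t₂.route t₁.route, or_comm] at this
    exact this
  · exact (ha ⟨h1, h2, h3⟩).elim

end Span

end LabShape

/-! ### Assembly of the Coherence Lemma -/

namespace LabShape

open FramedDag

variable {D : LabShape}

namespace Span

theorem conflict_comm (p q : Span D) : Conflict q.route p.route ↔ Conflict p.route q.route := by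
  rw [conflict_iff, conflict_iff, or_comm]

theorem not_conflict_not_isEdge {p q : Span D} (ha : ¬ (TwoLegs D ∧ Extreme p ∧ Extreme q))
    (h : q.route ∈ D.NE p.route ∪ D.SW p.route) : ¬ Conflict q.route p.route ∧
      ¬ IsEdge D.dag.gPolytope (gVec p.route) (gVec q.route) := by
  obtain ⟨t, t', hn, htp, htq⟩ := nestCorner_of_mem h ha
  have hc : ¬ Conflict p.route q.route := by
    rw [conflict_iff]
    rcases hn with hn | hn
    · exact not_clash_of_nested hn.nested ha
    · rw [or_comm]
      exact not_clash_of_nested hn.nested fun k => ha ⟨k.1, k.2.2, k.2.1⟩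
  refine ⟨(conflict_comm p q).not.2 hc, not_isEdge (t := t) (t' := t') hc ?_ htp htq⟩
  rcases hn with hn | hn
  · exact hn.gVec_add
  · rw [add_comm]; exact hn.gVec_add

theorem not_mem_iff (p q : Span D) :
    q.route ∉ D.NW p.route ∪ D.NE p.route ∪ D.SE p.route ∪ D.SW p.route ↔
      ¬ Conflict q.route p.route ∧ q.route ∉ D.NE p.route ∪ D.SW p.route := by
  rw [conflict_comm, conflict_iff, ← mem_NW_union_SE_iff]
  simp only [Set.mem_union, not_or]
  constructor
  · rintro ⟨⟨⟨h1, h2⟩, h3⟩, h4⟩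
    exact ⟨⟨h1, h3⟩, h2, h4⟩
  · rintro ⟨⟨h1, h3⟩, h2, h4⟩
    exact ⟨⟨⟨h1, h2⟩, h3⟩, h4⟩

theorem isEdge_of_not_mem {p q : Span D} (hne : p.route ≠ q.route) (hp : ¬ Trivial p)
    (hq : ¬ Trivial q) (hc : ¬ Conflict q.route p.route)
    (hnn : q.route ∉ D.NE p.route ∪ D.SW p.route) :
    IsEdge D.dag.gPolytope (gVec p.route) (gVec q.route) := by
  refine isEdge_of_supported (supported_pair hp hq ?_ ?_) hp hne
  · rwa [← conflict_iff, ← conflict_comm]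
  · rintro (h | h)
    · exact hnn (mem_of_nested h)
    · rcases mem_of_nested h with h | h
      · exact hnn (Or.inr ((mem_SW_iff_NE _ _).2 h))
      · exact hnn (Or.inl ((mem_SW_iff_NE _ _).1 h))

theorem isMinimalFace_of_zero {p q : Span D} (h : Trivial p ∨ Trivial q) :
    IsMinimalFace D.dag.gPolytope {gVec p.route, gVec q.route} D.dag.gPolytope := by
  refine isMinimalFace_gPolytope fun F _ mp mq => ?_
  rcases h with h | h
  · rwa [h.gVec_eq_zero] at mp
  · rwa [h.gVec_eq_zero] at mq

theorem supported_of_extreme {p q : Span D} (h2 : TwoLegs D) (hp : Extreme p) (hq : Extreme q)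
    (tp : ¬ Trivial p) (tq : ¬ Trivial q) (hc : ¬ Conflict p.route q.route) :
    Supported {p.route, q.route} := by
  rw [conflict_iff] at hc
  refine supported_pair tp tq hc ?_
  rw [not_or] at hc
  rintro (h | h)
  · exact not_nested_of_extreme h2 hp hq tp tq hc.2 h
  · exact not_nested_of_extreme h2 hq hp tq tp hc.1 h

theorem isMinimalFace_of_extreme {p q : Span D} (h2 : TwoLegs D) (hp : Extreme p)
    (hq : Extreme q) (hc : Conflict p.route q.route) :
    IsMinimalFace D.dag.gPolytope {gVec p.route, gVec q.route} D.dag.gPolytope := by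
  refine isMinimalFace_gPolytope fun F hF mp mq => ?_
  rcases (conflict_iff p q).1 hc with h | h
  · exact zero_mem_of_extreme h2 hp hq h hF mp mq
  · exact zero_mem_of_extreme h2 hq hp h hF mq mp

theorem array_faces_of_or {p q t₁ t₂ : Span D}
    (h : D.IsArray p.route q.route t₁.route t₂.route ∨ D.IsArray q.route p.route t₁.route t₂.route)
    (ha : ¬ (TwoLegs D ∧ Extreme p ∧ Extreme q)) :
    (Trivial t₁ ∨ Trivial t₂ →
      (∃ F, IsFacet D.dag.gPolytope F ∧ gVec p.route ∈ F) ∧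
      (∃ F, IsFacet D.dag.gPolytope F ∧ gVec q.route ∈ F) ∧
      (¬ ∃ F, IsFacet D.dag.gPolytope F ∧ gVec p.route ∈ F ∧ gVec q.route ∈ F) ∧
      IsMinimalFace D.dag.gPolytope {gVec p.route, gVec q.route} D.dag.gPolytope) ∧
    (¬ (Trivial t₁ ∨ Trivial t₂) →
      IsMinimalFace D.dag.gPolytope {gVec p.route, gVec q.route}
        (convexHull ℝ (gVec '' {p.route, q.route, t₁.route, t₂.route}))) := by
  rcases h with h | h
  · exact array_faces h ha
  · have h := array_faces h fun k => ha ⟨k.1, k.2.2, k.2.1⟩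
    rw [Set.pair_comm (gVec q.route), Set.insert_comm q.route] at h
    refine ⟨fun ht => ?_, h.2⟩
    obtain ⟨h1, h2, h3, h4⟩ := h.1 ht
    exact ⟨h2, h1, fun ⟨F, h5, h6, h7⟩ => h3 ⟨F, h5, h7, h6⟩, h4⟩

end Span

end LabShape

open FramedDag in
theorem lemma4p11 (D : LabShape) (R S : D.LabRoute) :
    -- both routes are anomalous
    (D.IsAnomalous R ∧ D.IsAnomalous S →
      (S ∈ D.NW R ∪ D.SE R ↔ Conflict R S) ∧
      (Conflict R S → IsMinimalFace D.dag.gPolytope {gVec R, gVec S} D.dag.gPolytope) ∧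
      (Coherent R S →
        (IsExceptional R ∨ IsExceptional S →
          IsMinimalFace D.dag.gPolytope {gVec R, gVec S} D.dag.gPolytope) ∧
        (¬ (IsExceptional R ∨ IsExceptional S) →
          IsMinimalFace D.dag.gPolytope {gVec R, gVec S} (segment ℝ (gVec R) (gVec S)) ∧
          (R ≠ S → IsEdge D.dag.gPolytope (gVec R) (gVec S))))) ∧
    -- the routes are not both anomalous
    (¬ (D.IsAnomalous R ∧ D.IsAnomalous S) →
      -- the further corners of a rectangle subtended by `R` and `S` are unique
      ((∀ A ∈ ({D.west R, D.east R} : Set (Set D.LabRoute)),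
          ∀ B ∈ ({D.north S, D.south S} : Set (Set D.LabRoute)), (A ∩ B).Subsingleton) ∧
        (∀ A ∈ ({D.north R, D.south R} : Set (Set D.LabRoute)),
          ∀ B ∈ ({D.west S, D.east S} : Set (Set D.LabRoute)), (A ∩ B).Subsingleton)) ∧
      -- conflict and the minimal face
      ((S ∈ D.NW R ∪ D.SE R ↔ Conflict S R) ∧
        ∀ T₁ T₂ : D.LabRoute, D.IsArray R S T₁ T₂ ∨ D.IsArray S R T₁ T₂ →
          (IsExceptional T₁ ∨ IsExceptional T₂ →
            (∃ F, IsFacet D.dag.gPolytope F ∧ gVec R ∈ F) ∧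
            (∃ F, IsFacet D.dag.gPolytope F ∧ gVec S ∈ F) ∧
            (¬ ∃ F, IsFacet D.dag.gPolytope F ∧ gVec R ∈ F ∧ gVec S ∈ F) ∧
            IsMinimalFace D.dag.gPolytope {gVec R, gVec S} D.dag.gPolytope) ∧
          (¬ (IsExceptional T₁ ∨ IsExceptional T₂) →
            IsMinimalFace D.dag.gPolytope {gVec R, gVec S}
              (convexHull ℝ (gVec '' {R, S, T₁, T₂})))) ∧
      -- coherent routes: the implications that hold for all `R` and `S`
      (S ∈ D.NE R ∪ D.SW R →
        Coherent S R ∧ ¬ IsEdge D.dag.gPolytope (gVec R) (gVec S)) ∧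
      (Coherent S R ∧ IsEdge D.dag.gPolytope (gVec R) (gVec S) →
        S ∉ D.NW R ∪ D.NE R ∪ D.SE R ∪ D.SW R) ∧
      -- coherent routes: the equivalences for distinct vertices of the polytope
      (R ≠ S → ¬ IsExceptional R → ¬ IsExceptional S →
        (S ∈ D.NE R ∪ D.SW R ↔
          Coherent S R ∧ ¬ IsEdge D.dag.gPolytope (gVec R) (gVec S)) ∧
        (S ∉ D.NW R ∪ D.NE R ∪ D.SE R ∪ D.SW R ↔
          Coherent S R ∧ IsEdge D.dag.gPolytope (gVec R) (gVec S)))) := by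
  obtain ⟨p, rfl⟩ := LabShape.exists_span R
  obtain ⟨q, rfl⟩ := LabShape.exists_span S
  rw [LabShape.Span.isAnomalous_iff, LabShape.Span.isAnomalous_iff,
    LabShape.Span.isExceptional_iff, LabShape.Span.isExceptional_iff]
  have hNW : q.route ∈ D.NW p.route ∪ D.SE p.route ↔ Conflict p.route q.route :=
    (LabShape.Span.mem_NW_union_SE_iff p q).trans (LabShape.Span.conflict_iff p q).symm
  have hcomm := LabShape.Span.conflict_comm p q
  constructor
  · rintro ⟨⟨h2, hp⟩, -, hq⟩
    refine ⟨hNW, LabShape.Span.isMinimalFace_of_extreme h2 hp hq,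
      fun hc => ⟨LabShape.Span.isMinimalFace_of_zero, fun hex => ?_⟩⟩
    rw [not_or] at hex
    have hs := LabShape.Span.supported_of_extreme h2 hp hq hex.1 hex.2 hc
    exact ⟨LabShape.Span.isMinimalFace_segment hs, LabShape.Span.isEdge_of_supported hs hex.1⟩
  · intro ha
    have ha' : ¬ (LabShape.Span.TwoLegs D ∧ p.Extreme ∧ q.Extreme) :=
      fun h => ha ⟨⟨h.1, h.2.1⟩, h.1, h.2.2⟩
    have hb := LabShape.Span.not_conflict_not_isEdge ha'
    have hout := LabShape.Span.not_mem_iff p q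
    refine ⟨⟨fun A hA B hB => LabShape.Span.subsingleton_corner ha' hA hB, fun A hA B hB => ?_⟩,
      ⟨hNW.trans hcomm.symm, fun T₁ T₂ hT => ?_⟩, hb, fun h => ?_,
      fun hne hp hq => ⟨⟨hb, fun h => ?_⟩, ?_⟩⟩
    · rw [Set.inter_comm]
      exact LabShape.Span.subsingleton_corner (fun h => ha' ⟨h.1, h.2.2, h.2.1⟩) hB hA
    · obtain ⟨t₁, rfl⟩ := LabShape.exists_span T₁
      obtain ⟨t₂, rfl⟩ := LabShape.exists_span T₂
      rw [LabShape.Span.isExceptional_iff, LabShape.Span.isExceptional_iff]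
      exact LabShape.Span.array_faces_of_or hT ha'
    · exact hout.2 ⟨h.1, fun k => (hb k).2 h.2⟩
    · by_contra k
      exact h.2 (LabShape.Span.isEdge_of_not_mem hne hp hq h.1 k)
    · exact ⟨fun h => ⟨(hout.1 h).1, LabShape.Span.isEdge_of_not_mem hne hp hq (hout.1 h).1
        (hout.1 h).2⟩, fun h => hout.2 ⟨h.1, fun k => (hb k).2 h.2⟩⟩
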